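/- A virtual link diagram is a generic plane diagram of finitely many oriented closed curves whose double points are marked as classical crossings (with over/under information) or as virtual crossings. Two diagrams are equivalent if they are related by a finite sequence of the classical Reidemeister moves RI, RII, RIII and the virtual Reidemeister moves VRI, VRII, VRIII, SV; here VRI, VRII, VRIII are the versions of RI, RII, RIII with all crossings virtual, and SV moves a strand with two virtual crossings past a classical crossing. A virtual link is an equivalence class of diagrams, and a diagram is trivial if it is equivalent to a diagram without double points. A diagram $D$ is $(m,n)$-unknottable if one obtains a trivial diagram from it by turning $m$ of its classical crossings into virtual ones and applying crossing changes at $n$ other classical crossings. The unknotting index $U(D)$ is the least such pair $(m,n)\in\mathbb{N}^2$ in the dictionary order, and the unknotting index $U(L)$ of a virtual link $L$ is the minimum of $U(D)$ over all diagrams $D$ of $L$. A base point sequence $a=\langle a_1,\dots,a_n\rangle$ of $D$ consists of an ordering $D^1,\dots,D^n$ of the components of $D$ and a non-crossing point $a_i$ on each $D^i$. A classical self crossing of $D^i$ is a warping crossing point if, moving from $a_i$ along the orientation, one meets it first at its under passage; a classical crossing between $D^i$ and $D^j$ with $i<j$ is a warping crossing point if $D^i$ is the under strand there. Let $d(D_a)$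 be the minimum number of classical crossings that have to be changed so that the resulting diagram, with base point sequence $a$, has no warping crossing point. The warping degree is $d(D)=\min_a d(D_a)$. **Theorem 2.6.** If $D$ is a diagram of a virtual link $L$ and $D$ has $v$ virtual crossings, then $U(L)$ exists and $$U(L)\le (v,\,d(D))$$ in the dictionary order. -/

import Mathlib

/-!
Oriented virtual link diagrams, encoded as oriented 4-valent plane maps.

At a transverse double point `c` of two oriented strands, rotate the picture so that one strand
runs to the north-east and the other to the north-west.  The passage `(c, false)` is the
north-east strand, which crosses the other strand from its left to its right, and `(c, true)` is
the north-west strand.  The edges of the diagram run from a passage to the next passage along the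
orientation, so a permutation `next` of the passages records the whole oriented plane graph, and an
edge is named by the passage `p` at which it starts (it ends at `next p`).
-/

/-- The kind of a double point: a positive or a negative classical crossing, or a virtual crossing.
At a positive crossing the north-east strand is the over strand, at a negative crossing the
north-west strand is. -/
inductive CrossingKind
  | pos
  | neg
  | virt

/-- The crossing change on kinds. -/
def CrossingKind.change : CrossingKind → CrossingKind
  | .pos => .neg
  | .neg => .pos
  | .virt => .virt

/-- Walking along the boundaries of the faces, with the face on the left-hand side.
A dart is a pair `(p, b)`: the edge starting at the passage `p`, walked along its orientation if
`b = true` and against it if `b = false`.  At the end of a dart, one turns left. -/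
def faceNext {C : Type} (next : Equiv.Perm (C × Bool)) :
    (C × Bool) × Bool → (C × Bool) × Bool
  | (p, true) =>
      match next p with
      | (c, false) => ((c, true), true)
      | (c, true) => (next.symm (c, false), false)
  | ((c, false), false) => (next.symm (c, true), false)
  | ((c, true), false) => ((c, false), true)

/-- The crossing at which a dart starts. -/
def dartStart {C : Type} (next : Equiv.Perm (C × Bool)) : (C × Bool) × Bool → C
  | (p, true) => p.1
  | (p, false) => (next p).1

/-- Number of faces: the number of cycles of `faceNext`. -/
noncomputable def numFaces {C : Type} (next : Equiv.Perm (C × Bool)) : ℕ :=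
  Nat.card (Quot fun d e => faceNext next d = e)

/-- Number of connected components of the underlying graph, whose vertices are the crossings. -/
noncomputable def numPieces {C : Type} (next : Equiv.Perm (C × Bool)) : ℕ :=
  Nat.card (Quot fun c d : C => ∃ s, (next (c, s)).1 = d)

/-- All pieces of the map are plane: `V - E + F` is twice the number of pieces.  Here
`E = 2 V`, since the graph is 4-valent. -/
def IsPlanarCode {C : Type} (next : Equiv.Perm (C × Bool)) : Prop :=
  ((Nat.card C : ℤ) - Nat.card (C × Bool)) + numFaces next = 2 * numPieces next

/-- An oriented virtual link diagram: a plane code with a kind for each double point,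
together with a number of circles without double points. -/
structure VirtualDiagram where
  /-- the double points, classical and virtual -/
  C : Type
  [fintypeC : Fintype C]
  [decEqC : DecidableEq C]
  /-- the passage that follows a given one along the orientation -/
  next : Equiv.Perm (C × Bool)
  kind : C → CrossingKind
  /-- the number of components without double points -/
  circles : ℕ
  planar : IsPlanarCode next

attribute [instance] VirtualDiagram.fintypeC VirtualDiagram.decEqC

namespace VirtualDiagram

/-- `c` is a classical crossing. -/
def IsClassical (D : VirtualDiagram) (c : D.C) : Prop := D.kind c ≠ .virt

/-- The passage `p` is the over passage of a classical crossing. -/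
def IsOver (D : VirtualDiagram) (p : D.C × Bool) : Prop :=
  (D.kind p.1 = .pos ∧ p.2 = false) ∨ (D.kind p.1 = .neg ∧ p.2 = true)

/-- The passage `p` is the under passage of a classical crossing. -/
def IsUnder (D : VirtualDiagram) (p : D.C × Bool) : Prop :=
  (D.kind p.1 = .pos ∧ p.2 = true) ∨ (D.kind p.1 = .neg ∧ p.2 = false)

/-- The number of virtual crossings. -/
noncomputable def numVirtual (D : VirtualDiagram) : ℕ := Nat.card {c : D.C // D.kind c = .virt}

/-- The number of components of the link: the cycles of `next`, and the circles. -/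
noncomputable def numComponents (D : VirtualDiagram) : ℕ :=
  Nat.card (Quot fun p q => D.next p = q) + D.circles

/-- Virtualization of the crossings in `S`. -/
def virtualize (D : VirtualDiagram) (S : Finset D.C) : VirtualDiagram where
  C := D.C
  next := D.next
  kind c := if c ∈ S then .virt else D.kind c
  circles := D.circles
  planar := D.planar

/-- Crossing change at the crossings in `T`. -/
def changeCrossings (D : VirtualDiagram) (T : Finset D.C) : VirtualDiagram where
  C := D.C
  next := D.next
  kind c := if c ∈ T then (D.kind c).change else D.kind c
  circles := D.circles
  planar := D.planar

/-! ### Reidemeister moves -/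

/-- `D` and `D'` are the same diagram, up to the names of the crossings. -/
def Iso (D D' : VirtualDiagram) : Prop :=
  ∃ e : D.C ≃ D'.C,
    (∀ p : D.C × Bool, D'.next (Prod.map e id p) = Prod.map e id (D.next p)) ∧
    (∀ c, D'.kind (e c) = D.kind c) ∧
    D'.circles = D.circles

/-- `D'` arises from `D` by dissolving the double points in `E`: each strand runs on as before, and
its passages through `E` are forgotten.  Components all of whose passages are forgotten become
circles, that is, the number of components does not change. -/
def Erases (D D' : VirtualDiagram) (E : Set D.C) : Prop :=
  ∃ f : D'.C ↪ D.C,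
    (∀ c, c ∈ Set.range f ↔ c ∉ E) ∧
    (∀ c, D'.kind c = D.kind (f c)) ∧
    (∀ p : D'.C × Bool, ∃ k : ℕ,
      D.next^[k + 1] (Prod.map f id p) = Prod.map f id (D'.next p) ∧
      ∀ j < k, (D.next^[j + 1] (Prod.map f id p)).1 ∈ E) ∧
    D'.numComponents = D.numComponents

/-- The dart `d` bounds a face with one corner. -/
def IsMonogon (D : VirtualDiagram) (d : (D.C × Bool) × Bool) : Prop :=
  faceNext D.next d = d

/-- The dart `d` lies on a face with two edges, with corners `x` and `y` that are distinct;
`x` and `y` are the ends of the edge of `d`. -/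
def IsBigon (D : VirtualDiagram) (d : (D.C × Bool) × Bool) (x y : D.C) : Prop :=
  (faceNext D.next)^[2] d = d ∧
  dartStart D.next d = x ∧ dartStart D.next (faceNext D.next d) = y ∧ x ≠ y

/-- The dart `d` lies on a face with three edges, with corners `x`, `y`, `z` that are distinct;
`x` and `y` are the ends of the edge of `d`. -/
def IsTriangle (D : VirtualDiagram) (d : (D.C × Bool) × Bool) (x y z : D.C) : Prop :=
  (faceNext D.next)^[3] d = d ∧
  dartStart D.next d = x ∧ dartStart D.next (faceNext D.next d) = y ∧
  dartStart D.next ((faceNext D.next)^[2] d) = z ∧ x ≠ y ∧ y ≠ z ∧ x ≠ z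

/-- The strand that contains the edge of `d` goes over at both ends of this edge. -/
def IsOverEdge (D : VirtualDiagram) (d : (D.C × Bool) × Bool) : Prop :=
  D.IsOver d.1 ∧ D.IsOver (D.next d.1)

/-- For the three edges of the triangle of `d`, exchange the two passages at its ends. -/
def triangleSwap (D : VirtualDiagram) (d : (D.C × Bool) × Bool) : Equiv.Perm (D.C × Bool) :=
  Equiv.swap d.1 (D.next d.1) *
  Equiv.swap (faceNext D.next d).1 (D.next (faceNext D.next d).1) *
  Equiv.swap ((faceNext D.next)^[2] d).1 (D.next ((faceNext D.next)^[2] d).1)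

/-- `D'` arises from `D` by turning over the triangle of `d`: the three strands involved each meet
the two others in the opposite order; the kinds of the crossings are kept. -/
def FlipsTriangle (D D' : VirtualDiagram) (d : (D.C × Bool) × Bool) : Prop :=
  ∃ e : D.C ≃ D'.C,
    (∀ p : D.C × Bool, D'.next (Prod.map e id (D.triangleSwap d p)) =
      Prod.map e id (D.triangleSwap d (D.next p))) ∧
    (∀ c, D'.kind (e c) = D.kind c) ∧
    D'.circles = D.circles

/-- The classical and the virtual Reidemeister moves.  The moves of types I and II are written in
the direction that removes crossings. -/
inductive Move : VirtualDiagram → VirtualDiagram → Prop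
  | iso {D D'} : Iso D D' → Move D D'
  | RI {D D'} (d : (D.C × Bool) × Bool) :
      D.IsMonogon d → D.IsClassical (dartStart D.next d) →
      Erases D D' {dartStart D.next d} → Move D D'
  | VRI {D D'} (d : (D.C × Bool) × Bool) :
      D.IsMonogon d → D.kind (dartStart D.next d) = .virt →
      Erases D D' {dartStart D.next d} → Move D D'
  | RII {D D'} (d : (D.C × Bool) × Bool) (x y : D.C) :
      D.IsBigon d x y → D.IsOverEdge d → Erases D D' {x, y} → Move D D'
  | VRII {D D'} (d : (D.C × Bool) × Bool) (x y : D.C) :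
      D.IsBigon d x y → D.kind x = .virt → D.kind y = .virt → Erases D D' {x, y} → Move D D'
  | RIII {D D'} (d : (D.C × Bool) × Bool) (x y z : D.C) :
      D.IsTriangle d x y z → D.IsOverEdge d → D.IsClassical z →
      FlipsTriangle D D' d → Move D D'
  | VRIII {D D'} (d : (D.C × Bool) × Bool) (x y z : D.C) :
      D.IsTriangle d x y z → D.kind x = .virt → D.kind y = .virt → D.kind z = .virt →
      FlipsTriangle D D' d → Move D D'
  | SV {D D'} (d : (D.C × Bool) × Bool) (x y z : D.C) :
      D.IsTriangle d x y z → D.kind x = .virt → D.kind y = .virt → D.IsClassical z →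
      FlipsTriangle D D' d → Move D D'

/-- Equivalence of virtual link diagrams: finite sequences of moves, in both directions. -/
def equivalence : Setoid VirtualDiagram := Relation.EqvGen.setoid Move

/-- `D` is a diagram of a trivial link: it is equivalent to a diagram without double points. -/
def IsTrivial (D : VirtualDiagram) : Prop :=
  ∃ D₀ : VirtualDiagram, IsEmpty D₀.C ∧ equivalence D D₀

/-! ### The unknotting index of a diagram -/

/-- `D` is `(m, n)`-unknottable. -/
def IsUnknottable (D : VirtualDiagram) (m n : ℕ) : Prop :=
  ∃ S T : Finset D.C,
    (∀ c ∈ S, D.IsClassical c) ∧ (∀ c ∈ T, D.IsClassical c) ∧ Disjoint S T ∧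
    S.card = m ∧ T.card = n ∧
    ((D.virtualize S).changeCrossings T).IsTrivial

/-- `u` is the unknotting index `U(D)`: the least pair, in the dictionary order, for which `D` is
unknottable. -/
def IsUnknottingIndex (D : VirtualDiagram) (u : ℕ ×ₗ ℕ) : Prop :=
  IsLeast {w : ℕ ×ₗ ℕ | D.IsUnknottable (ofLex w).1 (ofLex w).2} u

end VirtualDiagram

/-! ### The warping degree -/

/-- A base point sequence: an ordering of the components that have double points, and an edge on
each of them.  The base point `pt i` is the middle of the edge that starts at the passage `pt i`.
Components without double points have no influence on what follows. -/
structure BasePointSequence {C : Type} (next : Equiv.Perm (C × Bool)) where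
  length : ℕ
  pt : Fin length → C × Bool
  cover : ∀ p, ∃! i, next.SameCycle (pt i) p

/-- Starting at the `i`-th base point and moving along the orientation, the passage `q` is
encountered for the first time after `k` other passages. -/
def BasePointSequence.Encounters {C : Type} {next : Equiv.Perm (C × Bool)}
    (a : BasePointSequence next) (i : Fin a.length) (k : ℕ) (q : C × Bool) : Prop :=
  next^[k + 1] (a.pt i) = q ∧ ∀ j < k, next^[j + 1] (a.pt i) ≠ q

/-- Going through the components in their order, each from its base point, the passage `q` is
encountered before the passage `r`. -/
def BasePointSequence.Before {C : Type} {next : Equiv.Perm (C × Bool)}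
    (a : BasePointSequence next) (q r : C × Bool) : Prop :=
  ∃ i j k l, a.Encounters i k q ∧ a.Encounters j l r ∧ (i < j ∨ (i = j ∧ k < l))

namespace VirtualDiagram

/-- `c` is a warping crossing point of the based diagram `D_a`: its under passage comes first.  For
a self crossing, it is first encountered at the under passage; for a crossing between the
components `i < j`, it is an under crossing of the component `i`. -/
def IsWarping (D : VirtualDiagram) (a : BasePointSequence D.next) (c : D.C) : Prop :=
  ∃ s : Bool, D.IsUnder (c, s) ∧ a.Before (c, s) (c, !s)

/-- The warping degree of the based diagram `D_a`: the least number of crossings that have to be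
changed so that no warping crossing points are left. -/
noncomputable def warpingDegreeAt (D : VirtualDiagram) (a : BasePointSequence D.next) : ℕ :=
  sInf {k | ∃ T : Finset D.C, (∀ c ∈ T, D.IsClassical c) ∧ T.card = k ∧
    ∀ c : D.C, ¬ (D.changeCrossings T).IsWarping a c}

/-- The warping degree of `D`: the minimum over all base point sequences. -/
noncomputable def warpingDegree (D : VirtualDiagram) : ℕ :=
  sInf (Set.range D.warpingDegreeAt)

end VirtualDiagram

/-! ### Virtual links -/

/-- A virtual link is an equivalence class of diagrams. -/
def VirtualLink : Type 1 := Quotient VirtualDiagram.equivalence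

/-- `D` is a diagram of `L`. -/
def VirtualDiagram.IsDiagramOf (D : VirtualDiagram) (L : VirtualLink) : Prop :=
  Quotient.mk VirtualDiagram.equivalence D = L

/-- `u` is the unknotting index `U(L)`: the minimum of `U(D)` over all diagrams `D` of `L`. -/
def VirtualLink.IsUnknottingIndex (L : VirtualLink) (u : ℕ ×ₗ ℕ) : Prop :=
  IsLeast {w : ℕ ×ₗ ℕ | ∃ D : VirtualDiagram, D.IsDiagramOf L ∧ D.IsUnknottingIndex w} u

open Module

/-! A classical diagram that descends from some base point sequence is trivial, so it suffices to
reach one from a diagram equivalent to `D` by `v` virtualizations and `d(D)` crossing changes.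
Changing a set of crossings that realises the warping degree makes every classical crossing of `D`
descend; only the virtual crossings are left. Next to a virtual crossing `c`, push by RII a finger
of one of its strands across the other (`exists_corner`, `equivalence_fingerDiagram`). Of the two
new classical crossings, one forms a bigon with `c`. Once that one is virtualized, VRII removes it
together with `c`, and the other new crossing takes the place of `c`, with a sign that was free to
choose (`equivalence_moveCorner`, `exists_replace`). So one virtualization for each virtual crossing
makes `D` classical, with arbitrary signs at the former virtual crossings. Putting the earlier
passage over there gives a descending diagram (`descending_withKind`, `exists_isUnknottable`). The
dictionary order on pairs is a well-order, hence the minima exist and obey the bound.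

The bulk of the proof is that descending classical diagrams are trivial (`Descending.isTrivial`), by
induction on the number of crossings. Follow the strand from the first base point until it meets a
double point for the second time; all its passages so far go over. Either it has closed up a loop
with one corner, or it has run once around a component without self-crossings, which a kink turns
into such a loop (`exists_erasesVia_strand`, `exists_erasesVia_component`). The loop has an inside
by a Jordan curve argument modulo 2 (`Loop.exists_inside`). As long as an edge joins the loop to a
double point inside, RII followed by RIII pushes the loop over that point, and the number of points
inside drops (`exists_erasesVia_of_inside`). When no such edge is left, the inward edges at the loop
are chords that do not cross; an innermost one cuts off a bigon, which RII removes, and RI finishes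
(`Loop.exists_adjacent`, `exists_erasesVia_of_chords`). The net effect is to forget the crossings on
the loop, so the smaller diagram still descends (`Descending.of_erasesVia`).

A diagram contains a proof of Euler's formula, so every modified code has to be shown plane. This
rests on `isPlanarCode_iff`: a code is plane iff every cycle modulo 2 is the boundary of a function
on the faces. For each modification, a cycle of the new code is carried to the old one, bounded
there, and the bounding function is carried back. -/

namespace PlaneCode

/-! ### A homological criterion for planarity -/

section Invariants

variable {X : Type} (r : X → X → Prop)

/-- The functions with values in the field of two elements that are constant along `r`. -/
def invariants : Submodule (ZMod 2) (X → ZMod 2) where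
  carrier := {w | ∀ x y, r x y → w x = w y}
  add_mem' := by
    intro v w hv hw x y h
    simp [hv x y h, hw x y h]
  zero_mem' := by intro x y _; rfl
  smul_mem' := by
    intro a w hw x y h
    simp [hw x y h]

/-- Invariant functions are functions on the quotient. -/
def invariantsEquiv : invariants r ≃ₗ[ZMod 2] (Quot r → ZMod 2) where
  toFun w := Quot.lift w.1 w.2
  invFun u := ⟨fun x => u (Quot.mk r x), fun x y h => congrArg u (Quot.sound h)⟩
  map_add' v w := by
    funext q
    induction q using Quot.ind
    rfl
  map_smul' a w := by
    funext q
    induction q using Quot.ind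
    rfl
  left_inv w := rfl
  right_inv u := by
    funext q
    induction q using Quot.ind
    rfl

theorem finrank_invariants [Finite X] : finrank (ZMod 2) (invariants r) = Nat.card (Quot r) := by
  classical
  have : Fintype (Quot r) := Fintype.ofFinite _
  rw [(invariantsEquiv r).finrank_eq, Module.finrank_fintype_fun_eq_card, Nat.card_eq_fintype_card]

end Invariants

/-! ### Euler's formula as the vanishing of first homology modulo 2 -/

section Criterion

variable {C : Type} (next : Equiv.Perm (C × Bool))

/-- The boundary of a function on the faces. -/
def faceBoundary : ((C × Bool) × Bool → ZMod 2) →ₗ[ZMod 2] (C × Bool → ZMod 2) where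
  toFun w p := w (p, true) + w (p, false)
  map_add' v w := by
    funext p
    simp only [Pi.add_apply]
    ring
  map_smul' a w := by
    funext p
    simp [mul_add]

/-- The functions on the faces. -/
abbrev faceFunctions : Submodule (ZMod 2) ((C × Bool) × Bool → ZMod 2) :=
  invariants fun d e => faceNext next d = e

/-- The functions on the pieces. -/
abbrev pieceFunctions : Submodule (ZMod 2) (C → ZMod 2) :=
  invariants fun c d : C => ∃ s, (next (c, s)).1 = d

/-- There is one equation for each of the four corners at `c`, where the boundary of a face turns
from one edge to the next. -/
theorem faceFunctions_apply {w} (hw : w ∈ faceFunctions next) (c : C) :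
    w (next.symm (c, false), true) = w ((c, true), true) ∧
    w (next.symm (c, true), true) = w (next.symm (c, false), false) ∧
    w ((c, false), false) = w (next.symm (c, true), false) ∧
    w ((c, true), false) = w ((c, false), true) := by
  refine ⟨hw _ _ ?_, hw _ _ ?_, hw _ _ ?_, hw _ _ ?_⟩ <;> simp [faceNext]

theorem dartStart_faceNext (d : (C × Bool) × Bool) :
    dartStart next (faceNext next d) = match d with
      | (p, true) => (next p).1
      | (p, false) => p.1 := by
  rcases d with ⟨⟨c, s⟩, b⟩
  rcases hb : next (c, s) with ⟨c', s'⟩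
  cases s <;> cases b <;> cases s' <;> simp [faceNext, dartStart, hb]
variable [Fintype C] [DecidableEq C]

/-- The incidence matrix of edges and vertices. -/
def incidence : Matrix (C × Bool) C (ZMod 2) := fun p c =>
  (if p.1 = c then 1 else 0) + (if (next p).1 = c then 1 else 0)

theorem incidence_mulVec (f : C → ZMod 2) (p : C × Bool) :
    (incidence next).mulVec f p = f p.1 + f (next p).1 := by
  simp [incidence, Matrix.mulVec, dotProduct, add_mul, Finset.sum_add_distrib]

theorem incidence_transpose_mulVec (z : C × Bool → ZMod 2) (c : C) :
    (incidence next).transpose.mulVec z c =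
      z (c, false) + z (c, true) + (z (next.symm (c, false)) + z (next.symm (c, true))) := by
  have h : ∀ y : C × Bool → ZMod 2,
      ∑ p : C × Bool, (if p.1 = c then 1 else 0) * y p = y (c, false) + y (c, true) := by
    intro y
    rw [Fintype.sum_prod_type]
    simp [add_comm]
  have h2 : ∑ p : C × Bool, (if (next p).1 = c then 1 else 0) * z p =
      ∑ p : C × Bool, (if p.1 = c then 1 else 0) * z (next.symm p) := by
    rw [← Equiv.sum_comp next fun p : C × Bool =>
      (if p.1 = c then 1 else 0) * z (next.symm p)]
    simp
  simp only [incidence, Matrix.mulVec, dotProduct, Matrix.transpose_apply, add_mul,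
    Finset.sum_add_distrib]
  rw [h, h2, h]

/-- Functions on the pieces are the functions on the faces with zero boundary. -/
noncomputable def pieceEquiv : pieceFunctions next ≃ₗ[ZMod 2]
    LinearMap.ker ((faceBoundary (C := C)).domRestrict (faceFunctions next)) := by
  have h1 (g : pieceFunctions next) :
      (fun d => g.1 (dartStart next d)) ∈ faceFunctions next := by
    rintro d _ rfl
    change g.1 _ = g.1 _
    rw [dartStart_faceNext]
    rcases d with ⟨p, _ | _⟩
    · exact (g.2 _ _ ⟨p.2, rfl⟩).symm
    · exact g.2 _ _ ⟨p.2, rfl⟩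
  have h2 (g : pieceFunctions next) : (⟨_, h1 g⟩ : faceFunctions next) ∈
      LinearMap.ker ((faceBoundary (C := C)).domRestrict (faceFunctions next)) := by
    rw [LinearMap.mem_ker]
    funext p
    have h : g.1 p.1 = g.1 (next p).1 := g.2 _ _ ⟨p.2, rfl⟩
    simp [faceBoundary, dartStart, h, CharTwo.add_self_eq_zero]
  refine LinearEquiv.ofBijective
    { toFun := fun g => ⟨⟨_, h1 g⟩, h2 g⟩
      map_add' := fun _ _ => rfl
      map_smul' := fun _ _ => rfl } ⟨?_, ?_⟩
  · intro g g' h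
    ext c
    have := congrFun (congrArg (fun x => x.1.1) h) ((c, false), true)
    simpa [dartStart] using this
  · rintro ⟨⟨w, hw⟩, hk⟩
    have hb : ∀ p, w (p, true) = w (p, false) := by
      intro p
      have := congrFun (LinearMap.mem_ker.1 hk) p
      exact CharTwo.add_eq_zero.1 this
    -- Since `w` agrees on the two sides of every edge, the corner equations carry its value all
    -- around a crossing: it depends only on the crossing at which a dart starts.
    have key : ∀ d, w ((dartStart next d, false), true) = w d := by
      rintro ⟨p, _ | _⟩
      · obtain ⟨q, rfl⟩ := next.symm.surjective p
        obtain ⟨h1, h2, h3, h4⟩ := faceFunctions_apply next hw q.1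
        have e1 := hb (q.1, false)
        have e2 := hb (q.1, true)
        have e3 := hb (next.symm (q.1, false))
        have e4 := hb (next.symm (q.1, true))
        rcases q with ⟨c, _ | _⟩ <;> simp only [dartStart, Equiv.apply_symm_apply] at * <;> grind
      · obtain ⟨h1, h2, h3, h4⟩ := faceFunctions_apply next hw p.1
        have e2 := hb (p.1, true)
        rcases p with ⟨c, _ | _⟩
        · rfl
        · simp only [dartStart] at *
          grind
    refine ⟨⟨fun c => w ((c, false), true), ?_⟩, ?_⟩
    · rintro c _ ⟨s, rfl⟩
      have h1 := key ((c, s), true)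
      have h2 := key ((c, s), false)
      simp only [dartStart] at h1 h2
      change w _ = w _
      rw [h1, h2, hb]
    · ext d
      exact key d

theorem ker_incidence : LinearMap.ker (incidence next).mulVecLin = pieceFunctions next := by
  ext g
  rw [LinearMap.mem_ker]
  constructor
  · rintro h c _ ⟨s, rfl⟩
    have := congrFun h (c, s)
    rw [Matrix.mulVecLin_apply, incidence_mulVec] at this
    exact CharTwo.add_eq_zero.1 this
  · intro h
    funext p
    rw [Matrix.mulVecLin_apply, incidence_mulVec]
    exact CharTwo.add_eq_zero.2 (h _ _ ⟨p.2, rfl⟩)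

/-- Each of the four corners at a crossing lies between two of its edges, so its value is counted
twice. -/
theorem boundary_mem_cycles {w} (hw : w ∈ faceFunctions next) :
    (incidence next).transpose.mulVec (faceBoundary w) = 0 := by
  funext c
  rw [incidence_transpose_mulVec]
  obtain ⟨h1, h2, h3, h4⟩ := faceFunctions_apply next hw c
  simp only [faceBoundary, LinearMap.coe_mk, AddHom.coe_mk, Pi.zero_apply]
  grind

/-- A code is plane iff every cycle modulo 2 bounds. -/
theorem isPlanarCode_iff_cycles : IsPlanarCode next ↔
    ∀ z, (incidence next).transpose.mulVec z = 0 → ∃ w ∈ faceFunctions next, faceBoundary w = z := by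
  set Z := LinearMap.ker (incidence next).transpose.mulVecLin with hZ
  set d := (faceBoundary (C := C)).domRestrict (faceFunctions next) with hd
  have hle : LinearMap.range d ≤ Z := by
    rintro _ ⟨w, rfl⟩
    rw [hZ, LinearMap.mem_ker]
    exact boundary_mem_cycles next w.2
  -- With `P` pieces, rank-nullity gives dimension `F - P` for the boundaries and `E - V + P` for
  -- the cycles. As boundaries are cycles, the two spaces agree exactly when `V - E + F = 2P`.
  have h1 : finrank (ZMod 2) (LinearMap.range d) + numPieces next = numFaces next := by
    have h := LinearMap.finrank_range_add_finrank_ker d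
    rw [← (pieceEquiv next).finrank_eq, finrank_invariants, finrank_invariants] at h
    exact h
  have h2 : (incidence next).rank + numPieces next = Nat.card C := by
    have h := LinearMap.finrank_range_add_finrank_ker (incidence next).mulVecLin
    rw [ker_incidence, finrank_invariants, Module.finrank_fintype_fun_eq_card] at h
    rw [Nat.card_eq_fintype_card]
    exact h
  have h3 : (incidence next).rank + finrank (ZMod 2) Z = Nat.card (C × Bool) := by
    have h := LinearMap.finrank_range_add_finrank_ker (incidence next).transpose.mulVecLin
    rw [Module.finrank_fintype_fun_eq_card] at h
    rw [Nat.card_eq_fintype_card, ← h, ← Matrix.rank_transpose]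
    rfl
  have h4 : Nat.card (C × Bool) = 2 * Nat.card C := by
    rw [Nat.card_prod, Nat.card_eq_fintype_card (α := Bool), Fintype.card_bool, mul_comm]
  have h5 : IsPlanarCode next ↔ finrank (ZMod 2) (LinearMap.range d) = finrank (ZMod 2) Z := by
    unfold IsPlanarCode
    omega
  rw [h5]
  constructor
  · intro h z hz
    have he := Submodule.eq_of_le_of_finrank_eq hle h
    have : z ∈ LinearMap.range d := by
      rw [he]
      exact hz
    obtain ⟨w, hw⟩ := this
    exact ⟨w.1, w.2, hw⟩
  · intro h
    have : LinearMap.range d = Z := by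
      refine le_antisymm hle fun z hz => ?_
      obtain ⟨w, hw, e⟩ := h z hz
      exact ⟨⟨w, hw⟩, e⟩
    rw [this]

end Criterion

/-! ### Half-edges -/

variable {C : Type}

/-- A half-edge `(q, b)` is the outgoing end of the passage `q` if `b = true` and its incoming end
if `b = false`. -/
abbrev HalfEdge (C : Type) := (C × Bool) × Bool

/-- The counterclockwise quarter turn about a vertex. -/
def rot (h : HalfEdge C) : HalfEdge C := ((h.1.1, !h.1.2), xor h.2 h.1.2)

/-- The clockwise quarter turn about a vertex. -/
def rotInv (h : HalfEdge C) : HalfEdge C := ((h.1.1, !h.1.2), xor h.2 !h.1.2)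

/-- The opposite half-edge at the same vertex. -/
def opp (h : HalfEdge C) : HalfEdge C := (h.1, !h.2)

@[simp] theorem rot_rotInv (h : HalfEdge C) : rot (rotInv h) = h := by
  rcases h with ⟨⟨c, _ | _⟩, _ | _⟩ <;> rfl

@[simp] theorem rotInv_rot (h : HalfEdge C) : rotInv (rot h) = h := by
  rcases h with ⟨⟨c, _ | _⟩, _ | _⟩ <;> rfl

@[simp] theorem rot_rot (h : HalfEdge C) : rot (rot h) = opp h := by
  rcases h with ⟨⟨c, _ | _⟩, _ | _⟩ <;> rfl

@[simp] theorem rotInv_rotInv (h : HalfEdge C) : rotInv (rotInv h) = opp h := by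
  rcases h with ⟨⟨c, _ | _⟩, _ | _⟩ <;> rfl

@[simp] theorem opp_opp (h : HalfEdge C) : opp (opp h) = h := by
  rcases h with ⟨⟨c, _ | _⟩, _ | _⟩ <;> rfl

@[simp] theorem rot_opp (h : HalfEdge C) : rot (opp h) = rotInv h := by
  rcases h with ⟨⟨c, _ | _⟩, _ | _⟩ <;> rfl

@[simp] theorem opp_rot (h : HalfEdge C) : opp (rot h) = rotInv h := by
  rcases h with ⟨⟨c, _ | _⟩, _ | _⟩ <;> rfl

@[simp] theorem rotInv_opp (h : HalfEdge C) : rotInv (opp h) = rot h := by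
  rcases h with ⟨⟨c, _ | _⟩, _ | _⟩ <;> rfl

@[simp] theorem opp_rotInv (h : HalfEdge C) : opp (rotInv h) = rot h := by
  rcases h with ⟨⟨c, _ | _⟩, _ | _⟩ <;> rfl

@[simp] theorem rot_fst_fst (h : HalfEdge C) : (rot h).1.1 = h.1.1 := rfl
@[simp] theorem rotInv_fst_fst (h : HalfEdge C) : (rotInv h).1.1 = h.1.1 := rfl
@[simp] theorem opp_fst (h : HalfEdge C) : (opp h).1 = h.1 := rfl
@[simp] theorem opp_snd (h : HalfEdge C) : (opp h).2 = !h.2 := rfl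

/-- Half-edges at the same vertex differ by a rotation. -/
theorem eq_of_vert_eq {g h : HalfEdge C} (e : g.1.1 = h.1.1) :
    g = h ∨ g = rot h ∨ g = opp h ∨ g = rotInv h := by
  rcases g with ⟨⟨c, _ | _⟩, _ | _⟩ <;> rcases h with ⟨⟨c', _ | _⟩, _ | _⟩ <;>
    simp_all [rot, rotInv, opp]

/-- The other end of the edge of a half-edge. -/
def flip (next : Equiv.Perm (C × Bool)) (h : HalfEdge C) : HalfEdge C :=
  if h.2 then (next h.1, false) else (next.symm h.1, true)

variable (next : Equiv.Perm (C × Bool))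

@[simp] theorem flip_true (q : C × Bool) : flip next (q, true) = (next q, false) := rfl

@[simp] theorem flip_false (q : C × Bool) : flip next (q, false) = (next.symm q, true) := rfl

@[simp] theorem flip_flip (h : HalfEdge C) : flip next (flip next h) = h := by
  rcases h with ⟨q, _ | _⟩ <;> simp

@[simp] theorem flip_snd (h : HalfEdge C) : (flip next h).2 = !h.2 := by
  rcases h with ⟨q, _ | _⟩ <;> rfl

theorem flip_ne (h : HalfEdge C) : flip next h ≠ h := by
  intro e
  have := congrArg Prod.snd e
  simp at this

theorem flip_injective : Function.Injective (flip next) :=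
  Function.LeftInverse.injective (flip_flip next)

theorem flip_eq_iff {g h : HalfEdge C} : flip next g = h ↔ g = flip next h := by
  constructor <;> rintro rfl <;> simp

/-- Running on along the strand. -/
def str (h : HalfEdge C) : HalfEdge C := opp (flip next h)

/-- Running along the boundary of the face on the left. -/
def face (h : HalfEdge C) : HalfEdge C := rotInv (flip next h)

theorem str_injective : Function.Injective (str next) := fun g h e =>
  flip_injective next (by simpa [str] using congrArg opp e)

/-- The name of the edge of a half-edge. -/
def edgeName (h : HalfEdge C) : C × Bool := if h.2 then h.1 else next.symm h.1

/-- The dart that starts with a half-edge. -/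
def toDart (h : HalfEdge C) : (C × Bool) × Bool := (edgeName next h, h.2)

@[simp] theorem toDart_fst (h : HalfEdge C) : (toDart next h).1 = edgeName next h := rfl

theorem faceNext_toDart (h : HalfEdge C) :
    faceNext next (toDart next h) = toDart next (face next h) := by
  rcases h with ⟨q, _ | _⟩
  · rcases e : next.symm q with ⟨c, _ | _⟩ <;>
      simp [toDart, edgeName, faceNext, face, rotInv, flip, e]
  · rcases e : next q with ⟨c, _ | _⟩ <;>
      simp [toDart, edgeName, faceNext, face, rotInv, flip, e]

theorem dartStart_toDart (h : HalfEdge C) : dartStart next (toDart next h) = h.1.1 := by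
  rcases h with ⟨q, _ | _⟩ <;> simp [toDart, edgeName, dartStart]

theorem toDart_injective : Function.Injective (toDart next) := by
  rintro ⟨q, _ | _⟩ ⟨q', _ | _⟩ h <;> simp_all [toDart, edgeName]

theorem faceNext_iterate_toDart (h : HalfEdge C) (n : ℕ) :
    (faceNext next)^[n] (toDart next h) = toDart next ((face next)^[n] h) := by
  induction n generalizing h with
  | zero => rfl
  | succ n ih => rw [Function.iterate_succ_apply, Function.iterate_succ_apply, faceNext_toDart, ih]

/-- The passages at the two ends of an edge, in the order given by a half-edge. -/
theorem edgeName_cases (h : HalfEdge C) :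
    (h.2 = true ∧ edgeName next h = h.1 ∧ next (edgeName next h) = (flip next h).1) ∨
    (h.2 = false ∧ edgeName next h = (flip next h).1 ∧ next (edgeName next h) = h.1) := by
  rcases h with ⟨q, _ | _⟩ <;> simp [edgeName]

/-- A cycle modulo 2, as a function on half-edges. -/
structure IsCycle (z : HalfEdge C → ZMod 2) : Prop where
  flip_eq : ∀ h, z (flip next h) = z h
  sum_eq : ∀ h, z h + z (rot h) + z (opp h) + z (rotInv h) = 0

/-- `z` is the boundary of the function `w` on the faces. -/
structure IsBoundary (w z : HalfEdge C → ZMod 2) : Prop where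
  flip_eq : ∀ h, w (flip next h) = w h + z h
  rotInv_eq : ∀ h, w (rotInv h) = w h + z h

variable {next}

theorem IsBoundary.face_eq {w z : HalfEdge C → ZMod 2} (hw : IsBoundary next w z)
    (hz : ∀ h, z (flip next h) = z h) (h : HalfEdge C) : w (face next h) = w h := by
  rw [face, hw.rotInv_eq, hw.flip_eq, hz, add_assoc, CharTwo.add_self_eq_zero, add_zero]

/-- The sum at a vertex is invariant under rotation, so one half-edge per vertex is enough. -/
theorem IsCycle.of_vertex {z : HalfEdge C → ZMod 2} (h1 : ∀ h, z (flip next h) = z h)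
    (h2 : ∀ c, ∃ h : HalfEdge C, h.1.1 = c ∧ z h + z (rot h) + z (opp h) + z (rotInv h) = 0) :
    IsCycle next z := by
  refine ⟨h1, fun g => ?_⟩
  obtain ⟨h, hc, e⟩ := h2 g.1.1
  rcases eq_of_vert_eq hc.symm with rfl | rfl | rfl | rfl
  · exact e
  all_goals
    simp only [rot_rot, opp_rot, rotInv_rot, rot_opp, rotInv_opp, opp_opp, rot_rotInv,
      opp_rotInv, rotInv_rotInv]
    grind

variable (next)

/-- This is the form in which planarity is used from here on. The value `w h` belongs to the face on
the left of `h`, seen from its vertex; `flip next h` and `rotInv h` both have the other side of the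
edge on their left. In these terms the conditions treat all four directions at a vertex alike, and
the orientation of the strands drops out. -/
theorem isPlanarCode_iff [Fintype C] [DecidableEq C] : IsPlanarCode next ↔
    ∀ z, IsCycle next z → ∃ w, IsBoundary next w z := by
  rw [isPlanarCode_iff_cycles]
  constructor
  · intro h z hz
    obtain ⟨w, hw, e⟩ := h (fun p => z (p, true)) (by
      funext c
      rw [incidence_transpose_mulVec]
      have h1 := hz.sum_eq ((c, false), true)
      have h2 := hz.flip_eq ((c, false), false)
      have h3 := hz.flip_eq ((c, true), false)
      simp only [rot, opp, rotInv, flip_false] at h1 h2 h3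
      simp only [Bool.not_false, Bool.not_true, Bool.xor_false, Bool.xor_true] at h1
      rw [h2, h3, Pi.zero_apply]
      grind)
    have e' : ∀ p, w (p, true) + w (p, false) = z (p, true) := fun p => congrFun e p
    refine ⟨fun h => w (toDart next h), ?_, ?_⟩
    · rintro ⟨q, _ | _⟩
      · have h1 := e' (next.symm q)
        have h2 := hz.flip_eq (q, false)
        simp only [toDart, edgeName, flip_false, Bool.false_eq_true, if_false, if_true] at *
        grind
      · have h1 := e' q
        simp only [toDart, edgeName, flip_true, Bool.false_eq_true, if_false, if_true,
          Equiv.symm_apply_apply] at *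
        grind
    · rintro ⟨⟨c, s⟩, b⟩
      obtain ⟨h1, h2, h3, h4⟩ := faceFunctions_apply next hw c
      have e1 := e' (c, false)
      have e2 := e' (c, true)
      have e3 := e' (next.symm (c, false))
      have e4 := e' (next.symm (c, true))
      have f1 := hz.flip_eq ((c, false), false)
      have f2 := hz.flip_eq ((c, true), false)
      cases s <;> cases b <;>
        simp [toDart, edgeName, rotInv] at * <;> grind
  · intro h z hz
    have hz' : IsCycle next (fun h => z (edgeName next h)) := by
      refine IsCycle.of_vertex ?_ fun c => ⟨((c, false), true), rfl, ?_⟩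
      · rintro ⟨q, _ | _⟩ <;> simp [edgeName]
      · have := congrFun hz c
        rw [incidence_transpose_mulVec] at this
        simp [edgeName, rot, opp, rotInv]
        simp at this
        grind
    obtain ⟨w, hw⟩ := h _ hz'
    have hf := hw.face_eq hz'.flip_eq
    have hs : ∀ d, ∃ h, toDart next h = d := by
      rintro ⟨p, _ | _⟩
      · exact ⟨(next p, false), by simp [toDart, edgeName]⟩
      · exact ⟨(p, true), by simp [toDart, edgeName]⟩
    choose g hg using hs
    have hg' : ∀ h, g (toDart next h) = h := fun h => toDart_injective next (hg _)
    refine ⟨fun d => w (g d), ?_, ?_⟩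
    · rintro d _ rfl
      obtain ⟨h, rfl⟩ : ∃ h, toDart next h = d := ⟨g d, hg d⟩
      change w (g _) = w (g _)
      rw [faceNext_toDart, hg', hg', hf]
    · funext p
      have h1 := hw.flip_eq (p, true)
      have e1 : g (p, true) = (p, true) := by
        simpa [toDart, edgeName] using hg' (p, true)
      have e2 : g (p, false) = (next p, false) := by
        simpa [toDart, edgeName] using hg' (next p, false)
      simp only [faceBoundary, LinearMap.coe_mk, AddHom.coe_mk, e1, e2]
      simp [edgeName] at h1
      grind

/-! ### Codes from edge involutions -/

variable {C : Type}

/-- The code with a given edge involution. -/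
def ofFlip (i : HalfEdge C → HalfEdge C) (h1 : ∀ h, i (i h) = h) (h2 : ∀ h, (i h).2 = !h.2) :
    Equiv.Perm (C × Bool) where
  toFun q := (i (q, true)).1
  invFun q := (i (q, false)).1
  left_inv q := by
    have e : ((i (q, true)).1, false) = i (q, true) := Prod.ext rfl (by rw [h2]; rfl)
    simp only [e, h1]
  right_inv q := by
    have e : ((i (q, false)).1, true) = i (q, false) := Prod.ext rfl (by rw [h2]; rfl)
    simp only [e, h1]

theorem flip_ofFlip (i : HalfEdge C → HalfEdge C) (h1 : ∀ h, i (i h) = h)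
    (h2 : ∀ h, (i h).2 = !h.2) (h : HalfEdge C) : flip (ofFlip i h1 h2) h = i h := by
  rcases h with ⟨q, _ | _⟩
  · exact Prod.ext rfl (by rw [h2]; rfl)
  · exact Prod.ext rfl (by rw [h2]; rfl)

/-! ### First return -/

/-- `Ret next E p q`: from the passage `p`, the strand runs on to `q`, which is its first passage
outside `E`. -/
inductive Ret (next : Equiv.Perm (C × Bool)) (E : Set C) : C × Bool → C × Bool → Prop
  | base {p} : (next p).1 ∉ E → Ret next E p (next p)
  | step {p q} : (next p).1 ∈ E → Ret next E (next p) q → Ret next E p q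

/-- `Ret` for half-edges: `y` is the other end of the strand that starts at `x`, if the double
points in `E` are dissolved. -/
inductive RetH (next : Equiv.Perm (C × Bool)) (E : Set C) : HalfEdge C → HalfEdge C → Prop
  | base {x} : (flip next x).1.1 ∉ E → RetH next E x (flip next x)
  | step {x y} : (flip next x).1.1 ∈ E → RetH next E (str next x) y → RetH next E x y

variable {next : Equiv.Perm (C × Bool)} {E : Set C}

theorem Ret.notMem {p q} (h : Ret next E p q) : q.1 ∉ E := by
  induction h with
  | base h => exact h
  | step _ _ ih => exact ih

theorem Ret.unique {p q r} (h : Ret next E p q) (h' : Ret next E p r) : q = r := by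
  induction h with
  | base h => cases h' with
    | base _ => rfl
    | step h1 _ => exact absurd h1 h
  | step h _ ih => cases h' with
    | base h1 => exact absurd h h1
    | step _ h1 => exact ih h1

theorem RetH.notMem {x y} (h : RetH next E x y) : y.1.1 ∉ E := by
  induction h with
  | base h => exact h
  | step _ _ ih => exact ih

theorem RetH.unique {p q r} (h : RetH next E p q) (h' : RetH next E p r) : q = r := by
  induction h with
  | base h => cases h' with
    | base _ => rfl
    | step h1 _ => exact absurd h1 h
  | step h _ ih => cases h' with
    | base h1 => exact absurd h h1
    | step _ h1 => exact ih h1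

theorem RetH.of_flip {x y} (h : flip next x = y) (hy : y.1.1 ∉ E) : RetH next E x y := by
  subst h
  exact .base hy

theorem RetH.of_str {x y z} (h : flip next x = y) (hy : y.1.1 ∈ E) (hr : RetH next E (opp y) z) :
    RetH next E x z := by
  subst h
  exact .step hy hr

theorem RetH.snd_eq {x y} (h : RetH next E x y) : y.2 = !x.2 := by
  induction h with
  | base h => simp
  | step _ _ ih => rw [ih]; simp [str]

theorem Ret.retH {p q} (h : Ret next E p q) : RetH next E (p, true) (q, false) := by
  induction h with
  | base h => exact RetH.base (next := next) (x := (_, true)) h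
  | step h _ ih => exact .step (x := (_, true)) h ih

theorem RetH.ret {x y} (h : RetH next E x y) (hx : x.2 = true) : Ret next E x.1 y.1 := by
  induction h with
  | @base x h =>
    rcases x with ⟨p, _ | _⟩
    · simp at hx
    · exact Ret.base h
  | @step x y h _ ih =>
    rcases x with ⟨p, _ | _⟩
    · simp at hx
    · exact Ret.step h (ih rfl)

/-- The strand is walked backwards. If it started at a surviving double point, the way back stops
there; if it started at a dissolved one, the way back runs through and ends wherever the opposite
half-edge leads. -/
theorem RetH.reverse_aux {x y} (h : RetH next E x y) :
    (x.1.1 ∉ E → RetH next E y x) ∧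
      (x.1.1 ∈ E → ∀ t, RetH next E (opp x) t → RetH next E y t) := by
  induction h with
  | @base x h =>
    refine ⟨fun hx => .of_flip (flip_flip _ _) hx, fun hx t ht => .of_str (flip_flip _ _) hx ht⟩
  | @step x y h _ ih =>
    have e : opp (str next x) = flip next x := by simp [str]
    refine ⟨fun hx => ih.2 h x ?_, fun hx t ht => ih.2 h t ?_⟩
    · rw [e]
      exact .of_flip (flip_flip _ _) hx
    · rw [e]
      exact .of_str (flip_flip _ _) hx ht

theorem RetH.reverse {x y} (h : RetH next E x y) (hx : x.1.1 ∉ E) : RetH next E y x :=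
  h.reverse_aux.1 hx

theorem RetH.join {x y t} (h : RetH next E x y) (hx : x.1.1 ∈ E) (ht : RetH next E (opp x) t) :
    RetH next E y t :=
  h.reverse_aux.2 hx t ht

theorem RetH.exists_iterate {x y} (h : RetH next E x y) : ∃ n, (str next)^[n + 1] x = opp y := by
  induction h with
  | @base x h => exact ⟨0, rfl⟩
  | @step x y h _ ih =>
    obtain ⟨n, hn⟩ := ih
    exact ⟨n + 1, by rw [Function.iterate_succ_apply]; exact hn⟩

theorem exists_retH_or (next : Equiv.Perm (C × Bool)) (E : Set C) (x : HalfEdge C) :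
    (∃ y, RetH next E x y) ∨ ∀ n, ((str next)^[n + 1] x).1.1 ∈ E := by
  by_contra! hc
  obtain ⟨h1, n, hn⟩ := hc
  induction n generalizing x with
  | zero => exact h1 _ (.base hn)
  | succ n ih =>
    by_cases hx : (flip next x).1.1 ∈ E
    · exact ih (str next x) (fun y hy => h1 y (.step hx hy)) hn
    · exact h1 _ (.base hx)

theorem exists_str_period [Finite C] (next : Equiv.Perm (C × Bool)) :
    ∃ N, (str next)^[N + 1] = id := by
  let s : Equiv.Perm (HalfEdge C) := Equiv.ofBijective (str next)
    (Finite.injective_iff_bijective.1 (str_injective next))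
  obtain ⟨N, hN⟩ := Nat.exists_eq_succ_of_ne_zero (orderOf_pos s).ne'
  refine ⟨N, ?_⟩
  have h : (s ^ (N + 1) : Equiv.Perm _) = 1 := by
    rw [← Nat.succ_eq_add_one, ← hN]
    exact pow_orderOf_eq_one s
  funext x
  have := congrArg (fun g : Equiv.Perm _ => g x) h
  rw [Equiv.Perm.coe_one] at this
  rwa [← Equiv.Perm.iterate_eq_pow] at this

/-- Running on is a permutation of a finite set, so it comes back to `x`, which lies outside `E`;
hence it leaves `E` at some point. -/
theorem exists_retH [Finite C] {x : HalfEdge C} (hx : x.1.1 ∉ E) : ∃ y, RetH next E x y := by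
  refine (exists_retH_or next E x).resolve_right fun h => hx ?_
  obtain ⟨N, hN⟩ := exists_str_period next
  have := h N
  rwa [hN] at this

theorem iterate_opp_iterate (n : ℕ) (x : HalfEdge C) :
    (str next)^[n] (opp ((str next)^[n] x)) = opp x := by
  induction n generalizing x with
  | zero => rfl
  | succ n ih =>
    rw [Function.iterate_succ_apply', Function.iterate_succ_apply, ih]
    simp [str]

/-- The strand is closed: one that leaves `E` in one direction also leaves it in the other. -/
theorem exists_retH_opp [Finite C] {x y : HalfEdge C} (h : RetH next E x y) :
    ∃ t, RetH next E (opp x) t := by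
  refine (exists_retH_or next E (opp x)).resolve_right fun h' => h.notMem ?_
  obtain ⟨n, hn⟩ := h.exists_iterate
  obtain ⟨N, hN⟩ := exists_str_period next
  -- The exponent is a multiple of the period, `(n + 1) * (N + 1)`, written so that `n + 1` steps
  -- and one further step split off. The case `N = 0` is separate because there the subtraction
  -- truncates.
  have e : (str next)^[n * N + N - 1 + 1 + (n + 1)] y = y := by
    rcases N with _ | N
    · have h1 : ∀ m, (str next)^[m] y = y := by
        intro m
        have : str next = id := by simpa using hN
        rw [this]
        simp
      exact h1 _
    · have h2 : n * (N + 1) + (N + 1) - 1 + 1 + (n + 1) = (N + 1 + 1) * (n + 1) := by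
        have : n * (N + 1) + (N + 1) - 1 + 1 = n * (N + 1) + (N + 1) := by omega
        rw [this]
        ring
      rw [h2, Function.iterate_mul, hN]
      simp
  rcases N with _ | N
  · have h1 : ∀ m z, (str next)^[m] z = z := by
      intro m z
      have : str next = id := by simpa using hN
      rw [this]
      simp
    rw [h1] at hn
    have := h' 0
    rw [h1, hn] at this
    simpa using this
  · have h3 : (str next)^[n + 1] y = opp x := by
      have := iterate_opp_iterate (next := next) (n + 1) x
      rwa [hn, opp_opp] at this
    rw [Function.iterate_add_apply, h3] at e
    have := h' (n * (N + 1) + (N + 1) - 1)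
    rwa [e] at this

/-- Renaming of half-edges. -/
def lift {C' : Type} (f : C' → C) : HalfEdge C' → HalfEdge C := Prod.map (Prod.map f id) id

section lift

variable {C' : Type} (f : C' → C)

@[simp] theorem lift_fst (h : HalfEdge C') : (lift f h).1 = Prod.map f id h.1 := rfl
@[simp] theorem lift_snd (h : HalfEdge C') : (lift f h).2 = h.2 := rfl
@[simp] theorem rot_lift (h : HalfEdge C') : rot (lift f h) = lift f (rot h) := rfl
@[simp] theorem rotInv_lift (h : HalfEdge C') : rotInv (lift f h) = lift f (rotInv h) := rfl
@[simp] theorem opp_lift (h : HalfEdge C') : opp (lift f h) = lift f (opp h) := rfl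
theorem lift_mk (c : C') (s b : Bool) : lift f ((c, s), b) = ((f c, s), b) := rfl

theorem lift_injective (hf : Function.Injective f) : Function.Injective (lift f) :=
  (hf.prodMap Function.injective_id).prodMap Function.injective_id

end lift

theorem exists_lift {h : HalfEdge C} {C' : Type} {f : C' → C} (hh : h.1.1 ∈ Set.range f) :
    ∃ g, lift f g = h := by
  obtain ⟨c, hc⟩ := hh
  exact ⟨((c, h.1.2), h.2), by rw [lift_mk, hc]⟩

/-! ### First return under renaming and under enlarging the dissolved set -/

section Return

variable {C' : Type} {next' : Equiv.Perm (C' × Bool)} {f : C' → C}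

/-- First return of passages only speaks of outgoing half-edges; incoming ones follow by reversing
the strand. -/
theorem retH_lift (hf : ∀ c, f c ∉ E)
    (hr : ∀ p, Ret next E (Prod.map f id p) (Prod.map f id (next' p))) (x : HalfEdge C') :
    RetH next E (lift f x) (lift f (flip next' x)) := by
  rcases x with ⟨p, _ | _⟩
  · have h := (hr (next'.symm p)).retH
    rw [Equiv.apply_symm_apply] at h
    exact h.reverse (hf _)
  · exact (hr p).retH

/-- If more is dissolved, an old stopping point either remains one or is run through. Induction on
the coarser strand then makes first returns compose, see `Ret.trans`. -/
theorem Ret.mono {E' : Set C} (hE : E ⊆ E') {a b} (h : Ret next E a b) :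
    (b.1 ∉ E' → Ret next E' a b) ∧ (b.1 ∈ E' → ∀ c, Ret next E' b c → Ret next E' a c) := by
  induction h with
  | base h => exact ⟨.base, fun hb c hc => .step hb hc⟩
  | step h _ ih =>
    exact ⟨fun hb => .step (hE h) (ih.1 hb), fun hb c hc => .step (hE h) (ih.2 hb c hc)⟩

theorem Ret.trans {E' : Set C'} {E'' : Set C} (hE : E ⊆ E'') (hf : ∀ c, f c ∈ E'' ↔ c ∈ E')
    (hr : ∀ p, Ret next E (Prod.map f id p) (Prod.map f id (next' p))) {p q}
    (h : Ret next' E' p q) : Ret next E'' (Prod.map f id p) (Prod.map f id q) := by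
  induction h with
  | base h => exact ((hr _).mono hE).1 (by simpa [hf] using h)
  | step h _ ih => exact ((hr _).mono hE).2 (by simpa [hf] using h) _ ih

theorem exists_ret [Finite C] {p : C × Bool} (hp : p.1 ∉ E) : ∃ q, Ret next E p q := by
  obtain ⟨y, hy⟩ := exists_retH (next := next) (x := (p, true)) hp
  exact ⟨_, hy.ret rfl⟩

theorem ret_iff {p q} : Ret next E p q ↔
    q.1 ∉ E ∧ ∃ k : ℕ, next^[k + 1] p = q ∧ ∀ j < k, (next^[j + 1] p).1 ∈ E := by
  constructor
  · intro h
    refine ⟨h.notMem, ?_⟩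
    induction h with
    | base h => exact ⟨0, rfl, by simp⟩
    | step h _ ih =>
      obtain ⟨k, h1, h2⟩ := ih
      refine ⟨k + 1, by rwa [Function.iterate_succ_apply], fun j hj => ?_⟩
      rcases j with _ | j
      · exact h
      · rw [Function.iterate_succ_apply]
        exact h2 j (by omega)
  · rintro ⟨hq, k, h1, h2⟩
    induction k generalizing p with
    | zero =>
      subst h1
      exact .base hq
    | succ k ih =>
      refine .step (h2 0 (by omega)) (ih (by rwa [Function.iterate_succ_apply] at h1) ?_)
      intro j hj
      have := h2 (j + 1) (by omega)
      rwa [Function.iterate_succ_apply] at this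

/-- The number of cycles does not grow under first return. -/
theorem exists_quot_eq_of_iterate (hf : ∀ c, c ∈ Set.range f ↔ c ∉ E) (hi : Function.Injective f)
    (hr : ∀ p, Ret next E (Prod.map f id p) (Prod.map f id (next' p))) (n : ℕ) :
    ∀ (a : C × Bool) (q : C' × Bool), next^[n + 1] a = Prod.map f id q →
      ∃ r, Ret next E a (Prod.map f id r) ∧
        Quot.mk (fun p q => next' p = q) r = Quot.mk (fun p q => next' p = q) q := by
  induction n with
  | zero =>
    intro a q h
    refine ⟨q, ?_, rfl⟩
    rw [← h]
    refine .base ?_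
    change (next^[0 + 1] a).1 ∉ E
    rw [h]
    exact (hf _).1 ⟨q.1, rfl⟩
  | succ n ih =>
    intro a q h
    rw [Function.iterate_succ_apply] at h
    obtain ⟨r, h1, h2⟩ := ih _ q h
    by_cases ha : (next a).1 ∈ E
    · exact ⟨r, .step ha h1, h2⟩
    · obtain ⟨c, hc⟩ := (hf _).2 ha
      have e : Prod.map f id (c, (next a).2) = next a := Prod.ext hc rfl
      refine ⟨(c, (next a).2), e ▸ .base ha, ?_⟩
      rw [← h2]
      refine Quot.sound ?_
      have h3 := hr (c, (next a).2)
      rw [e] at h3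
      exact hi.prodMap Function.injective_id (h3.unique h1)

end Return

/-- The number of cycles of a code. -/
noncomputable def numCycles (next : Equiv.Perm (C × Bool)) : ℕ :=
  Nat.card (Quot fun p q => next p = q)

theorem quot_mk_next (p : C × Bool) :
    Quot.mk (fun p q => next p = q) (next p) = Quot.mk (fun p q => next p = q) p :=
  (Quot.sound (r := fun p q => next p = q) rfl).symm

theorem quot_mk_iterate (n : ℕ) (p : C × Bool) :
    Quot.mk (fun p q => next p = q) (next^[n] p) = Quot.mk (fun p q => next p = q) p := by
  induction n with
  | zero => rfl
  | succ n ih =>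
    rw [← ih, Function.iterate_succ_apply', quot_mk_next]

theorem Ret.quot_eq {p q} (h : Ret next E p q) :
    Quot.mk (fun p q => next p = q) p = Quot.mk (fun p q => next p = q) q := by
  obtain ⟨_, k, hk, _⟩ := ret_iff.1 h
  rw [← hk]
  exact (quot_mk_iterate _ _).symm

theorem exists_iterate_of_sameCycle [Finite C] {p q : C × Bool} (h : next.SameCycle p q) :
    ∃ n, next^[n + 1] p = q := by
  classical
  obtain ⟨_⟩ := nonempty_fintype C
  obtain ⟨i, hi, _, h2⟩ := h.exists_pow_eq next
  obtain ⟨n, rfl⟩ := Nat.exists_eq_succ_of_ne_zero hi.ne'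
  refine ⟨n, ?_⟩
  rw [← h2, ← Equiv.Perm.iterate_eq_pow]

theorem exists_iterate_of_quot_eq [Finite C] {p q : C × Bool}
    (h : Quot.mk (fun p q => next p = q) p = Quot.mk (fun p q => next p = q) q) :
    ∃ n, next^[n + 1] p = q := by
  have h1 : next.SameCycle p q := by
    replace h := Quot.eqvGen_exact h
    induction h with
    | rel _ _ h => exact ⟨1, by simpa using h⟩
    | refl _ => exact Equiv.Perm.SameCycle.refl _ _
    | symm _ _ _ ih => exact ih.symm
    | trans _ _ _ _ _ ih1 ih2 => exact ih1.trans ih2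
  exact exists_iterate_of_sameCycle h1

/-! ### Counting components under first return -/

section Return

variable {C' : Type} [Finite C] {next' : Equiv.Perm (C' × Bool)} {f : C' → C}

/-- Injectivity holds because the survivors on one cycle of `next` are met one after the other in
the order of `next'`. -/
theorem exists_quotMap (hf : ∀ c, c ∈ Set.range f ↔ c ∉ E) (hi : Function.Injective f)
    (hr : ∀ p, Ret next E (Prod.map f id p) (Prod.map f id (next' p))) :
    ∃ g : Quot (fun p q => next' p = q) → Quot (fun p q => next p = q),
      (∀ p, g (Quot.mk _ p) = Quot.mk _ (Prod.map f id p)) ∧ Function.Injective g := by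
  refine ⟨Quot.lift (fun p => Quot.mk _ (Prod.map f id p)) ?_, fun _ => rfl, ?_⟩
  · rintro p _ rfl
    exact (hr p).quot_eq
  · rintro ⟨p⟩ ⟨q⟩ h
    obtain ⟨n, hn⟩ := exists_iterate_of_quot_eq h
    obtain ⟨r, h1, h2⟩ := exists_quot_eq_of_iterate hf hi hr n _ _ hn
    have h3 := hi.prodMap Function.injective_id ((hr p).unique h1)
    subst h3
    exact (quot_mk_next p).symm.trans h2

theorem numCycles_le (hf : ∀ c, c ∈ Set.range f ↔ c ∉ E) (hi : Function.Injective f)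
    (hr : ∀ p, Ret next E (Prod.map f id p) (Prod.map f id (next' p))) :
    numCycles next' ≤ numCycles next := by
  obtain ⟨g, -, hg⟩ := exists_quotMap hf hi hr
  exact Nat.card_le_card_of_injective g hg

/-- The condition `hs` says that no cycle is swallowed by `E`, so that none has to be replaced by a
circle. -/
theorem numCycles_eq (hf : ∀ c, c ∈ Set.range f ↔ c ∉ E) (hi : Function.Injective f)
    (hr : ∀ p, Ret next E (Prod.map f id p) (Prod.map f id (next' p)))
    (hs : ∀ p, p.1 ∈ E → ∃ q, Ret next E p q) : numCycles next' = numCycles next := by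
  obtain ⟨g, hg, hg'⟩ := exists_quotMap hf hi hr
  refine Nat.card_congr (Equiv.ofBijective g ⟨hg', ?_⟩)
  rintro ⟨p⟩
  have h1 : ∃ q, q.1 ∉ E ∧ Quot.mk (fun p q => next p = q) q = Quot.mk _ p := by
    by_cases hp : p.1 ∈ E
    · obtain ⟨q, hq⟩ := hs p hp
      exact ⟨q, hq.notMem, hq.quot_eq.symm⟩
    · exact ⟨p, hp, rfl⟩
  obtain ⟨q, hq, e⟩ := h1
  obtain ⟨c, hc⟩ := (hf _).2 hq
  refine ⟨Quot.mk _ (c, q.2), ?_⟩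
  rw [hg]
  refine Eq.trans (congrArg _ ?_) e
  exact Prod.ext hc rfl

end Return

/-! ### Planarity of erasing -/

/-- The other passage through the same double point. -/
def oth {C : Type} (p : C × Bool) : C × Bool := (p.1, !p.2)

/-- The passages through the double points in `E` come in consecutive pairs, and the passages that
are transverse to such a pair are consecutive too. -/
structure IsBlock {C : Type} (next : Equiv.Perm (C × Bool)) (E : Set C) (first : C × Bool → Prop) :
    Prop where
  mem : ∀ a, first a → (next a).1 ∈ E
  not_first : ∀ a, first a → ¬ first (next a)
  first_symm : ∀ b : C × Bool, b.1 ∈ E → ¬ first b → first (next.symm b)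
  adjacent : ∀ a, first a → next (oth a) = oth (next a) ∨ next (oth (next a)) = oth a
  first_mem : ∀ a, first a → a.1 ∈ E

/-- A cycle of the smaller code is spread along the old strands and runs straight through `E`; it is
a cycle again, hence it bounds some `w`. Along a strand, the value of `w` on the left changes at
each transverse strand that is crossed in `E`. These crossings come in consecutive pairs that carry
the same value, so the changes cancel modulo 2 and the restriction of `w` to the survivors works. -/
theorem IsBlock.isPlanarCode {C C' : Type} [Fintype C] [DecidableEq C] [Fintype C']
    [DecidableEq C'] {next : Equiv.Perm (C × Bool)} {next' : Equiv.Perm (C' × Bool)} {E : Set C}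
    {first : C × Bool → Prop} (hb : IsBlock next E first) {f : C' → C}
    (hf : ∀ c, c ∈ Set.range f ↔ c ∉ E) (hi : Function.Injective f)
    (hr : ∀ p, Ret next E (Prod.map f id p) (Prod.map f id (next' p)))
    (hp : IsPlanarCode next) : IsPlanarCode next' := by
  classical
  rw [isPlanarCode_iff] at hp ⊢
  intro z' hz'
  have hfE : ∀ c, f c ∉ E := fun c => (hf _).1 ⟨c, rfl⟩
  have hrl := retH_lift hfE hr
  -- The value 0 is for closed strands that lie entirely in `E`, where `z'` says nothing.
  let z : HalfEdge C → ZMod 2 := fun x =>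
    if h : ∃ y, RetH next E x (lift f y) then z' h.choose else 0
  have zval : ∀ x y, RetH next E x (lift f y) → z x = z' y := by
    intro x y h
    have hx : ∃ y, RetH next E x (lift f y) := ⟨y, h⟩
    simp only [z, dif_pos hx]
    rw [lift_injective f hi (hx.choose_spec.unique h)]
  have znone : ∀ x, (¬ ∃ y, RetH next E x y) → z x = 0 := by
    intro x h
    have hx : ¬ ∃ y, RetH next E x (lift f y) := fun ⟨y, hy⟩ => h ⟨_, hy⟩
    simp only [z, dif_neg hx]
  have hl : ∀ y, y.1.1 ∉ E → ∃ u, lift f u = y := fun y hy => exists_lift ((hf _).2 hy)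
  have zlift : ∀ u, z (lift f u) = z' u := fun u => by
    rw [zval _ _ (hrl u), hz'.flip_eq]
  -- The two directions from a dissolved double point end at the two ends of one edge of the new
  -- code.
  have zopp : ∀ x : HalfEdge C, x.1.1 ∈ E → z (opp x) = z x := by
    intro x hx
    by_cases h : ∃ y, RetH next E x y
    · obtain ⟨y, hy⟩ := h
      obtain ⟨t, ht⟩ := exists_retH_opp hy
      have hyt := hy.join hx ht
      obtain ⟨u, rfl⟩ := hl y hy.notMem
      obtain ⟨v, rfl⟩ := hl t ht.notMem
      rw [zval _ _ hy, zval _ _ ht, ← lift_injective f hi ((hrl u).unique hyt), hz'.flip_eq]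
    · have h' : ¬ ∃ y, RetH next E (opp x) y := by
        rintro ⟨y, hy⟩
        have := exists_retH_opp hy
        rw [opp_opp] at this
        exact h this
      rw [znone _ h, znone _ h']
  have zflip1 : ∀ x, (flip next x).1.1 ∉ E → z (flip next x) = z x := by
    intro x hx
    obtain ⟨u, hu⟩ := hl _ hx
    rw [← hu, zlift, zval x u (hu ▸ RetH.base hx)]
  have zflip : ∀ x, z (flip next x) = z x := by
    intro x
    by_cases hx : (flip next x).1.1 ∈ E
    · by_cases hx' : x.1.1 ∈ E
      · have e : z x = z (str next x) := by
          by_cases h : ∃ y, RetH next E (str next x) y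
          · obtain ⟨y, hy⟩ := h
            obtain ⟨u, rfl⟩ := hl y hy.notMem
            rw [zval _ _ hy, zval _ _ (.step hx hy)]
          · have h' : ¬ ∃ y, RetH next E x y := by
              rintro ⟨y, hy⟩
              cases hy with
              | base h1 => exact h1 hx
              | step _ h1 => exact h ⟨_, h1⟩
            rw [znone _ h, znone _ h']
        rw [e, str, zopp _ hx]
      · have := zflip1 (flip next x) (by rwa [flip_flip])
        rw [flip_flip] at this
        exact this.symm
    · exact zflip1 x hx
  have hz : IsCycle next z := by
    refine ⟨zflip, fun h => ?_⟩
    by_cases hh : h.1.1 ∈ E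
    · have h1 := zopp h hh
      have h2 := zopp (rot h) hh
      rw [opp_rot] at h2
      grind
    · obtain ⟨u, rfl⟩ := hl h hh
      simp only [rot_lift, opp_lift, rotInv_lift, zlift]
      exact hz'.sum_eq u
  obtain ⟨w, hw⟩ := hp z hz
  have hopp : ∀ x, w (opp x) = w x + z x + z (rotInv x) := by
    intro x
    rw [← rotInv_rotInv, hw.rotInv_eq, hw.rotInv_eq]
  have zoth : ∀ b : C × Bool, b.1 ∈ E → ∀ s, z (b, s) = z (b, true) := by
    rintro b hb (_ | _)
    · exact zopp (b, true) hb
    · rfl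
  -- The last term is the change still due when the walk starts between the two crossings of a pair.
  have chain : ∀ p q, Ret next E p q → w (q, false) = w (p, true) + z (p, true) +
      if first p then z (oth (next p), true) else 0 := by
    intro p q h
    induction h with
    | @base p h =>
      have h1 : ¬ first p := fun h' => h (hb.mem _ h')
      rw [if_neg h1, add_zero]
      exact hw.flip_eq (p, true)
    | @step p q h _ ih =>
      rw [ih]
      have e1 : w (next p, false) = w (p, true) + z (p, true) := hw.flip_eq (p, true)
      have e2 : w (next p, true) = _ := hopp (next p, false)
      have e3 := zoth (next p) h false
      have e4 : z (next p, false) = z (p, true) := zflip (p, true)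
      have e5 : z (rotInv (next p, false)) = z (oth (next p), true) := zoth (oth (next p)) h _
      by_cases h1 : first (next p)
      · have h2 : ¬ first p := fun h' => hb.not_first _ h' h1
        rw [if_pos h1, if_neg h2]
        -- Here `adjacent` enters: the transverse passages of a pair are joined by an edge, so `z`
        -- agrees on them.
        have e6 : z (oth (next (next p)), true) = z (oth (next p), true) := by
          have h3 : (oth (next (next p))).1 ∈ E := hb.mem _ h1
          rcases hb.adjacent _ h1 with h4 | h4
          · have := zflip (oth (next p), true)
            rw [flip_true, h4, zoth _ h3] at this
            exact this
          · have := zflip (oth (next (next p)), true)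
            rw [flip_true, h4, zoth (oth (next p)) h] at this
            exact this.symm
        grind
      · have h2 : first p := by
          have := hb.first_symm _ h h1
          rwa [Equiv.symm_apply_apply] at this
        rw [if_neg h1, if_pos h2]
        grind
  have key : ∀ p, w (lift f (next' p, false)) = w (lift f (p, true)) + z' (p, true) := by
    intro p
    have h1 := chain _ _ (hr p)
    have h2 : ¬ first (Prod.map f id p) := fun h => hfE p.1 (hb.first_mem _ h)
    rw [if_neg h2, add_zero] at h1
    rw [← zlift]
    exact h1
  refine ⟨fun u => w (lift f u), ?_, fun u => ?_⟩
  · rintro ⟨q, _ | _⟩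
    · have := key (next'.symm q)
      rw [Equiv.apply_symm_apply] at this
      have h2 := hz'.flip_eq (q, false)
      rw [flip_false] at h2 ⊢
      grind
    · exact key q
  · rw [← rotInv_lift, hw.rotInv_eq, zlift]

/-! ### Erasing -/

/-- `D'` arises from `D` by dissolving the double points in `E`, where `f` gives the names in `D` of
the double points of `D'`. -/
structure ErasesVia (D D' : VirtualDiagram) (E : Set D.C) (f : D'.C → D.C) : Prop where
  injective : Function.Injective f
  range : ∀ c, c ∈ Set.range f ↔ c ∉ E
  kind : ∀ c, D'.kind c = D.kind (f c)
  ret : ∀ p, Ret D.next E (Prod.map f id p) (Prod.map f id (D'.next p))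
  numComponents : D'.numComponents = D.numComponents

variable {D D' D₁ D₂ : VirtualDiagram} {E : Set D.C} {f : D'.C → D.C}

theorem ErasesVia.notMem (h : ErasesVia D D' E f) (c : D'.C) : f c ∉ E := (h.range _).1 ⟨c, rfl⟩

theorem ErasesVia.erases (h : ErasesVia D D' E f) : D.Erases D' E := by
  refine ⟨⟨f, h.injective⟩, h.range, h.kind, fun p => ?_, h.numComponents⟩
  exact (ret_iff.1 (h.ret p)).2

theorem ErasesVia.retH (h : ErasesVia D D' E f) (x : HalfEdge D'.C) :
    RetH D.next E (lift f x) (lift f (flip D'.next x)) :=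
  retH_lift h.notMem h.ret x

theorem ErasesVia.flip_eq (h : ErasesVia D D' E f) {x y : HalfEdge D'.C}
    (hr : RetH D.next E (lift f x) (lift f y)) : flip D'.next x = y :=
  lift_injective f h.injective ((h.retH x).unique hr)

theorem ErasesVia.exists_lift (h : ErasesVia D D' E f) {x : HalfEdge D.C} (hx : x.1.1 ∉ E) :
    ∃ y, lift f y = x :=
  PlaneCode.exists_lift ((h.range _).2 hx)

/-- Successive simplifications are recorded as a single erasure from the original diagram, which is
what the inductions below return. -/
theorem ErasesVia.trans (h : ErasesVia D D' E f) {E' : Set D'.C} {g : D₁.C → D'.C}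
    (h' : ErasesVia D' D₁ E' g) {E'' : Set D.C} (hE : E ⊆ E'') (hE' : ∀ c, f c ∈ E'' ↔ c ∈ E') :
    ErasesVia D D₁ E'' (f ∘ g) where
  injective := h.injective.comp h'.injective
  range c := by
    constructor
    · rintro ⟨x, rfl⟩
      rw [Function.comp_apply, hE']
      exact h'.notMem x
    · intro hc
      obtain ⟨x, rfl⟩ := (h.range c).2 fun hx => hc (hE hx)
      obtain ⟨y, rfl⟩ := (h'.range x).2 fun hx => hc ((hE' _).2 hx)
      exact ⟨y, rfl⟩
  kind c := by rw [h'.kind, h.kind]; rfl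
  ret p := by
    have := Ret.trans hE hE' h.ret (h'.ret p)
    simpa [Prod.map_map] using this
  numComponents := by rw [h'.numComponents, h.numComponents]

/-- If `D` and `D₁` arise from `D₂` by erasing, and `D₁` by erasing more, then `D₁` arises from `D`
by erasing. -/
theorem ErasesVia.cancel {Y E' : Set D₂.C} {f : D.C → D₂.C} {g : D₁.C → D₂.C}
    (h : ErasesVia D₂ D Y f) (h' : ErasesVia D₂ D₁ E' g) (hE : Y ⊆ E') :
    ∃ k, ErasesVia D D₁ (f ⁻¹' E') k ∧ f ∘ k = g := by
  have hk : ∀ c, ∃ x, f x = g c := fun c => (h.range _).2 fun hc => h'.notMem c (hE hc)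
  choose k hk using hk
  have hfk : f ∘ k = g := funext hk
  have hinj : Function.Injective k := fun x y e => h'.injective (by rw [← hk, ← hk, e])
  have hrange : ∀ c, c ∈ Set.range k ↔ c ∉ f ⁻¹' E' := by
    intro c
    rw [Set.mem_preimage, ← h'.range]
    constructor
    · rintro ⟨x, rfl⟩
      exact ⟨x, (hk x).symm⟩
    · rintro ⟨x, hx⟩
      exact ⟨x, h.injective (by rw [hk, hx])⟩
  refine ⟨k, ⟨hinj, hrange, fun c => ?_, fun p => ?_, ?_⟩, hfk⟩
  · rw [h'.kind, h.kind, hk]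
  · obtain ⟨q, hq⟩ := exists_ret (next := D.next) (E := f ⁻¹' E') (p := Prod.map k id p)
      ((hrange _).1 ⟨p.1, rfl⟩)
    have h1 := Ret.trans (f := f) (E' := f ⁻¹' E') hE (fun c => Iff.rfl) h.ret hq
    have h2 := h'.ret p
    rw [← hfk] at h2
    have h3 : Prod.map f id (Prod.map k id p) = Prod.map (f ∘ k) id p := rfl
    rw [h3] at h1
    have h4 : Prod.map f id q = Prod.map f id (Prod.map k id (D₁.next p)) := h1.unique h2
    rwa [h.injective.prodMap Function.injective_id h4] at hq
  · rw [h'.numComponents, h.numComponents]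

section erase

variable (D : VirtualDiagram) (E : Set D.C)

theorem exists_eraseFlip (x : HalfEdge {c : D.C // c ∉ E}) :
    ∃ y : HalfEdge {c : D.C // c ∉ E}, RetH D.next E (lift Subtype.val x) (lift Subtype.val y) := by
  obtain ⟨y, hy⟩ := exists_retH (next := D.next) (E := E) (x := lift Subtype.val x) x.1.1.2
  obtain ⟨u, rfl⟩ := exists_lift (f := (Subtype.val : {c : D.C // c ∉ E} → D.C)) (h := y)
    (by simpa using hy.notMem)
  exact ⟨u, hy⟩

/-- The code that arises by dissolving the double points in `E`. -/
noncomputable def eraseNext : Equiv.Perm ({c : D.C // c ∉ E} × Bool) :=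
  ofFlip (fun x => (exists_eraseFlip D E x).choose)
    (fun x => by
      have h1 := (exists_eraseFlip D E x).choose_spec
      have h2 := (exists_eraseFlip D E (exists_eraseFlip D E x).choose).choose_spec
      exact lift_injective _ Subtype.val_injective (h2.unique (h1.reverse x.1.1.2)))
    (fun x => (exists_eraseFlip D E x).choose_spec.snd_eq)

theorem ret_eraseNext (p : {c : D.C // c ∉ E} × Bool) :
    Ret D.next E (Prod.map Subtype.val id p) (Prod.map Subtype.val id (eraseNext D E p)) :=
  (exists_eraseFlip D E (p, true)).choose_spec.ret rfl

theorem range_val (c : D.C) :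
    c ∈ Set.range (Subtype.val : {c : D.C // c ∉ E} → D.C) ↔ c ∉ E := by
  simp

open Classical in
/-- The diagram that arises by dissolving the double points in `E`, if its code is plane. -/
noncomputable def eraseDiagram (h : IsPlanarCode (eraseNext D E)) : VirtualDiagram where
  C := {c : D.C // c ∉ E}
  next := eraseNext D E
  kind c := D.kind c
  -- By `numCycles_le` nothing is truncated. Components lying entirely in `E` are turned into
  -- circles here.
  circles := D.numComponents - numCycles (eraseNext D E)
  planar := h

theorem erasesVia_eraseDiagram (h : IsPlanarCode (eraseNext D E)) :
    ErasesVia D (eraseDiagram D E h) E Subtype.val where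
  injective := Subtype.val_injective
  range := range_val D E
  kind _ := rfl
  ret := ret_eraseNext D E
  numComponents := by
    have h1 : numCycles (eraseNext D E) ≤ numCycles D.next :=
      numCycles_le (range_val D E) Subtype.val_injective (ret_eraseNext D E)
    have h2 : D.numComponents = numCycles D.next + D.circles := rfl
    have h3 : (eraseDiagram D E h).numComponents =
      numCycles (eraseNext D E) + (D.numComponents - numCycles (eraseNext D E)) := rfl
    omega

theorem IsBlock.exists_erasesVia {first} (hb : IsBlock D.next E first) :
    ∃ D' f, ErasesVia D D' E f := by
  classical
  exact ⟨_, _, erasesVia_eraseDiagram D E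
    (hb.isPlanarCode (range_val D E) Subtype.val_injective (ret_eraseNext D E) D.planar)⟩

end erase

open VirtualDiagram

/-! ### Monogons and bigons -/

@[simp] theorem oth_fst {C : Type} (p : C × Bool) : (oth p).1 = p.1 := rfl

@[simp] theorem oth_oth {C : Type} (p : C × Bool) : oth (oth p) = p := by
  rcases p with ⟨c, _ | _⟩ <;> rfl

theorem oth_ne {C : Type} (p : C × Bool) : oth p ≠ p := by
  rcases p with ⟨c, _ | _⟩ <;> simp [oth]

theorem eq_or_eq_oth {C : Type} {p q : C × Bool} (h : p.1 = q.1) : p = q ∨ p = oth q := by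
  rcases p with ⟨c, _ | _⟩ <;> rcases q with ⟨c', _ | _⟩ <;> simp_all [oth]

theorem rot_fst {C : Type} (h : HalfEdge C) : (rot h).1 = oth h.1 := rfl

/-! ### Monogons and bigons as blocks -/

section Block

variable {C : Type} {next : Equiv.Perm (C × Bool)}

/-- At a monogon the strand crosses itself: the transverse passages of the pair `a`, `oth a` are
`oth a`, `a`, joined by the same edge. -/
theorem isBlock_singleton {a : C × Bool} (h : next a = oth a) :
    IsBlock next {a.1} (fun p => p = a) := by
  refine ⟨?_, ?_, ?_, ?_, ?_⟩
  · rintro _ rfl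
    rw [h]
    rfl
  · rintro _ rfl
    rw [h]
    exact oth_ne _
  · intro b hb hba
    rcases eq_or_eq_oth (p := b) (q := a) hb with rfl | rfl
    · exact absurd rfl hba
    · rw [← h, Equiv.symm_apply_apply]
  · rintro _ rfl
    right
    rw [h, oth_oth, h]
  · rintro _ rfl
    rfl

/-- The two sides of a bigon, each with its own orientation: `u` starts the side through `p` and
`q`, and `v` the other one. -/
theorem isBlock_pair {p q u v : C × Bool} (hpq : p.1 ≠ q.1)
    (hu : (u = p ∧ next u = q) ∨ (u = q ∧ next u = p))
    (hv : (v = oth p ∧ next v = oth q) ∨ (v = oth q ∧ next v = oth p)) :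
    IsBlock next {p.1, q.1} (fun a => a = u ∨ a = v) := by
  have h1 : p ≠ q := fun h => hpq (congrArg Prod.fst h)
  have h2 : oth p ≠ q := fun h => hpq (by simpa using congrArg Prod.fst h)
  have h3 : p ≠ oth q := fun h => hpq (by simpa using congrArg Prod.fst h)
  have h4 : oth p ≠ oth q := fun h => hpq (by simpa using congrArg Prod.fst h)
  have h5 := oth_ne p
  have h6 := oth_ne q
  have h7 : ∀ {a b}, next a = b → next.symm b = a := fun h => by rw [← h, Equiv.symm_apply_apply]
  have h8 := oth_oth p
  have h9 := oth_oth q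
  refine ⟨?_, ?_, ?_, ?_, ?_⟩
  · rintro _ (rfl | rfl)
    · rcases hu with ⟨_, h⟩ | ⟨_, h⟩ <;> simp [h]
    · rcases hv with ⟨_, h⟩ | ⟨_, h⟩ <;> simp [h]
  · rcases hu with ⟨rfl, h⟩ | ⟨rfl, h⟩ <;> rcases hv with ⟨rfl, h'⟩ | ⟨rfl, h'⟩ <;>
      rintro _ (rfl | rfl) <;> grind
  · intro b hb hb'
    have hb2 : b = p ∨ b = oth p ∨ b = q ∨ b = oth q := by
      rcases hb with hb | hb
      · rcases eq_or_eq_oth hb with h | h <;> simp [h]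
      · rcases eq_or_eq_oth hb with h | h <;> simp [h]
    rcases hu with ⟨rfl, h⟩ | ⟨rfl, h⟩ <;> rcases hv with ⟨rfl, h'⟩ | ⟨rfl, h'⟩ <;>
      have e := h7 h <;> have e' := h7 h' <;> grind
  · rcases hu with ⟨rfl, h⟩ | ⟨rfl, h⟩ <;> rcases hv with ⟨rfl, h'⟩ | ⟨rfl, h'⟩ <;>
      rintro _ (rfl | rfl) <;> grind
  · rintro _ (rfl | rfl)
    · rcases hu with ⟨rfl, h⟩ | ⟨rfl, h⟩ <;> simp
    · rcases hv with ⟨rfl, h⟩ | ⟨rfl, h⟩ <;> simp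

end Block

variable {D D' : VirtualDiagram}

theorem exists_erasesVia_monogon {h : HalfEdge D.C} (hh : face D.next h = h) :
    ∃ D' f, ErasesVia D D' {h.1.1} f := by
  have h1 : (flip D.next h).1 = oth h.1 := by
    have : flip D.next h = rot h := by
      conv_rhs => rw [← hh, face, rot_rotInv]
    rw [this, rot_fst]
  rcases edgeName_cases D.next h with ⟨_, e1, e2⟩ | ⟨_, e1, e2⟩
  · rw [e1, h1] at e2
    exact (isBlock_singleton e2).exists_erasesVia
  · rw [e1, h1] at e2
    have := (isBlock_singleton (next := D.next) (a := oth h.1) (by rw [e2, oth_oth]))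
    exact this.exists_erasesVia

/-- From here on moves are described by half-edges; this lemma and the next ones translate them into
the darts used in the definition of `Move`. -/
theorem move_monogon {h : HalfEdge D.C} (hh : face D.next h = h) (hc : D.IsClassical h.1.1)
    (he : D.Erases D' {h.1.1}) : Move D D' := by
  refine Move.RI (toDart D.next h) ?_ ?_ ?_
  · rw [IsMonogon, faceNext_toDart, hh]
  · rwa [dartStart_toDart]
  · rwa [dartStart_toDart]

theorem exists_erasesVia_bigon {h : HalfEdge D.C} (hh : face D.next (face D.next h) = h)
    (hne : h.1.1 ≠ (flip D.next h).1.1) :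
    ∃ D' f, ErasesVia D D' {h.1.1, (flip D.next h).1.1} f := by
  have h1 : (face D.next h).1 = oth (flip D.next h).1 := rfl
  have h2 : (flip D.next (face D.next h)).1 = oth h.1 := by
    have : flip D.next (face D.next h) = rot h := by
      conv_rhs => rw [← hh]
      rw [face.eq_def D.next (face D.next h), rot_rotInv]
    rw [this, rot_fst]
  refine (isBlock_pair (u := edgeName D.next h) (v := edgeName D.next (face D.next h)) hne
    ?_ ?_).exists_erasesVia
  · rcases edgeName_cases D.next h with ⟨_, e1, e2⟩ | ⟨_, e1, e2⟩
    · exact Or.inl ⟨e1, e2⟩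
    · exact Or.inr ⟨e1, e2⟩
  · rcases edgeName_cases D.next (face D.next h) with ⟨_, e1, e2⟩ | ⟨_, e1, e2⟩
    · exact Or.inr ⟨e1, e2.trans h2⟩
    · exact Or.inl ⟨e1.trans h2, e2⟩

theorem isBigon_toDart {h : HalfEdge D.C} (hh : face D.next (face D.next h) = h)
    (hne : h.1.1 ≠ (flip D.next h).1.1) :
    D.IsBigon (toDart D.next h) h.1.1 (flip D.next h).1.1 := by
  refine ⟨?_, ?_, ?_, hne⟩
  · rw [faceNext_iterate_toDart]
    exact congrArg _ hh
  · rw [dartStart_toDart]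
  · rw [faceNext_toDart, dartStart_toDart]
    rfl

theorem isOverEdge_toDart {h : HalfEdge D.C} (h1 : D.IsOver h.1)
    (h2 : D.IsOver (flip D.next h).1) : D.IsOverEdge (toDart D.next h) := by
  rcases edgeName_cases D.next h with ⟨_, e1, e2⟩ | ⟨_, e1, e2⟩
  · exact ⟨by rwa [toDart_fst, e1], by rwa [toDart_fst, e2]⟩
  · exact ⟨by rwa [toDart_fst, e1], by rwa [toDart_fst, e2]⟩

theorem move_bigon {h g : HalfEdge D.C} (hg : flip D.next h = g)
    (hh : face D.next (face D.next h) = h)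
    (hne : h.1.1 ≠ g.1.1) (h1 : D.IsOver h.1) (h2 : D.IsOver g.1)
    (he : D.Erases D' {h.1.1, g.1.1}) : Move D D' := by
  subst hg
  exact Move.RII _ _ _ (isBigon_toDart hh hne) (isOverEdge_toDart h1 h2) he

theorem move_virtual_bigon {h g : HalfEdge D.C} (hg : flip D.next h = g)
    (hh : face D.next (face D.next h) = h)
    (hne : h.1.1 ≠ g.1.1) (h1 : D.kind h.1.1 = .virt) (h2 : D.kind g.1.1 = .virt)
    (he : D.Erases D' {h.1.1, g.1.1}) : Move D D' := by
  subst hg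
  exact Move.VRII _ _ _ (isBigon_toDart hh hne) h1 h2 he

theorem move_triangle {h₀ h₁ h₂ : HalfEdge D.C} (f₀ : face D.next h₀ = h₁)
    (f₁ : face D.next h₁ = h₂) (f₂ : face D.next h₂ = h₀)
    (h01 : h₀.1.1 ≠ h₁.1.1) (h12 : h₁.1.1 ≠ h₂.1.1) (h02 : h₀.1.1 ≠ h₂.1.1)
    (h1 : D.IsOver h₀.1) (h2 : D.IsOver (flip D.next h₀).1) (hz : D.IsClassical h₂.1.1)
    (hf : D.FlipsTriangle D' (toDart D.next h₀)) : Move D D' := by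
  refine Move.RIII _ h₀.1.1 h₁.1.1 h₂.1.1 ⟨?_, ?_, ?_, ?_, h01, h12, h02⟩
    (isOverEdge_toDart h1 h2) hz hf
  · rw [faceNext_iterate_toDart]
    simp [f₀, f₁, f₂]
  · rw [dartStart_toDart]
  · rw [faceNext_toDart, dartStart_toDart, f₀]
  · rw [faceNext_iterate_toDart, dartStart_toDart]
    simp [f₀, f₁]

/-! ### Boundaries -/

section Boundary

variable {C : Type} {next : Equiv.Perm (C × Bool)}

theorem IsBoundary.add {w z w' z' : HalfEdge C → ZMod 2} (h : IsBoundary next w z)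
    (h' : IsBoundary next w' z') : IsBoundary next (w + w') (z + z') :=
  ⟨fun x => by simp only [Pi.add_apply, h.flip_eq, h'.flip_eq]; ring,
    fun x => by simp only [Pi.add_apply, h.rotInv_eq, h'.rotInv_eq]; ring⟩

theorem IsBoundary.isCycle {w z : HalfEdge C → ZMod 2} (h : IsBoundary next w z) :
    IsCycle next z := by
  refine ⟨fun x => ?_, fun x => ?_⟩
  · have h1 := h.flip_eq x
    have h2 := h.flip_eq (flip next x)
    rw [flip_flip] at h2
    grind
  · have h1 := h.rotInv_eq x
    have h2 := h.rotInv_eq (rot x)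
    have h3 := h.rotInv_eq (opp x)
    have h4 := h.rotInv_eq (rotInv x)
    rw [rotInv_rot] at h2
    rw [rotInv_opp] at h3
    rw [rotInv_rotInv] at h4
    grind

theorem IsCycle.add {z z' : HalfEdge C → ZMod 2} (h : IsCycle next z) (h' : IsCycle next z') :
    IsCycle next (z + z') :=
  ⟨fun x => by simp only [Pi.add_apply, h.flip_eq, h'.flip_eq],
    fun x => by
      have h1 := h.sum_eq x
      have h2 := h'.sum_eq x
      simp only [Pi.add_apply]
      linear_combination h1 + h2⟩

/-- The hypothesis says that `A` is constant on faces, since applying it at `flip next x` compares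
`face next x` with `x`. The boundary of `A` on an edge is then the sum of the values on its two
sides. -/
theorem isBoundary_of_face_eq {A : HalfEdge C → ZMod 2} (h : ∀ x, A (rotInv x) = A (flip next x)) :
    IsBoundary next A (fun x => A x + A (flip next x)) :=
  ⟨fun x => by grind, fun x => by
    rw [h]
    grind⟩

/-- For planarity, it suffices to bound the cycles up to boundaries. -/
theorem isPlanarCode_of_boundary [Fintype C] [DecidableEq C]
    (h : ∀ z, IsCycle next z → ∃ A b, IsBoundary next A b ∧
      (IsCycle next (z + b) → ∃ w, IsBoundary next w (z + b))) : IsPlanarCode next := by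
  rw [isPlanarCode_iff]
  intro z hz
  obtain ⟨A, b, hA, h'⟩ := h z hz
  obtain ⟨w, hw⟩ := h' (hz.add hA.isCycle)
  refine ⟨w + A, ?_⟩
  have e : z = z + b + b := by
    funext x
    simp only [Pi.add_apply]
    grind
  rw [e]
  exact hw.add hA

end Boundary

/-! ### Finger moves -/

section Finger

variable {C : Type}

/-- The half-edges of the old diagram after a finger move. -/
abbrev inc (x : HalfEdge C) : HalfEdge (C ⊕ Bool) := lift Sum.inl x

/-- At the first new double point of a finger of the edge of `h` over the edge of `k`, the half-edge
that leads to the tip of the finger. -/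
def fingerOut (h k : HalfEdge C) : HalfEdge (C ⊕ Bool) := ((Sum.inr false, xor h.2 k.2), h.2)

/-- At the second new double point of a finger of the edge of `h` over the edge of `k`, the
half-edge that leads back to the end of the edge of `h`. -/
def fingerBack (h k : HalfEdge C) : HalfEdge (C ⊕ Bool) := ((Sum.inr true, xor h.2 !k.2), h.2)

theorem finger_cases (h k : HalfEdge C) (x : HalfEdge (C ⊕ Bool)) :
    (∃ u, x = inc u) ∨ (x = fingerOut h k ∨ x = rot (fingerOut h k) ∨ x = opp (fingerOut h k) ∨
      x = rotInv (fingerOut h k)) ∨ x = fingerBack h k ∨ x = rot (fingerBack h k) ∨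
      x = opp (fingerBack h k) ∨ x = rotInv (fingerBack h k) := by
  rcases x with ⟨⟨c | (_ | _), s⟩, b⟩
  · exact Or.inl ⟨((c, s), b), rfl⟩
  · exact Or.inr (Or.inl (eq_of_vert_eq rfl))
  · exact Or.inr (Or.inr (eq_of_vert_eq rfl))

/-- A function on the half-edges of a finger diagram, given by its values. -/
def fingerFun {X : Type} (h k : HalfEdge C) (g : HalfEdge C → X) (a₀ a₁ a₂ a₃ b₀ b₁ b₂ b₃ : X) :
    HalfEdge (C ⊕ Bool) → X
  | ((Sum.inl c, s), b) => g ((c, s), b)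
  | ((Sum.inr false, s), b) =>
    if s = xor h.2 k.2 then (if b = h.2 then a₀ else a₂) else (if b = k.2 then a₁ else a₃)
  | ((Sum.inr true, s), b) =>
    if s = xor h.2 !k.2 then (if b = h.2 then b₀ else b₂) else (if b = k.2 then b₃ else b₁)

section Values

variable {X : Type} {h k : HalfEdge C} {g : HalfEdge C → X} {a₀ a₁ a₂ a₃ b₀ b₁ b₂ b₃ : X}

@[simp] theorem fingerFun_inc (u : HalfEdge C) :
    fingerFun h k g a₀ a₁ a₂ a₃ b₀ b₁ b₂ b₃ (inc u) = g u := rfl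

@[simp] theorem fingerFun_out :
    fingerFun h k g a₀ a₁ a₂ a₃ b₀ b₁ b₂ b₃ (fingerOut h k) = a₀ := by
  simp [fingerFun, fingerOut]

@[simp] theorem fingerFun_rot_out :
    fingerFun h k g a₀ a₁ a₂ a₃ b₀ b₁ b₂ b₃ (rot (fingerOut h k)) = a₁ := by
  simp [fingerFun, fingerOut, rot]

@[simp] theorem fingerFun_opp_out :
    fingerFun h k g a₀ a₁ a₂ a₃ b₀ b₁ b₂ b₃ (opp (fingerOut h k)) = a₂ := by
  simp [fingerFun, fingerOut, opp]

@[simp] theorem fingerFun_rotInv_out :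
    fingerFun h k g a₀ a₁ a₂ a₃ b₀ b₁ b₂ b₃ (rotInv (fingerOut h k)) = a₃ := by
  simp [fingerFun, fingerOut, rotInv]

@[simp] theorem fingerFun_back :
    fingerFun h k g a₀ a₁ a₂ a₃ b₀ b₁ b₂ b₃ (fingerBack h k) = b₀ := by
  simp [fingerFun, fingerBack]

@[simp] theorem fingerFun_rot_back :
    fingerFun h k g a₀ a₁ a₂ a₃ b₀ b₁ b₂ b₃ (rot (fingerBack h k)) = b₁ := by
  simp [fingerFun, fingerBack, rot]

@[simp] theorem fingerFun_opp_back :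
    fingerFun h k g a₀ a₁ a₂ a₃ b₀ b₁ b₂ b₃ (opp (fingerBack h k)) = b₂ := by
  simp [fingerFun, fingerBack, opp]

@[simp] theorem fingerFun_rotInv_back :
    fingerFun h k g a₀ a₁ a₂ a₃ b₀ b₁ b₂ b₃ (rotInv (fingerBack h k)) = b₃ := by
  simp [fingerFun, fingerBack, rotInv]

end Values

/-- The edge of `k` lies on the boundary of the face of `h`. -/
structure OnFace (next : Equiv.Perm (C × Bool)) (h k : HalfEdge C) (n : ℕ) : Prop where
  pos : 1 ≤ n
  eq : (face next)^[n] h = k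
  ne : ∀ i, 1 ≤ i → i ≤ n → (face next)^[i] h ≠ h
  edge_ne : k ≠ flip next h

section

variable {next : Equiv.Perm (C × Bool)} {h k : HalfEdge C} {n : ℕ}

theorem OnFace.ne' (hf : OnFace next h k n) : k ≠ h := by
  rw [← hf.eq]
  exact hf.ne n hf.pos le_rfl

theorem OnFace.flip_flip_ne (hf : OnFace next h k n) : flip next k ≠ h := fun e =>
  hf.edge_ne ((flip_eq_iff next).1 e)

theorem OnFace.flip_ne_flip (hf : OnFace next h k n) : flip next k ≠ flip next h := fun e =>
  hf.ne' (flip_injective next e)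

theorem rot_fingerOut_snd : (rot (fingerOut h k)).2 = k.2 := by simp [rot, fingerOut]

theorem rot_fingerBack_snd : (rot (fingerBack h k)).2 = !k.2 := by simp [rot, fingerBack]

theorem rotInv_snd (x : HalfEdge C) : (rotInv x).2 = !(rot x).2 := by
  rcases x with ⟨⟨c, _ | _⟩, _ | _⟩ <;> rfl

theorem face_injective : Function.Injective (face next) := fun x y e =>
  flip_injective next (by simpa [face] using congrArg rot e)

/-- The part of the face of `h` between `h` and `k`. -/
theorem OnFace.exists_segment (hf : OnFace next h k n) : ∃ A : HalfEdge C → ZMod 2,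
    A h = 0 ∧ A (face next h) = 1 ∧ A k = 1 ∧ A (face next k) = 0 ∧
    ∀ x, x ≠ h → x ≠ k → A (face next x) = A x := by
  classical
  refine ⟨fun x => if ∃ i, 1 ≤ i ∧ i ≤ n ∧ (face next)^[i] h = x then 1 else 0, ?_, ?_, ?_, ?_, ?_⟩
  · exact if_neg fun ⟨i, h1, h2, h3⟩ => hf.ne i h1 h2 h3
  · exact if_pos ⟨1, le_rfl, hf.pos, rfl⟩
  · exact if_pos ⟨n, hf.pos, le_rfl, hf.eq⟩
  -- If `face next k` occurred after `i` steps, cancelling them from `n + 1` steps would bring `h`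
  -- back after `n + 1 - i` steps.
  · refine if_neg fun ⟨i, h1, h2, h3⟩ => hf.ne (n + 1 - i) (by omega) (by omega) ?_
    have : (face next)^[i] ((face next)^[n + 1 - i] h) = (face next)^[i] h := by
      rw [h3, ← Function.iterate_add_apply, show i + (n + 1 - i) = n + 1 by omega,
        Function.iterate_succ_apply', hf.eq]
    exact face_injective.iterate i this
  · intro x h1 h2
    refine if_congr ⟨?_, ?_⟩ rfl rfl
    · rintro ⟨i, h3, h4, h5⟩
      obtain ⟨j, rfl⟩ := Nat.exists_eq_add_of_le' h3
      rw [Function.iterate_succ_apply'] at h5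
      have h6 := face_injective h5
      refine ⟨j, ?_, by omega, h6⟩
      rcases j with _ | j
      · exact absurd h6.symm h1
      · omega
    · rintro ⟨i, h3, h4, h5⟩
      refine ⟨i + 1, by omega, ?_, by rw [Function.iterate_succ_apply', h5]⟩
      rcases h4.lt_or_eq with h6 | rfl
      · omega
      · exact absurd (h5.symm.trans hf.eq) h2

end

variable [DecidableEq C] (next : Equiv.Perm (C × Bool)) (h k : HalfEdge C)

/-- The edges of a diagram after pushing a finger of the edge of `h` over the edge of `k`. -/
def fingerFlip : HalfEdge (C ⊕ Bool) → HalfEdge (C ⊕ Bool) :=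
  fingerFun h k
    (fun u => if u = h then opp (fingerOut h k) else if u = flip next h then fingerBack h k
      else if u = k then rot (fingerBack h k) else if u = flip next k then rot (fingerOut h k)
      else inc (flip next u))
    (opp (fingerBack h k)) (inc (flip next k)) (inc h) (rotInv (fingerBack h k))
    (inc (flip next h)) (inc k) (fingerOut h k) (rotInv (fingerOut h k))

variable {next h k} {n : ℕ}

theorem fingerFlip_h : fingerFlip next h k (inc h) = opp (fingerOut h k) := by
  simp [fingerFlip]

theorem fingerFlip_flip_h : fingerFlip next h k (inc (flip next h)) = fingerBack h k := by
  simp [fingerFlip, flip_ne]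

theorem OnFace.fingerFlip_k (hf : OnFace next h k n) :
    fingerFlip next h k (inc k) = rot (fingerBack h k) := by
  simp [fingerFlip, hf.ne', hf.edge_ne]

theorem OnFace.fingerFlip_flip_k (hf : OnFace next h k n) :
    fingerFlip next h k (inc (flip next k)) = rot (fingerOut h k) := by
  simp [fingerFlip, hf.flip_flip_ne, hf.flip_ne_flip, flip_ne]

theorem fingerFlip_inc {u : HalfEdge C} (h1 : u ≠ h) (h2 : u ≠ flip next h) (h3 : u ≠ k)
    (h4 : u ≠ flip next k) : fingerFlip next h k (inc u) = inc (flip next u) := by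
  simp [fingerFlip, h1, h2, h3, h4]

theorem fingerFlip_out : fingerFlip next h k (fingerOut h k) = opp (fingerBack h k) := by
  simp [fingerFlip]

theorem fingerFlip_rot_out : fingerFlip next h k (rot (fingerOut h k)) = inc (flip next k) := by
  simp [fingerFlip]

theorem fingerFlip_opp_out : fingerFlip next h k (opp (fingerOut h k)) = inc h := by
  simp [fingerFlip]

theorem fingerFlip_rotInv_out :
    fingerFlip next h k (rotInv (fingerOut h k)) = rotInv (fingerBack h k) := by
  simp [fingerFlip]

theorem fingerFlip_back : fingerFlip next h k (fingerBack h k) = inc (flip next h) := by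
  simp [fingerFlip]

theorem fingerFlip_rot_back : fingerFlip next h k (rot (fingerBack h k)) = inc k := by
  simp [fingerFlip]

theorem fingerFlip_opp_back : fingerFlip next h k (opp (fingerBack h k)) = fingerOut h k := by
  simp [fingerFlip]

theorem fingerFlip_rotInv_back :
    fingerFlip next h k (rotInv (fingerBack h k)) = rotInv (fingerOut h k) := by
  simp [fingerFlip]

theorem OnFace.fingerFlip_fingerFlip (hf : OnFace next h k n) (x : HalfEdge (C ⊕ Bool)) :
    fingerFlip next h k (fingerFlip next h k x) = x := by
  rcases finger_cases h k x with ⟨u, rfl⟩ | (rfl | rfl | rfl | rfl) | rfl | rfl | rfl | rfl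
  · by_cases h1 : u = h
    · rw [h1, fingerFlip_h, fingerFlip_opp_out]
    by_cases h2 : u = flip next h
    · rw [h2, fingerFlip_flip_h, fingerFlip_back]
    by_cases h3 : u = k
    · rw [h3, hf.fingerFlip_k, fingerFlip_rot_back]
    by_cases h4 : u = flip next k
    · rw [h4, hf.fingerFlip_flip_k, fingerFlip_rot_out]
    rw [fingerFlip_inc h1 h2 h3 h4, fingerFlip_inc, flip_flip]
    · rwa [Ne, flip_eq_iff]
    · exact fun e => h1 (flip_injective next e)
    · rwa [Ne, flip_eq_iff]
    · exact fun e => h3 (flip_injective next e)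
  · rw [fingerFlip_out, fingerFlip_opp_back]
  · rw [fingerFlip_rot_out, hf.fingerFlip_flip_k]
  · rw [fingerFlip_opp_out, fingerFlip_h]
  · rw [fingerFlip_rotInv_out, fingerFlip_rotInv_back]
  · rw [fingerFlip_back, fingerFlip_flip_h]
  · rw [fingerFlip_rot_back, hf.fingerFlip_k]
  · rw [fingerFlip_opp_back, fingerFlip_out]
  · rw [fingerFlip_rotInv_back, fingerFlip_rotInv_out]

theorem OnFace.fingerFlip_snd (hf : OnFace next h k n) (x : HalfEdge (C ⊕ Bool)) :
    (fingerFlip next h k x).2 = !x.2 := by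
  have e1 : (fingerOut h k).2 = h.2 := rfl
  have e2 : (fingerBack h k).2 = h.2 := rfl
  rcases finger_cases h k x with ⟨u, rfl⟩ | (rfl | rfl | rfl | rfl) | rfl | rfl | rfl | rfl
  · by_cases h1 : u = h
    · simp [h1, fingerFlip_h, e1]
    by_cases h2 : u = flip next h
    · simp [h2, fingerFlip_flip_h, e2]
    by_cases h3 : u = k
    · simp [h3, hf.fingerFlip_k, rot_fingerBack_snd]
    by_cases h4 : u = flip next k
    · simp [h4, hf.fingerFlip_flip_k, rot_fingerOut_snd]
    rw [fingerFlip_inc h1 h2 h3 h4]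
    simp
  · simp [fingerFlip_out, e1, e2]
  · simp [fingerFlip_rot_out, rot_fingerOut_snd]
  · simp [fingerFlip_opp_out, e1]
  · simp [fingerFlip_rotInv_out, rotInv_snd, rot_fingerOut_snd, rot_fingerBack_snd]
  · simp [fingerFlip_back, e2]
  · simp [fingerFlip_rot_back, rot_fingerBack_snd]
  · simp [fingerFlip_opp_back, e1, e2]
  · simp [fingerFlip_rotInv_back, rotInv_snd, rot_fingerOut_snd, rot_fingerBack_snd]

/-- The code of a diagram after a finger move. -/
def OnFace.code (hf : OnFace next h k n) : Equiv.Perm ((C ⊕ Bool) × Bool) :=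
  ofFlip (fingerFlip next h k) hf.fingerFlip_fingerFlip hf.fingerFlip_snd

theorem OnFace.flip_code (hf : OnFace next h k n) (x : HalfEdge (C ⊕ Bool)) :
    flip hf.code x = fingerFlip next h k x := flip_ofFlip _ _ _ _

/-- The finger cuts the face of `h` in two. The function `F` is the indicator of the part that
contains the segment from `face next h` to `k`; the listed values determine its boundary at the new
double points. -/
theorem OnFace.exists_fingerFace (hf : OnFace next h k n) : ∃ F : HalfEdge (C ⊕ Bool) → ZMod 2,
    (∀ x, F (rotInv x) = F (flip hf.code x)) ∧ F (inc h) = 0 ∧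
    F (fingerOut h k) = F (inc (flip next k)) ∧ F (opp (fingerOut h k)) = F (inc (flip next h)) ∧
    F (fingerBack h k) = 1 ∧ F (opp (fingerBack h k)) = 0 := by
  obtain ⟨A, A1, A2, A3, A4, A5⟩ := hf.exists_segment
  have hAf : ∀ x, x ≠ h → x ≠ k → A (rotInv (flip next x)) = A x := A5
  let F : HalfEdge (C ⊕ Bool) → ZMod 2 := fingerFun h k A (A (flip next k)) 0 (A (flip next h)) 0
    1 (A (flip next k)) 0 (A (flip next h))
  have hFi : ∀ u, F (inc u) = A u := fun u => rfl
  refine ⟨F, fun x => ?_, A1, by simp [F], by simp [F], by simp [F], by simp [F]⟩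
  rw [hf.flip_code]
  rcases finger_cases h k x with ⟨u, rfl⟩ | (rfl | rfl | rfl | rfl) | rfl | rfl | rfl | rfl
  · have hu : ∀ v, A (rotInv (flip next (flip next v))) = A (rotInv v) := by simp
    by_cases h1 : u = h
    · rw [h1, fingerFlip_h, rotInv_lift, hFi, ← hu, hAf _ (flip_ne _ _) hf.edge_ne.symm]
      simp [F]
    by_cases h2 : u = flip next h
    · rw [h2, fingerFlip_flip_h, rotInv_lift, hFi]
      simp [F]
      exact A2
    by_cases h3 : u = k
    · rw [h3, hf.fingerFlip_k, rotInv_lift, hFi, ← hu, hAf _ hf.flip_flip_ne (flip_ne _ _)]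
      simp [F]
    by_cases h4 : u = flip next k
    · rw [h4, hf.fingerFlip_flip_k, rotInv_lift, hFi]
      simp [F]
      exact A4
    rw [fingerFlip_inc h1 h2 h3 h4, rotInv_lift, hFi, hFi, ← hu, hAf]
    · rwa [Ne, flip_eq_iff]
    · rwa [Ne, flip_eq_iff]
  · rw [fingerFlip_out]; simp [F]
  · rw [fingerFlip_rot_out, hFi]; simp [F]
  · rw [fingerFlip_opp_out, hFi, A1]; simp [F]
  · rw [fingerFlip_rotInv_out]; simp [F]
  · rw [fingerFlip_back, hFi]; simp [F]
  · rw [fingerFlip_rot_back, hFi, A3]; simp [F]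
  · rw [fingerFlip_opp_back]; simp [F]
  · rw [fingerFlip_rotInv_back]; simp [F]

/-- `G` is the indicator of the bigon at the tip of the finger. -/
theorem OnFace.exists_fingerTip (hf : OnFace next h k n) : ∃ G : HalfEdge (C ⊕ Bool) → ZMod 2,
    (∀ x, G (rotInv x) = G (flip hf.code x)) ∧ (∀ u, G (inc u) = 0) ∧
    G (fingerOut h k) = 0 ∧ G (opp (fingerOut h k)) = 0 ∧
    G (fingerBack h k) = 0 ∧ G (opp (fingerBack h k)) = 1 := by
  let G : HalfEdge (C ⊕ Bool) → ZMod 2 := fingerFun h k (fun _ => 0) 0 0 0 1 0 0 1 0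
  have hGi : ∀ u, G (inc u) = 0 := fun u => rfl
  refine ⟨G, fun x => ?_, hGi, by simp [G], by simp [G], by simp [G], by simp [G]⟩
  rw [hf.flip_code]
  rcases finger_cases h k x with ⟨u, rfl⟩ | (rfl | rfl | rfl | rfl) | rfl | rfl | rfl | rfl
  · rw [rotInv_lift, hGi]
    by_cases h1 : u = h
    · rw [h1, fingerFlip_h]; simp [G]
    by_cases h2 : u = flip next h
    · rw [h2, fingerFlip_flip_h]; simp [G]
    by_cases h3 : u = k
    · rw [h3, hf.fingerFlip_k]; simp [G]
    by_cases h4 : u = flip next k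
    · rw [h4, hf.fingerFlip_flip_k]; simp [G]
    rw [fingerFlip_inc h1 h2 h3 h4, hGi]
  · rw [fingerFlip_out]; simp [G]
  · rw [fingerFlip_rot_out, hGi]; simp [G]
  · rw [fingerFlip_opp_out, hGi]; simp [G]
  · rw [fingerFlip_rotInv_out]; simp [G]
  · rw [fingerFlip_back, hGi]; simp [G]
  · rw [fingerFlip_rot_back, hGi]; simp [G]
  · rw [fingerFlip_opp_back]; simp [G]
  · rw [fingerFlip_rotInv_back]; simp [G]

/-- Cycles that run straight through the new double points bound. -/
theorem OnFace.exists_isBoundary [Fintype C] (hf : OnFace next h k n) (hp : IsPlanarCode next)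
    {z : HalfEdge (C ⊕ Bool) → ZMod 2} (hz : IsCycle hf.code z)
    (s1 : z (opp (fingerOut h k)) = z (fingerOut h k))
    (s2 : z (opp (fingerBack h k)) = z (fingerBack h k)) : ∃ w, IsBoundary hf.code w z := by
  rw [isPlanarCode_iff] at hp
  have zf : ∀ x, z (fingerFlip next h k x) = z x := fun x => by
    rw [← hf.flip_code]
    exact hz.flip_eq x
  have e1 := zf (fingerOut h k)
  have e2 := zf (fingerBack h k)
  have e3 := zf (opp (fingerOut h k))
  have e4 := zf (rot (fingerOut h k))
  have e5 := zf (rotInv (fingerOut h k))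
  have e6 := zf (rot (fingerBack h k))
  rw [fingerFlip_out] at e1
  rw [fingerFlip_back] at e2
  rw [fingerFlip_opp_out] at e3
  rw [fingerFlip_rot_out] at e4
  rw [fingerFlip_rotInv_out] at e5
  rw [fingerFlip_rot_back] at e6
  have e7 := hz.sum_eq (fingerOut h k)
  have e8 := hz.sum_eq (fingerBack h k)
  have t1 : z (inc (flip next h)) = z (inc h) := by rw [e2, ← s2, ← e1.symm, e3, s1]
  have t2 : z (inc (flip next k)) = z (inc k) := by
    clear zf hz hp
    grind
  have hz' : IsCycle next (fun u => z (inc u)) := by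
    refine ⟨fun u => ?_, fun u => hz.sum_eq (inc u)⟩
    by_cases h1 : u = h
    · rw [h1, t1]
    by_cases h2 : u = flip next h
    · rw [h2, flip_flip, t1]
    by_cases h3 : u = k
    · rw [h3, t2]
    by_cases h4 : u = flip next k
    · rw [h4, flip_flip, t2]
    have := zf (inc u)
    rwa [fingerFlip_inc h1 h2 h3 h4] at this
  obtain ⟨w, hw⟩ := hp _ hz'
  -- The edges of `h` and `k` have a common face on their left, and `w` is constant on it. This lets
  -- `w` extend over the finger.
  have hkh : w k = w h := by
    rw [← hf.eq]
    exact Function.Semiconj.iterate_right (f := w) (ga := face next) (gb := id)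
      (fun x => hw.face_eq hz'.flip_eq x) n h |>.trans (by simp)
  have wh : w (flip next h) = w h + z (inc h) := hw.flip_eq h
  have wk : w (flip next k) = w k + z (inc k) := hw.flip_eq k
  refine ⟨fingerFun h k w (w (flip next k)) (w h) (w (flip next h)) (w (flip next k) + z (inc h))
    (w h) (w (flip next k)) (w (flip next k) + z (inc h)) (w (flip next h)), fun x => ?_,
    fun x => ?_⟩
  · rw [hf.flip_code]
    rcases finger_cases h k x with ⟨u, rfl⟩ | (rfl | rfl | rfl | rfl) | rfl | rfl | rfl | rfl
    · by_cases h1 : u = h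
      · rw [h1, fingerFlip_h, fingerFun_opp_out, fingerFun_inc, wh]
      by_cases h2 : u = flip next h
      · rw [h2, fingerFlip_flip_h, fingerFun_back, fingerFun_inc, wh, t1]
        clear * -
        grind
      by_cases h3 : u = k
      · rw [h3, hf.fingerFlip_k, fingerFun_rot_back, fingerFun_inc, wk]
      by_cases h4 : u = flip next k
      · rw [h4, hf.fingerFlip_flip_k, fingerFun_rot_out, fingerFun_inc, wk, t2, hkh]
        clear * -
        grind
      rw [fingerFlip_inc h1 h2 h3 h4]
      exact hw.flip_eq u
    · rw [fingerFlip_out, fingerFun_opp_back, fingerFun_out]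
      clear zf hz hz' hw hf hp
      grind
    · rw [fingerFlip_rot_out, fingerFun_rot_out, fingerFun_inc]
      clear zf hz hz' hw hf hp
      grind
    · rw [fingerFlip_opp_out, fingerFun_opp_out, fingerFun_inc]
      clear zf hz hz' hw hf hp
      grind
    · rw [fingerFlip_rotInv_out, fingerFun_rotInv_out, fingerFun_rotInv_back]
      clear zf hz hz' hw hf hp
      grind
    · rw [fingerFlip_back, fingerFun_back, fingerFun_inc]
      clear zf hz hz' hw hf hp
      grind
    · rw [fingerFlip_rot_back, fingerFun_rot_back, fingerFun_inc]
      clear zf hz hz' hw hf hp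
      grind
    · rw [fingerFlip_opp_back, fingerFun_opp_back, fingerFun_out]
      clear zf hz hz' hw hf hp
      grind
    · rw [fingerFlip_rotInv_back, fingerFun_rotInv_back, fingerFun_rotInv_out]
      clear zf hz hz' hw hf hp
      grind
  · rcases finger_cases h k x with ⟨u, rfl⟩ | (rfl | rfl | rfl | rfl) | rfl | rfl | rfl | rfl
    · exact hw.rotInv_eq u
    all_goals
      clear zf hz hz' hw hf hp
      simp only [rotInv_rot, rotInv_opp, rotInv_rotInv, fingerFun_out, fingerFun_back,
        fingerFun_rot_out, fingerFun_rot_back, fingerFun_opp_out, fingerFun_opp_back,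
        fingerFun_rotInv_out, fingerFun_rotInv_back]
      grind

/-- A cycle can turn at the two new double points. Adding the boundaries of one part of the cut face
and of the tip makes it straight at both; such a cycle comes from the old code. -/
theorem OnFace.isPlanarCode [Fintype C] (hf : OnFace next h k n) (hp : IsPlanarCode next) :
    IsPlanarCode hf.code := by
  refine isPlanarCode_of_boundary fun z hz => ?_
  obtain ⟨F, F1, F2, F3, F4, F5, F6⟩ := hf.exists_fingerFace
  obtain ⟨G, G1, G2, G3, G4, G5, G6⟩ := hf.exists_fingerTip
  -- The boundary of the tip changes straightness at both new points, so only `F` affects the sum of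
  -- the two defects; this forces `α`. Then `β` repairs the defect that remains at the first point.
  obtain ⟨α, hα⟩ : ∃ α, α = z (fingerOut h k) + z (opp (fingerOut h k)) + z (fingerBack h k) +
    z (opp (fingerBack h k)) := ⟨_, rfl⟩
  obtain ⟨β, hβ⟩ : ∃ β, β = z (fingerOut h k) + z (opp (fingerOut h k)) +
    α * (F (inc (flip next k)) + F (inc (flip next h))) := ⟨_, rfl⟩
  refine ⟨fun x => α * F x + β * G x, _,
    isBoundary_of_face_eq fun x => by rw [F1, G1], fun hz1 => ?_⟩
  refine hf.exists_isBoundary hp hz1 ?_ ?_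
  · simp only [Pi.add_apply, hf.flip_code, fingerFlip_out, fingerFlip_opp_out, F2, F3, F4, F6, G2,
      G3, G4, G6]
    clear hz1 F1 G1 hz
    grind
  · simp only [Pi.add_apply, hf.flip_code, fingerFlip_back, fingerFlip_opp_back, F3, F5,
      F6, G2, G3, G5, G6]
    clear hz1 F1 G1 hz
    grind

end Finger

/-! ### Strands after a finger move -/

section Finger

variable {C : Type} [DecidableEq C] {next : Equiv.Perm (C × Bool)} {h k : HalfEdge C} {n : ℕ}

theorem OnFace.retH (hf : OnFace next h k n) (x : HalfEdge C) :
    RetH hf.code (Set.range Sum.inr) (inc x) (inc (flip next x)) := by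
  by_cases h1 : x = h
  · subst h1
    refine .of_str (y := opp (fingerOut x k)) (by rw [hf.flip_code, fingerFlip_h]) ⟨_, rfl⟩ ?_
    refine .of_str (y := opp (fingerBack x k)) (by rw [opp_opp, hf.flip_code, fingerFlip_out])
      ⟨_, rfl⟩ ?_
    exact .of_flip (by rw [opp_opp, hf.flip_code, fingerFlip_back]) (by simp)
  by_cases h2 : x = flip next h
  · subst h2
    refine .of_str (y := fingerBack h k) (by rw [hf.flip_code, fingerFlip_flip_h]) ⟨_, rfl⟩ ?_
    refine .of_str (y := fingerOut h k) (by rw [hf.flip_code, fingerFlip_opp_back]) ⟨_, rfl⟩ ?_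
    exact .of_flip (by rw [hf.flip_code, fingerFlip_opp_out, flip_flip]) (by simp)
  by_cases h3 : x = k
  · subst h3
    refine .of_str (y := rot (fingerBack h x)) (by rw [hf.flip_code, hf.fingerFlip_k]) ⟨_, rfl⟩ ?_
    refine .of_str (y := rotInv (fingerOut h x))
      (by rw [opp_rot, hf.flip_code, fingerFlip_rotInv_back]) ⟨_, rfl⟩ ?_
    exact .of_flip (by rw [opp_rotInv, hf.flip_code, fingerFlip_rot_out]) (by simp)
  by_cases h4 : x = flip next k
  · subst h4
    refine .of_str (y := rot (fingerOut h k)) (by rw [hf.flip_code, hf.fingerFlip_flip_k])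
      ⟨_, rfl⟩ ?_
    refine .of_str (y := rotInv (fingerBack h k))
      (by rw [opp_rot, hf.flip_code, fingerFlip_rotInv_out]) ⟨_, rfl⟩ ?_
    exact .of_flip (by rw [opp_rotInv, hf.flip_code, fingerFlip_rot_back, flip_flip]) (by simp)
  exact .of_flip (by rw [hf.flip_code, fingerFlip_inc h1 h2 h3 h4]) (by simp)

/-- No strand is trapped among the new double points, so dissolving them creates no circle. -/
theorem OnFace.exists_retH (hf : OnFace next h k n) (i s b : Bool) :
    ∃ y, RetH hf.code (Set.range Sum.inr) ((Sum.inr i, s), b) y := by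
  rcases finger_cases h k ((Sum.inr i, s), b) with
    ⟨u, hu⟩ | (hu | hu | hu | hu) | hu | hu | hu | hu
  · exact absurd (congrArg (fun z => z.1.1) hu) (by simp)
  all_goals rw [hu]
  · refine ⟨_, .of_str (y := opp (fingerBack h k)) (by rw [hf.flip_code, fingerFlip_out])
      ⟨_, rfl⟩ (.of_flip (by rw [opp_opp, hf.flip_code, fingerFlip_back]) (by simp))⟩
  · exact ⟨_, .of_flip (by rw [hf.flip_code, fingerFlip_rot_out]) (by simp)⟩
  · exact ⟨_, .of_flip (by rw [hf.flip_code, fingerFlip_opp_out]) (by simp)⟩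
  · refine ⟨_, .of_str (y := rotInv (fingerBack h k))
      (by rw [hf.flip_code, fingerFlip_rotInv_out]) ⟨_, rfl⟩
      (.of_flip (by rw [opp_rotInv, hf.flip_code, fingerFlip_rot_back]) (by simp))⟩
  · exact ⟨_, .of_flip (by rw [hf.flip_code, fingerFlip_back]) (by simp)⟩
  · exact ⟨_, .of_flip (by rw [hf.flip_code, fingerFlip_rot_back]) (by simp)⟩
  · refine ⟨_, .of_str (y := fingerOut h k)
      (by rw [hf.flip_code, fingerFlip_opp_back]) ⟨_, rfl⟩
      (.of_flip (by rw [hf.flip_code, fingerFlip_opp_out]) (by simp))⟩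
  · refine ⟨_, .of_str (y := rotInv (fingerOut h k))
      (by rw [hf.flip_code, fingerFlip_rotInv_back]) ⟨_, rfl⟩
      (.of_flip (by rw [opp_rotInv, hf.flip_code, fingerFlip_rot_out]) (by simp))⟩

end Finger

/-! ### The second Reidemeister move -/

section FingerDiagram

variable {D : VirtualDiagram} {h k : HalfEdge D.C} {n : ℕ}

/-- The diagram after a finger move; `κ` is the kind of the first new crossing, and the second one
has the opposite sign. -/
def fingerDiagram (hf : OnFace D.next h k n) (κ : CrossingKind) : VirtualDiagram where
  C := D.C ⊕ Bool
  next := hf.code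
  kind := Sum.elim D.kind fun i => if i then κ.change else κ
  circles := D.circles
  planar := hf.isPlanarCode D.planar

theorem erasesVia_fingerDiagram (hf : OnFace D.next h k n) (κ : CrossingKind) :
    ErasesVia (fingerDiagram hf κ) D (Set.range Sum.inr) Sum.inl := by
  have h1 : ∀ c, c ∈ Set.range (Sum.inl : D.C → D.C ⊕ Bool) ↔ c ∉ Set.range Sum.inr := by
    rintro (c | i) <;> simp
  have h2 : ∀ p, Ret hf.code (Set.range Sum.inr) (Prod.map Sum.inl id p)
      (Prod.map Sum.inl id (D.next p)) := fun p => (hf.retH (p, true)).ret rfl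
  refine ⟨Sum.inl_injective, h1, fun _ => rfl, h2, ?_⟩
  refine congrArg (· + D.circles) (numCycles_eq h1 Sum.inl_injective h2 ?_)
  rintro ⟨_, s⟩ ⟨i, rfl⟩
  obtain ⟨y, hy⟩ := hf.exists_retH i s true
  exact ⟨_, hy.ret rfl⟩

theorem face_tip (hf : OnFace D.next h k n) :
    face hf.code (opp (fingerBack h k)) = rotInv (fingerOut h k) ∧
    face hf.code (rotInv (fingerOut h k)) = opp (fingerBack h k) := by
  refine ⟨?_, ?_⟩
  · rw [face, hf.flip_code, fingerFlip_opp_back]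
  · rw [face, hf.flip_code, fingerFlip_rotInv_out, rotInv_rotInv]

/-- The finger crosses the other strand back and forth, so its two passages have opposite labels;
opposite signs put it over both times. -/
theorem isOver_fingerBack (hf : OnFace D.next h k n) (κ : CrossingKind)
    (ho : (fingerDiagram hf κ).IsOver (fingerOut h k).1) :
    (fingerDiagram hf κ).IsOver (fingerBack h k).1 := by
  cases κ <;> simp_all [IsOver, fingerDiagram, fingerOut, fingerBack, CrossingKind.change]

theorem isOver_rotInv_of_not_isOver (hf : OnFace D.next h k n) {κ : CrossingKind} (hκ : κ ≠ .virt)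
    (ho : ¬ (fingerDiagram hf κ).IsOver (fingerOut h k).1) :
    (fingerDiagram hf κ).IsOver (rotInv (fingerOut h k)).1 ∧
    (fingerDiagram hf κ).IsOver (rotInv (fingerBack h k)).1 := by
  cases κ <;> simp_all [IsOver, fingerDiagram, fingerOut, fingerBack, rotInv, CrossingKind.change]

theorem equivalence_of_move {D D' : VirtualDiagram} (h : Move D D') : equivalence D D' :=
  Relation.EqvGen.rel _ _ h

/-- Either strand may be the upper one, depending on `κ`. The case distinction names the tip bigon
by a half-edge on the upper side, as RII requires. -/
theorem equivalence_fingerDiagram (hf : OnFace D.next h k n) {κ : CrossingKind} (hκ : κ ≠ .virt) :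
    equivalence (fingerDiagram hf κ) D := by
  have hE := erasesVia_fingerDiagram hf κ
  obtain ⟨f1, f2⟩ := face_tip hf
  have e1 : flip hf.code (opp (fingerBack h k)) = fingerOut h k := by
    rw [hf.flip_code, fingerFlip_opp_back]
  have e2 : flip hf.code (rotInv (fingerOut h k)) = rotInv (fingerBack h k) := by
    rw [hf.flip_code, fingerFlip_rotInv_out]
  have s1 : ({Sum.inr true, Sum.inr false} : Set (D.C ⊕ Bool)) = Set.range Sum.inr := by
    ext (c | (_ | _)) <;> simp
  have s2 : ({Sum.inr false, Sum.inr true} : Set (D.C ⊕ Bool)) = Set.range Sum.inr := by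
    rw [Set.pair_comm, s1]
  apply equivalence_of_move
  by_cases ho : (fingerDiagram hf κ).IsOver (fingerOut h k).1
  · refine move_bigon (D := fingerDiagram hf κ) (h := opp (fingerBack h k))
      (g := fingerOut h k) e1 ((congrArg _ f1).trans f2) ?_ (isOver_fingerBack hf κ ho) ho ?_
    · exact fun e => by simpa using Sum.inr_injective e
    · exact (congrArg (fun s => (fingerDiagram hf κ).Erases D s) s1).mpr hE.erases
  · refine move_bigon (D := fingerDiagram hf κ) (h := rotInv (fingerOut h k))
      (g := rotInv (fingerBack h k)) e2 ((congrArg _ f2).trans f1) ?_ ?_ ?_ ?_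
    · exact fun e => by simpa using Sum.inr_injective e
    · exact (isOver_rotInv_of_not_isOver hf hκ ho).1
    · exact (isOver_rotInv_of_not_isOver hf hκ ho).2
    · exact (congrArg (fun s => (fingerDiagram hf κ).Erases D s) s2).mpr hE.erases

end FingerDiagram

/-! ### Turning over a triangle -/

section Triangle

variable {C : Type}

theorem ne_of_vert_ne {g h : HalfEdge C} (e : g.1.1 ≠ h.1.1) :
    (g ≠ h ∧ g ≠ rot h ∧ g ≠ opp h ∧ g ≠ rotInv h) ∧
    (rot g ≠ h ∧ rot g ≠ rot h ∧ rot g ≠ opp h ∧ rot g ≠ rotInv h) ∧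
    (opp g ≠ h ∧ opp g ≠ rot h ∧ opp g ≠ opp h ∧ opp g ≠ rotInv h) ∧
    rotInv g ≠ h ∧ rotInv g ≠ rot h ∧ rotInv g ≠ opp h ∧ rotInv g ≠ rotInv h := by
  refine ⟨⟨?_, ?_, ?_, ?_⟩, ⟨?_, ?_, ?_, ?_⟩, ⟨?_, ?_, ?_, ?_⟩, ?_, ?_, ?_, ?_⟩ <;>
    exact fun h' => e (congrArg (fun x => x.1.1) h')

theorem rotations_ne (h : HalfEdge C) :
    (h ≠ rot h ∧ h ≠ opp h ∧ h ≠ rotInv h) ∧ (rot h ≠ h ∧ rot h ≠ opp h ∧ rot h ≠ rotInv h) ∧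
    (opp h ≠ h ∧ opp h ≠ rot h ∧ opp h ≠ rotInv h) ∧
    rotInv h ≠ h ∧ rotInv h ≠ rot h ∧ rotInv h ≠ opp h := by
  rcases h with ⟨⟨c, _ | _⟩, _ | _⟩ <;> simp [rot, opp, rotInv]

/-- The half-edges `h₀`, `h₁`, `h₂` run around a triangle. -/
structure IsTri (next : Equiv.Perm (C × Bool)) (h₀ h₁ h₂ : HalfEdge C) : Prop where
  face₀ : face next h₀ = h₁
  face₁ : face next h₁ = h₂
  face₂ : face next h₂ = h₀
  ne₀₁ : h₀.1.1 ≠ h₁.1.1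
  ne₁₂ : h₁.1.1 ≠ h₂.1.1
  ne₀₂ : h₀.1.1 ≠ h₂.1.1

variable {next : Equiv.Perm (C × Bool)} {h₀ h₁ h₂ : HalfEdge C}

theorem flip_eq_of_face {g h : HalfEdge C} (e : face next g = h) : flip next g = rot h := by
  rw [← e, face, rot_rotInv]

/-- The passages at the corners of a triangle are distinct. -/
theorem oth_ne_of_ne {p q : C × Bool} (h : p.1 ≠ q.1) :
    p ≠ q ∧ p ≠ oth q ∧ oth p ≠ q ∧ oth p ≠ oth q := by
  refine ⟨?_, ?_, ?_, ?_⟩ <;> exact fun e => h (by simpa using congrArg Prod.fst e)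

theorem rotate_snd {g h : HalfEdge C} (e : face next g = h) :
    g.2 = (rotInv h).2 ∧ (!g.2) = (rot h).2 := by
  have h1 := flip_snd next g
  rw [flip_eq_of_face e] at h1
  rw [rotInv_snd, h1]
  simp

variable [DecidableEq C] (next h₀ h₁ h₂)

/-- For the three edges of a triangle, exchange the two passages at its ends. -/
def triSwap : Equiv.Perm (C × Bool) :=
  Equiv.swap (edgeName next h₀) (next (edgeName next h₀)) *
  Equiv.swap (edgeName next h₁) (next (edgeName next h₁)) *
  Equiv.swap (edgeName next h₂) (next (edgeName next h₂))

variable {next h₀ h₁ h₂}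

/-- The side that leaves a corner by `h` arrives at the next one by the rotation of the next
half-edge, hence at its other passage. This removes the orientations of the sides from the formula.
-/
theorem IsTri.triSwap_eq (ht : IsTri next h₀ h₁ h₂) : triSwap next h₀ h₁ h₂ =
    Equiv.swap h₀.1 (oth h₁.1) * Equiv.swap h₁.1 (oth h₂.1) * Equiv.swap h₂.1 (oth h₀.1) := by
  have key : ∀ g h, face next g = h →
      Equiv.swap (edgeName next g) (next (edgeName next g)) = Equiv.swap g.1 (oth h.1) := by
    intro g h e
    have h1 : (flip next g).1 = oth h.1 := by rw [flip_eq_of_face e, rot_fst]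
    rcases edgeName_cases next g with ⟨_, e1, e2⟩ | ⟨_, e1, e2⟩
    · rw [e2, e1, h1]
    · rw [e2, e1, h1, Equiv.swap_comm]
  rw [triSwap, key _ _ ht.face₀, key _ _ ht.face₁, key _ _ ht.face₂]

theorem IsTri.triSwap_apply (ht : IsTri next h₀ h₁ h₂) :
    triSwap next h₀ h₁ h₂ h₀.1 = oth h₁.1 ∧ triSwap next h₀ h₁ h₂ (oth h₁.1) = h₀.1 ∧
    triSwap next h₀ h₁ h₂ h₁.1 = oth h₂.1 ∧ triSwap next h₀ h₁ h₂ (oth h₂.1) = h₁.1 ∧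
    triSwap next h₀ h₁ h₂ h₂.1 = oth h₀.1 ∧ triSwap next h₀ h₁ h₂ (oth h₀.1) = h₂.1 := by
  have a1 := oth_ne_of_ne ht.ne₀₁
  have a2 := oth_ne_of_ne ht.ne₁₂
  have a3 := oth_ne_of_ne ht.ne₀₂
  have b1 := oth_ne_of_ne ht.ne₀₁.symm
  have b2 := oth_ne_of_ne ht.ne₁₂.symm
  have b3 := oth_ne_of_ne ht.ne₀₂.symm
  have c1 := oth_ne h₀.1
  have c2 := oth_ne h₁.1
  have c3 := oth_ne h₂.1
  rw [ht.triSwap_eq]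
  refine ⟨?_, ?_, ?_, ?_, ?_, ?_⟩ <;>
    simp [Equiv.swap_apply_def, a1, a2, a3, b1, b2, b3, c1, c2, c3, c1.symm, c2.symm, c3.symm]

theorem IsTri.triSwap_of_ne (ht : IsTri next h₀ h₁ h₂) {p : C × Bool} (e0 : p.1 ≠ h₀.1.1)
    (e1 : p.1 ≠ h₁.1.1) (e2 : p.1 ≠ h₂.1.1) : triSwap next h₀ h₁ h₂ p = p := by
  have a0 := oth_ne_of_ne e0
  have a1 := oth_ne_of_ne e1
  have a2 := oth_ne_of_ne e2
  rw [ht.triSwap_eq]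
  simp [Equiv.swap_apply_def, a0, a1, a2]

theorem vert_cases (h₀ h₁ h₂ : HalfEdge C) (p : C × Bool) :
    (p = h₀.1 ∨ p = oth h₀.1) ∨ (p = h₁.1 ∨ p = oth h₁.1) ∨ (p = h₂.1 ∨ p = oth h₂.1) ∨
    (p.1 ≠ h₀.1.1 ∧ p.1 ≠ h₁.1.1 ∧ p.1 ≠ h₂.1.1) := by
  by_cases e0 : p.1 = h₀.1.1
  · exact Or.inl (eq_or_eq_oth e0)
  by_cases e1 : p.1 = h₁.1.1
  · exact Or.inr (Or.inl (eq_or_eq_oth e1))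
  by_cases e2 : p.1 = h₂.1.1
  · exact Or.inr (Or.inr (Or.inl (eq_or_eq_oth e2)))
  exact Or.inr (Or.inr (Or.inr ⟨e0, e1, e2⟩))

theorem IsTri.triSwap_triSwap (ht : IsTri next h₀ h₁ h₂) (p : C × Bool) :
    triSwap next h₀ h₁ h₂ (triSwap next h₀ h₁ h₂ p) = p := by
  obtain ⟨t1, t2, t3, t4, t5, t6⟩ := ht.triSwap_apply
  rcases vert_cases h₀ h₁ h₂ p with (rfl | rfl) | (rfl | rfl) | (rfl | rfl) | ⟨e0, e1, e2⟩
  · rw [t1, t2]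
  · rw [t6, t5]
  · rw [t3, t4]
  · rw [t2, t1]
  · rw [t5, t6]
  · rw [t4, t3]
  · rw [ht.triSwap_of_ne e0 e1 e2, ht.triSwap_of_ne e0 e1 e2]

variable (next h₀ h₁ h₂)

/-- The action of `triSwap` on half-edges. -/
def triSwapH (x : HalfEdge C) : HalfEdge C := (triSwap next h₀ h₁ h₂ x.1, x.2)

/-- The code after turning over a triangle. -/
def triNext : Equiv.Perm (C × Bool) :=
  triSwap next h₀ h₁ h₂ * next * (triSwap next h₀ h₁ h₂)⁻¹

variable {next h₀ h₁ h₂}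

theorem IsTri.triSwapH_triSwapH (ht : IsTri next h₀ h₁ h₂) (x : HalfEdge C) :
    triSwapH next h₀ h₁ h₂ (triSwapH next h₀ h₁ h₂ x) = x :=
  Prod.ext (ht.triSwap_triSwap x.1) rfl

theorem IsTri.triSwap_inv (ht : IsTri next h₀ h₁ h₂) (p : C × Bool) :
    (triSwap next h₀ h₁ h₂)⁻¹ p = triSwap next h₀ h₁ h₂ p := by
  rw [Equiv.Perm.inv_eq_iff_eq, ht.triSwap_triSwap]

theorem IsTri.flip_triNext (ht : IsTri next h₀ h₁ h₂) (x : HalfEdge C) :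
    flip (triNext next h₀ h₁ h₂) x =
      triSwapH next h₀ h₁ h₂ (flip next (triSwapH next h₀ h₁ h₂ x)) := by
  rcases x with ⟨q, _ | _⟩
  · refine Prod.ext ?_ rfl
    change (triSwap next h₀ h₁ h₂ * next * (triSwap next h₀ h₁ h₂)⁻¹)⁻¹ q = _
    rw [mul_inv_rev, mul_inv_rev, inv_inv, Equiv.Perm.mul_apply, Equiv.Perm.mul_apply,
      ht.triSwap_inv]
    rfl
  · refine Prod.ext ?_ rfl
    change (triSwap next h₀ h₁ h₂ * next * (triSwap next h₀ h₁ h₂)⁻¹) q = _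
    rw [Equiv.Perm.mul_apply, Equiv.Perm.mul_apply, ht.triSwap_inv]
    rfl

theorem IsTri.triSwapH_apply (ht : IsTri next h₀ h₁ h₂) :
    (triSwapH next h₀ h₁ h₂ h₀ = rotInv h₁ ∧ triSwapH next h₀ h₁ h₂ (opp h₀) = rot h₁ ∧
      triSwapH next h₀ h₁ h₂ (rot h₀) = opp h₂ ∧ triSwapH next h₀ h₁ h₂ (rotInv h₀) = h₂) ∧
    (triSwapH next h₀ h₁ h₂ h₁ = rotInv h₂ ∧ triSwapH next h₀ h₁ h₂ (opp h₁) = rot h₂ ∧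
      triSwapH next h₀ h₁ h₂ (rot h₁) = opp h₀ ∧ triSwapH next h₀ h₁ h₂ (rotInv h₁) = h₀) ∧
    (triSwapH next h₀ h₁ h₂ h₂ = rotInv h₀ ∧ triSwapH next h₀ h₁ h₂ (opp h₂) = rot h₀ ∧
      triSwapH next h₀ h₁ h₂ (rot h₂) = opp h₁ ∧ triSwapH next h₀ h₁ h₂ (rotInv h₂) = h₁) := by
  obtain ⟨t1, t2, t3, t4, t5, t6⟩ := ht.triSwap_apply
  have r0 := rotate_snd ht.face₀
  have r1 := rotate_snd ht.face₁
  have r2 := rotate_snd ht.face₂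
  refine ⟨⟨?_, ?_, ?_, ?_⟩, ⟨?_, ?_, ?_, ?_⟩, ?_, ?_, ?_, ?_⟩
  · exact Prod.ext t1 r0.1
  · exact Prod.ext t1 r0.2
  · exact Prod.ext t6 r2.2.symm
  · exact Prod.ext t6 r2.1.symm
  · exact Prod.ext t3 r1.1
  · exact Prod.ext t3 r1.2
  · exact Prod.ext t2 r0.2.symm
  · exact Prod.ext t2 r0.1.symm
  · exact Prod.ext t5 r2.1
  · exact Prod.ext t5 r2.2
  · exact Prod.ext t4 r1.2.symm
  · exact Prod.ext t4 r1.1.symm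

theorem IsTri.triSwapH_of_ne (ht : IsTri next h₀ h₁ h₂) {x : HalfEdge C} (e0 : x.1.1 ≠ h₀.1.1)
    (e1 : x.1.1 ≠ h₁.1.1) (e2 : x.1.1 ≠ h₂.1.1) : triSwapH next h₀ h₁ h₂ x = x :=
  Prod.ext (ht.triSwap_of_ne e0 e1 e2) rfl

/-- The exchange `S` of passages matches the edges of the two codes, but it mixes the vertices. A
cycle of the turned code, transported by `S`, becomes a cycle of the old one after a correction `ε`
on the three sides; the function that bounds it is transported back with a correction `ω` at the
three corners. -/
theorem IsTri.isPlanarCode [Fintype C] (ht : IsTri next h₀ h₁ h₂) (hp : IsPlanarCode next) :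
    IsPlanarCode (triNext next h₀ h₁ h₂) := by
  rw [isPlanarCode_iff] at hp ⊢
  intro z' hz'
  have hS := ht.triSwapH_triSwapH
  have hflip := ht.flip_triNext
  have hne := fun x => ht.triSwapH_of_ne (x := x)
  obtain ⟨⟨a1, a2, a3, a4⟩, ⟨b1, b2, b3, b4⟩, c1, c2, c3, c4⟩ := ht.triSwapH_apply
  generalize triSwapH next h₀ h₁ h₂ = S at *
  have k0 := flip_eq_of_face ht.face₀
  have k1 := flip_eq_of_face ht.face₁
  have k2 := flip_eq_of_face ht.face₂
  have k0' : flip next (rot h₁) = h₀ := by rw [← k0, flip_flip]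
  have k1' : flip next (rot h₂) = h₁ := by rw [← k1, flip_flip]
  have k2' : flip next (rot h₀) = h₂ := by rw [← k2, flip_flip]
  have n01 := ne_of_vert_ne ht.ne₀₁
  have n12 := ne_of_vert_ne ht.ne₁₂
  have n02 := ne_of_vert_ne ht.ne₀₂
  have n10 := ne_of_vert_ne ht.ne₀₁.symm
  have n21 := ne_of_vert_ne ht.ne₁₂.symm
  have n20 := ne_of_vert_ne ht.ne₀₂.symm
  have m0 := rotations_ne h₀
  have m1 := rotations_ne h₁
  have m2 := rotations_ne h₂
  have zf : ∀ x, z' (S (flip next (S x))) = z' x := fun x => by rw [← hflip]; exact hz'.flip_eq x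
  -- `δᵢ` tells whether `z'` turns at the `i`-th corner. Below, this defect is compensated along the
  -- opposite side of the triangle.
  obtain ⟨δ₀, d0⟩ : ∃ δ, δ = z' h₀ + z' (opp h₀) := ⟨_, rfl⟩
  obtain ⟨δ₁, d1⟩ : ∃ δ, δ = z' h₁ + z' (opp h₁) := ⟨_, rfl⟩
  obtain ⟨δ₂, d2⟩ : ∃ δ, δ = z' h₂ + z' (opp h₂) := ⟨_, rfl⟩
  have s0 := hz'.sum_eq h₀
  have s1 := hz'.sum_eq h₁
  have s2 := hz'.sum_eq h₂
  have f0 := zf (rotInv h₁)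
  have f1 := zf (rotInv h₂)
  have f2 := zf (rotInv h₀)
  rw [b4, k0, b3] at f0
  rw [c4, k1, c3] at f1
  rw [a4, k2, a3] at f2
  let ε : HalfEdge C → ZMod 2 := fun x =>
    if x = h₀ ∨ x = rot h₁ then δ₂ else if x = h₁ ∨ x = rot h₂ then δ₀
    else if x = h₂ ∨ x = rot h₀ then δ₁ else 0
  have hεf : ∀ x, ε (flip next x) = ε x := by
    intro x
    have g0 : (flip next x = h₀ ∨ flip next x = rot h₁) ↔ (x = h₀ ∨ x = rot h₁) := by
      rw [flip_eq_iff, flip_eq_iff, k0, k0', or_comm]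
    have g1 : (flip next x = h₁ ∨ flip next x = rot h₂) ↔ (x = h₁ ∨ x = rot h₂) := by
      rw [flip_eq_iff, flip_eq_iff, k1, k1', or_comm]
    have g2 : (flip next x = h₂ ∨ flip next x = rot h₀) ↔ (x = h₂ ∨ x = rot h₀) := by
      rw [flip_eq_iff, flip_eq_iff, k2, k2', or_comm]
    simp only [ε, g0, g1, g2]
  have hε0 : ∀ x : HalfEdge C, x.1.1 ≠ h₀.1.1 → x.1.1 ≠ h₁.1.1 → x.1.1 ≠ h₂.1.1 → ε x = 0 := by
    intro x e0 e1 e2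
    have g0 := ne_of_vert_ne e0
    have g1 := ne_of_vert_ne e1
    have g2 := ne_of_vert_ne e2
    simp [ε, g0, g1, g2]
  have ε0 : ε h₀ = δ₂ ∧ ε (rot h₀) = δ₁ ∧ ε (opp h₀) = 0 ∧ ε (rotInv h₀) = 0 := by
    simp [ε, m0, n01, n02]
  have ε1 : ε h₁ = δ₀ ∧ ε (rot h₁) = δ₂ ∧ ε (opp h₁) = 0 ∧ ε (rotInv h₁) = 0 := by
    simp [ε, m1, n10, n12]
  have ε2 : ε h₂ = δ₁ ∧ ε (rot h₂) = δ₀ ∧ ε (opp h₂) = 0 ∧ ε (rotInv h₂) = 0 := by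
    simp [ε, m2, n20, n21]
  have vcases : ∀ x : HalfEdge C, (x = h₀ ∨ x = rot h₀ ∨ x = opp h₀ ∨ x = rotInv h₀) ∨
      (x = h₁ ∨ x = rot h₁ ∨ x = opp h₁ ∨ x = rotInv h₁) ∨
      (x = h₂ ∨ x = rot h₂ ∨ x = opp h₂ ∨ x = rotInv h₂) ∨
      (x.1.1 ≠ h₀.1.1 ∧ x.1.1 ≠ h₁.1.1 ∧ x.1.1 ≠ h₂.1.1) := by
    intro x
    by_cases e0 : x.1.1 = h₀.1.1
    · exact Or.inl (eq_of_vert_eq e0)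
    by_cases e1 : x.1.1 = h₁.1.1
    · exact Or.inr (Or.inl (eq_of_vert_eq e1))
    by_cases e2 : x.1.1 = h₂.1.1
    · exact Or.inr (Or.inr (Or.inl (eq_of_vert_eq e2)))
    exact Or.inr (Or.inr (Or.inr ⟨e0, e1, e2⟩))
  clear_value ε
  have hz : IsCycle next (fun x => z' (S x) + ε x) := by
    refine IsCycle.of_vertex (fun x => ?_) fun c => ?_
    · have := zf (S x)
      rw [hS] at this
      change z' _ + ε _ = z' _ + ε _
      rw [this, hεf]
    · by_cases e0 : c = h₀.1.1
      · refine ⟨h₀, e0.symm, ?_⟩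
        simp only [a1, a2, a3, a4, ε0]
        clear zf hz' hp
        grind
      by_cases e1 : c = h₁.1.1
      · refine ⟨h₁, e1.symm, ?_⟩
        simp only [b1, b2, b3, b4, ε1]
        clear zf hz' hp
        grind
      by_cases e2 : c = h₂.1.1
      · refine ⟨h₂, e2.symm, ?_⟩
        simp only [c1, c2, c3, c4, ε2]
        clear zf hz' hp
        grind
      refine ⟨((c, true), true), rfl, ?_⟩
      rw [hne _ e0 e1 e2, hε0 _ e0 e1 e2, hne _ e0 e1 e2, hε0 _ e0 e1 e2, hne _ e0 e1 e2,
        hε0 _ e0 e1 e2, hne _ e0 e1 e2, hε0 _ e0 e1 e2]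
      simpa using hz'.sum_eq ((c, true), true)
  obtain ⟨w, hw⟩ := hp _ hz
  have r1 := hw.rotInv_eq h₀
  have r2 := hw.rotInv_eq (rot h₀)
  have r3 := hw.rotInv_eq (opp h₀)
  have r4 := hw.rotInv_eq (rotInv h₀)
  have r5 := hw.rotInv_eq h₁
  have r6 := hw.rotInv_eq (rot h₁)
  have r7 := hw.rotInv_eq (opp h₁)
  have r8 := hw.rotInv_eq (rotInv h₁)
  have r9 := hw.rotInv_eq h₂
  have r10 := hw.rotInv_eq (rot h₂)
  have r11 := hw.rotInv_eq (opp h₂)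
  have r12 := hw.rotInv_eq (rotInv h₂)
  have w0 := hw.flip_eq h₀
  have w1 := hw.flip_eq h₁
  have w2 := hw.flip_eq h₂
  rw [k0] at w0
  rw [k1] at w1
  rw [k2] at w2
  simp only [rotInv_rot, rotInv_opp, rotInv_rotInv, a1, a2, a3, a4, ε0, b1, b2, b3, b4, ε1, c1, c2,
    c3, c4, ε2, add_zero] at r1 r2 r3 r4 r5 r6 r7 r8 r9 r10 r11 r12 w0 w1 w2
  -- The values `w (S hᵢ)` are kept, and the values at `rotInv hᵢ` and `opp hᵢ` are forced by going
  -- clockwise around the corner; at `rot hᵢ` no correction is needed.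
  let ω : HalfEdge C → ZMod 2 := fun x =>
    if x = opp h₀ then w (rotInv h₁) + z' h₀ + z' (rotInv h₀) + w (rot h₁)
    else if x = rotInv h₀ then w (rotInv h₁) + z' h₀ + w h₂
    else if x = opp h₁ then w (rotInv h₂) + z' h₁ + z' (rotInv h₁) + w (rot h₂)
    else if x = rotInv h₁ then w (rotInv h₂) + z' h₁ + w h₀
    else if x = opp h₂ then w (rotInv h₀) + z' h₂ + z' (rotInv h₂) + w (rot h₀)
    else if x = rotInv h₂ then w (rotInv h₀) + z' h₂ + w h₁ else 0
  have hω0 : ∀ x : HalfEdge C, x ≠ opp h₀ → x ≠ rotInv h₀ → x ≠ opp h₁ → x ≠ rotInv h₁ →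
      x ≠ opp h₂ → x ≠ rotInv h₂ → ω x = 0 := by
    intro x e1 e2 e3 e4 e5 e6
    simp [ω, e1, e2, e3, e4, e5, e6]
  have ω0 : ω h₀ = 0 ∧ ω (rot h₀) = 0 ∧
      ω (opp h₀) = w (rotInv h₁) + z' h₀ + z' (rotInv h₀) + w (rot h₁) ∧
      ω (rotInv h₀) = w (rotInv h₁) + z' h₀ + w h₂ := by
    simp [ω, m0, n01, n02]
  have ω1 : ω h₁ = 0 ∧ ω (rot h₁) = 0 ∧
      ω (opp h₁) = w (rotInv h₂) + z' h₁ + z' (rotInv h₁) + w (rot h₂) ∧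
      ω (rotInv h₁) = w (rotInv h₂) + z' h₁ + w h₀ := by
    simp [ω, m1, n10, n12]
  have ω2 : ω h₂ = 0 ∧ ω (rot h₂) = 0 ∧
      ω (opp h₂) = w (rotInv h₀) + z' h₂ + z' (rotInv h₂) + w (rot h₀) ∧
      ω (rotInv h₂) = w (rotInv h₀) + z' h₂ + w h₁ := by
    simp [ω, m2, n20, n21]
  clear_value ω
  refine ⟨fun x => w (S x) + ω x, fun x => ?_, fun x => ?_⟩
  · rw [hflip]
    rw [hS, hw.flip_eq, hS]
    have hωS : ∀ y, y ≠ h₀ → y ≠ h₁ → y ≠ h₂ → y ≠ rot h₀ → y ≠ rot h₁ → y ≠ rot h₂ →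
        ω (S y) = 0 ∧ ε y = 0 := by
      intro y i0 i1 i2 j0 j1 j2
      rcases vcases y with (e | e | e | e) | (e | e | e | e) | (e | e | e | e) | ⟨e0, e1, e2⟩
      · exact absurd e i0
      · exact absurd e j0
      · rw [e, a2]; exact ⟨ω1.2.1, ε0.2.2.1⟩
      · rw [e, a4]; exact ⟨ω2.1, ε0.2.2.2⟩
      · exact absurd e i1
      · exact absurd e j1
      · rw [e, b2]; exact ⟨ω2.2.1, ε1.2.2.1⟩
      · rw [e, b4]; exact ⟨ω0.1, ε1.2.2.2⟩
      · exact absurd e i2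
      · exact absurd e j2
      · rw [e, c2]; exact ⟨ω0.2.1, ε2.2.2.1⟩
      · rw [e, c4]; exact ⟨ω1.1, ε2.2.2.2⟩
      · have g0 := ne_of_vert_ne e0
        have g1 := ne_of_vert_ne e1
        have g2 := ne_of_vert_ne e2
        refine ⟨?_, hε0 y e0 e1 e2⟩
        rw [hne y e0 e1 e2]
        apply hω0 <;> simp [g0, g1, g2]
    have goal : ∀ y, ε y + ω (S (flip next y)) = ω (S y) := by
      intro y
      by_cases i0 : y = h₀
      · rw [i0, k0, b3, a1, ω0.2.2.1, ω1.2.2.2, ε0.1]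
        clear zf hz' hp hz hw hω0 hε0 vcases hεf hflip hne hS ht n01 n12 n02 n10 n21 n20 m0 m1 m2 hωS
        grind
      by_cases i1 : y = h₁
      · rw [i1, k1, c3, b1, ω1.2.2.1, ω2.2.2.2, ε1.1]
        clear zf hz' hp hz hw hω0 hε0 vcases hεf hflip hne hS ht n01 n12 n02 n10 n21 n20 m0 m1 m2 hωS
        grind
      by_cases i2 : y = h₂
      · rw [i2, k2, a3, c1, ω2.2.2.1, ω0.2.2.2, ε2.1]
        clear zf hz' hp hz hw hω0 hε0 vcases hεf hflip hne hS ht n01 n12 n02 n10 n21 n20 m0 m1 m2 hωS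
        grind
      by_cases j0 : y = rot h₀
      · rw [j0, k2', a3, c1, ω2.2.2.1, ω0.2.2.2, ε0.2.1]
        clear zf hz' hp hz hw hω0 hε0 vcases hεf hflip hne hS ht n01 n12 n02 n10 n21 n20 m0 m1 m2 hωS
        grind
      by_cases j1 : y = rot h₁
      · rw [j1, k0', b3, a1, ω0.2.2.1, ω1.2.2.2, ε1.2.1]
        clear zf hz' hp hz hw hω0 hε0 vcases hεf hflip hne hS ht n01 n12 n02 n10 n21 n20 m0 m1 m2 hωS
        grind
      by_cases j2 : y = rot h₂
      · rw [j2, k1', c3, b1, ω1.2.2.1, ω2.2.2.2, ε2.2.1]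
        clear zf hz' hp hz hw hω0 hε0 vcases hεf hflip hne hS ht n01 n12 n02 n10 n21 n20 m0 m1 m2 hωS
        grind
      rw [(hωS y i0 i1 i2 j0 j1 j2).1, (hωS y i0 i1 i2 j0 j1 j2).2, (hωS (flip next y) ?_ ?_ ?_ ?_ ?_ ?_).1,
        add_zero]
      all_goals
        rw [Ne, flip_eq_iff]
        first
          | rwa [k0] | rwa [k1] | rwa [k2] | rwa [k0'] | rwa [k1'] | rwa [k2']
    have := goal (S x)
    rw [hS] at this
    linear_combination this
  · rcases vcases x with e | e | e | ⟨e0, e1, e2⟩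
    · rcases e with rfl | rfl | rfl | rfl <;>
      · simp only [rotInv_rot, rotInv_opp, rotInv_rotInv, a1, a2, a3, a4, ω0]
        clear zf hz' hp hz hw hω0 hε0 vcases hεf hflip hne hS ht n01 n12 n02 n10 n21 n20 m0 m1 m2
        grind
    · rcases e with rfl | rfl | rfl | rfl <;>
      · simp only [rotInv_rot, rotInv_opp, rotInv_rotInv, b1, b2, b3, b4, ω1]
        clear zf hz' hp hz hw hω0 hε0 vcases hεf hflip hne hS ht n01 n12 n02 n10 n21 n20 m0 m1 m2
        grind
    · rcases e with rfl | rfl | rfl | rfl <;>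
      · simp only [rotInv_rot, rotInv_opp, rotInv_rotInv, c1, c2, c3, c4, ω2]
        clear zf hz' hp hz hw hω0 hε0 vcases hεf hflip hne hS ht n01 n12 n02 n10 n21 n20 m0 m1 m2
        grind
    · have g0 := ne_of_vert_ne e0
      have g1 := ne_of_vert_ne e1
      have g2 := ne_of_vert_ne e2
      have := hw.rotInv_eq x
      rw [hω0 x, hω0 (rotInv x), hne x e0 e1 e2, hne (rotInv x) e0 e1 e2, this, hε0 x e0 e1 e2,
        hne x e0 e1 e2]
      · ring
      all_goals simp [g0, g1, g2]

end Triangle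

/-! ### Turning over a triangle and dissolving its corners -/

section Dissolve

variable {C : Type} {E : Set C} [DecidableEq C]

/-- Exchanging two consecutive passages, one of which gets dissolved. -/
theorem Ret.swap {next : Equiv.Perm (C × Bool)} {a b : C × Bool} (hab : next a = b) (hne : a ≠ b)
    (hE : a.1 ∈ E ∨ b.1 ∈ E) {p q : C × Bool} (h : Ret next E p q) (hp : p.1 ∉ E) :
    Ret (Equiv.swap a b * next * (Equiv.swap a b)⁻¹) E p q := by
  obtain ⟨σ, hσ⟩ : ∃ σ, σ = Equiv.swap a b * next * (Equiv.swap a b)⁻¹ := ⟨_, rfl⟩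
  have hb : σ b = a := by simp [hσ, hab]
  have ha : σ a = Equiv.swap a b (next b) := by simp [hσ]
  have hx : ∀ x, x ≠ a → x ≠ b → σ x = Equiv.swap a b (next x) := by
    intro x h1 h2
    simp [hσ, Equiv.swap_apply_of_ne_of_ne h1 h2]
  have hnb : ∀ x, x ≠ a → next x ≠ b := fun x h1 h2 => h1 (next.injective (h2.trans hab.symm))
  rw [← hσ]
  clear hσ
  have base : ∀ {x y}, σ x = y → y.1 ∉ E → Ret σ E x y := by
    rintro x y rfl hy
    exact .base hy
  have step : ∀ {x y z}, σ x = y → y.1 ∈ E → Ret σ E y z → Ret σ E x z := by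
    rintro x y z rfl hy hz
    exact .step hy hz
  -- The new order of the two passages is `b`, `a`, so what followed `b` now follows `a`. The last
  -- clause covers a walk from `a`, which formerly ran through the dissolved `b`.
  have claim : (p ≠ a → p ≠ b → Ret σ E p q) ∧ (p = b → Ret σ E a q) ∧
      (p = a → b.1 ∈ E → Ret σ E a q) := by
    clear hp
    have fin : ∀ {x}, Ret next E a x → b.1 ∉ E → x = b := fun h h' =>
      h.unique (hab ▸ Ret.base (by rwa [hab]))
    induction h with
    | @base p hq =>
      refine ⟨fun h1 h2 => ?_, ?_, ?_⟩
      · by_cases e : next p = a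
        · rw [e] at hq ⊢
          have h3 : σ p = b := by rw [hx p h1 h2, e, Equiv.swap_apply_left]
          exact step h3 (hE.resolve_left hq) (base hb hq)
        · exact base (by rw [hx p h1 h2, Equiv.swap_apply_of_ne_of_ne e (hnb p h1)]) hq
      · rintro rfl
        by_cases e : next p = a
        · rw [e] at hq ⊢
          rw [e, Equiv.swap_apply_left] at ha
          exact step ha (hE.resolve_left hq) (base hb hq)
        · exact base (by rw [ha, Equiv.swap_apply_of_ne_of_ne e (hnb p hne.symm)]) hq
      · rintro rfl h1
        exact absurd h1 (by rwa [hab] at hq)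
    | @step p q hq hr ih =>
      refine ⟨fun h1 h2 => ?_, ?_, ?_⟩
      · by_cases e : next p = a
        · rw [e] at hq ih hr
          have h3 : σ p = b := by rw [hx p h1 h2, e, Equiv.swap_apply_left]
          by_cases h4 : b.1 ∈ E
          · exact step h3 h4 (step hb hq (ih.2.2 rfl h4))
          · rw [fin hr h4]
            exact base h3 h4
        · exact step (by rw [hx p h1 h2, Equiv.swap_apply_of_ne_of_ne e (hnb p h1)]) hq
            (ih.1 e (hnb p h1))
      · rintro rfl
        by_cases e : next p = a
        · rw [e] at hq ih hr
          rw [e, Equiv.swap_apply_left] at ha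
          by_cases h4 : p.1 ∈ E
          · exact ih.2.2 rfl h4
          · rw [fin hr h4]
            exact base ha h4
        · exact step (by rw [ha, Equiv.swap_apply_of_ne_of_ne e (hnb p hne.symm)]) hq
            (ih.1 e (hnb p hne.symm))
      · rintro rfl h1
        exact ih.2.1 hab
  by_cases h1 : p = a
  · exact h1 ▸ claim.2.2 h1 (hE.resolve_left (h1 ▸ hp))
  by_cases h2 : p = b
  · exact step (h2 ▸ hb) (hE.resolve_right (h2 ▸ hp)) (claim.2.1 h2)
  exact claim.1 h1 h2

variable {next : Equiv.Perm (C × Bool)} {h₀ h₁ h₂ : HalfEdge C}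

/-- Turning the triangle over is a succession of three exchanges of consecutive passages. Of any two
corners at least one is dissolved, so no exchange is visible to the surviving strands. -/
theorem IsTri.ret (ht : IsTri next h₀ h₁ h₂) (e₀₁ : h₀.1.1 ∈ E ∨ h₁.1.1 ∈ E)
    (e₁₂ : h₁.1.1 ∈ E ∨ h₂.1.1 ∈ E) (e₀₂ : h₀.1.1 ∈ E ∨ h₂.1.1 ∈ E) {p q : C × Bool}
    (h : Ret next E p q) (hp : p.1 ∉ E) : Ret (triNext next h₀ h₁ h₂) E p q := by
  have key : ∀ {g h}, face next g = h → g.1.1 ≠ h.1.1 → (g.1.1 ∈ E ∨ h.1.1 ∈ E) →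
      ∃ a b, next a = b ∧ a ≠ b ∧ (a.1 ∈ E ∨ b.1 ∈ E) ∧ edgeName next g = a ∧
        ((a = g.1 ∧ b = oth h.1) ∨ (b = g.1 ∧ a = oth h.1)) := by
    intro g h e hne hE
    have h1 : (flip next g).1 = oth h.1 := by rw [flip_eq_of_face e, rot_fst]
    have h2 := oth_ne_of_ne hne
    rcases edgeName_cases next g with ⟨_, e1, e2⟩ | ⟨_, e1, e2⟩
    · refine ⟨_, _, e2, ?_, ?_, rfl, ?_⟩ <;> rw [e1, h1]
      · exact h2.2.1
      · simpa
      · simp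
    · refine ⟨_, _, e2, ?_, ?_, rfl, ?_⟩ <;> rw [e1, h1]
      · exact h2.2.1.symm
      · simpa [or_comm]
      · simp
  obtain ⟨a₀, b₀, n₀, d₀, i₀, k₀, s₀⟩ := key ht.face₀ ht.ne₀₁ e₀₁
  obtain ⟨a₁, b₁, n₁, d₁, i₁, k₁, s₁⟩ := key ht.face₁ ht.ne₁₂ e₁₂
  obtain ⟨a₂, b₂, n₂, d₂, i₂, k₂, s₂⟩ := key ht.face₂ ht.ne₀₂.symm e₀₂.symm
  have o1 := oth_ne_of_ne ht.ne₀₁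
  have o2 := oth_ne_of_ne ht.ne₁₂
  have o3 := oth_ne_of_ne ht.ne₀₂
  have o1' := oth_ne_of_ne ht.ne₀₁.symm
  have o3' := oth_ne_of_ne ht.ne₀₂.symm
  have c1 := oth_ne h₀.1
  have c2 := oth_ne h₁.1
  have c3 := oth_ne h₂.1
  -- The three sides use six distinct passages, so each pair is still consecutive after the
  -- preceding exchanges.
  have disj : (a₁ ≠ a₂ ∧ a₁ ≠ b₂ ∧ b₁ ≠ a₂ ∧ b₁ ≠ b₂) ∧ (a₀ ≠ a₂ ∧ a₀ ≠ b₂ ∧ b₀ ≠ a₂ ∧ b₀ ≠ b₂) ∧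
      a₀ ≠ a₁ ∧ a₀ ≠ b₁ ∧ b₀ ≠ a₁ ∧ b₀ ≠ b₁ := by
    rcases s₀ with ⟨rfl, rfl⟩ | ⟨rfl, rfl⟩ <;> rcases s₁ with ⟨rfl, rfl⟩ | ⟨rfl, rfl⟩ <;>
      rcases s₂ with ⟨rfl, rfl⟩ | ⟨rfl, rfl⟩ <;>
      simp [o1, o2, o3, o1', o3', c2, c3, c1.symm]
  obtain ⟨⟨x1, x2, x3, x4⟩, ⟨y1, y2, y3, y4⟩, z1, z2, z3, z4⟩ := disj
  have h2 := h.swap n₂ d₂ i₂ hp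
  have m₁ : (Equiv.swap a₂ b₂ * next * (Equiv.swap a₂ b₂)⁻¹) a₁ = b₁ := by
    simp [Equiv.swap_apply_of_ne_of_ne x1 x2, n₁, Equiv.swap_apply_of_ne_of_ne x3 x4]
  have m₀ : (Equiv.swap a₂ b₂ * next * (Equiv.swap a₂ b₂)⁻¹) a₀ = b₀ := by
    simp [Equiv.swap_apply_of_ne_of_ne y1 y2, n₀, Equiv.swap_apply_of_ne_of_ne y3 y4]
  have h1 := h2.swap m₁ d₁ i₁ hp
  have m₀' : (Equiv.swap a₁ b₁ * (Equiv.swap a₂ b₂ * next * (Equiv.swap a₂ b₂)⁻¹) *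
      (Equiv.swap a₁ b₁)⁻¹) a₀ = b₀ := by
    have z : (Equiv.swap a₁ b₁)⁻¹ a₀ = a₀ := by
      rw [Equiv.swap_inv, Equiv.swap_apply_of_ne_of_ne z1 z2]
    rw [Equiv.Perm.mul_apply, Equiv.Perm.mul_apply, z, m₀, Equiv.swap_apply_of_ne_of_ne z3 z4]
  have h0 := h1.swap m₀' d₀ i₀ hp
  convert h0 using 1
  rw [triNext, triSwap, k₀, k₁, k₂, n₀, n₁, n₂]
  simp [mul_assoc]

end Dissolve

/-! ### The third Reidemeister move -/

/-- The diagram after turning over a triangle. -/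
def triDiagram (D : VirtualDiagram) {h₀ h₁ h₂ : HalfEdge D.C} (ht : IsTri D.next h₀ h₁ h₂) :
    VirtualDiagram where
  C := D.C
  next := triNext D.next h₀ h₁ h₂
  kind := D.kind
  circles := D.circles
  planar := ht.isPlanarCode D.planar

variable {D : VirtualDiagram} {h₀ h₁ h₂ : HalfEdge D.C}

theorem flipsTriangle_triDiagram (ht : IsTri D.next h₀ h₁ h₂) :
    D.FlipsTriangle (triDiagram D ht) (toDart D.next h₀) := by
  refine ⟨Equiv.refl _, fun p => ?_, fun c => rfl, rfl⟩
  have h1 : D.triangleSwap (toDart D.next h₀) = triSwap D.next h₀ h₁ h₂ := by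
    simp only [triangleSwap, triSwap, faceNext_toDart, toDart_fst,
      ht.face₀, Function.iterate_succ_apply, ht.face₁, Function.iterate_zero_apply]
  rw [h1]
  change triNext D.next h₀ h₁ h₂ (triSwap D.next h₀ h₁ h₂ p) = triSwap D.next h₀ h₁ h₂ (D.next p)
  simp [triNext]

theorem equivalence_triDiagram (ht : IsTri D.next h₀ h₁ h₂) (h1 : D.IsOver h₀.1)
    (h2 : D.IsOver (flip D.next h₀).1) (hz : D.IsClassical h₂.1.1) :
    equivalence D (triDiagram D ht) :=
  equivalence_of_move (move_triangle ht.face₀ ht.face₁ ht.face₂ ht.ne₀₁ ht.ne₁₂ ht.ne₀₂ h1 h2 hz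
    (flipsTriangle_triDiagram ht))

/-- The new code is a conjugate of the old one. -/
theorem numComponents_triDiagram (ht : IsTri D.next h₀ h₁ h₂) :
    (triDiagram D ht).numComponents = D.numComponents := by
  have h1 : numCycles (triNext D.next h₀ h₁ h₂) = numCycles D.next := by
    refine Nat.card_congr (Quot.congr (triSwap D.next h₀ h₁ h₂)⁻¹ fun p q => ?_)
    rw [triNext, Equiv.Perm.mul_apply, Equiv.Perm.mul_apply, Equiv.Perm.eq_inv_iff_eq]
  exact congrArg (· + D.circles) h1

/-- Dissolving double points before or after turning over a triangle. -/
theorem ErasesVia.of_triDiagram {D' : VirtualDiagram} {E : Set D.C} {f : D'.C → D.C}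
    (ht : IsTri D.next h₀ h₁ h₂) (e₀₁ : h₀.1.1 ∈ E ∨ h₁.1.1 ∈ E)
    (e₁₂ : h₁.1.1 ∈ E ∨ h₂.1.1 ∈ E) (e₀₂ : h₀.1.1 ∈ E ∨ h₂.1.1 ∈ E)
    (h : ErasesVia (triDiagram D ht) D' E f) : ErasesVia D D' E f where
  injective := h.injective
  range := h.range
  kind := h.kind
  ret p := by
    have hp : (Prod.map f id p).1 ∉ E := h.notMem p.1
    obtain ⟨q, hq⟩ := exists_ret (next := D.next) hp
    have := (ht.ret e₀₁ e₁₂ e₀₂ hq hp).unique (h.ret p)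
    exact this ▸ hq
  numComponents := h.numComponents.trans (numComponents_triDiagram ht)

/-! ### Kinks -/

section Kink

variable {C : Type} [DecidableEq C] (next : Equiv.Perm (C × Bool)) (p : C × Bool)

/-- The code after adding a kink to the edge that starts at the passage `p`. -/
def kinkCode : Equiv.Perm (Option C × Bool) where
  toFun
    | (some c, s) => if (c, s) = p then (none, false) else Prod.map some id (next (c, s))
    | (none, false) => (none, true)
    | (none, true) => Prod.map some id (next p)
  invFun
    | (some c, s) =>
      if (c, s) = next p then (none, true) else Prod.map some id (next.symm (c, s))
    | (none, true) => (none, false)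
    | (none, false) => Prod.map some id p
  left_inv := by
    rintro ⟨_ | c, _ | _⟩
    · rfl
    · simp [Prod.map]
    · by_cases h : (c, false) = p
      · subst h; simp [Prod.map]
      · simp [h, Prod.map]
    · by_cases h : (c, true) = p
      · subst h; simp [Prod.map]
      · simp [h, Prod.map]
  right_inv := by
    rintro ⟨_ | c, _ | _⟩
    · simp [Prod.map]
    · rfl
    · by_cases h : (c, false) = next p
      · simp only [h, if_true, Prod.map, id]
        rw [← h]
      · have h' : next.symm (c, false) ≠ p := fun e => h (by rw [← e, Equiv.apply_symm_apply])
        simp [h, h', Prod.map]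
    · by_cases h : (c, true) = next p
      · simp only [h, if_true, Prod.map, id]
        rw [← h]
      · have h' : next.symm (c, true) ≠ p := fun e => h (by rw [← e, Equiv.apply_symm_apply])
        simp [h, h', Prod.map]

variable {next p}

theorem kinkCode_some_self : kinkCode next p (Prod.map some id p) = (none, false) :=
  if_pos rfl

theorem kinkCode_some {q : C × Bool} (h : q ≠ p) :
    kinkCode next p (Prod.map some id q) = Prod.map some id (next q) :=
  if_neg h

theorem kinkCode_false : kinkCode next p (none, false) = (none, true) := rfl

theorem kinkCode_true : kinkCode next p (none, true) = Prod.map some id (next p) := rfl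

theorem kinkCode_symm_some_next :
    (kinkCode next p).symm (Prod.map some id (next p)) = (none, true) := by
  rw [Equiv.symm_apply_eq, kinkCode_true]

theorem kinkCode_symm_some {q : C × Bool} (h : q ≠ next p) :
    (kinkCode next p).symm (Prod.map some id q) = Prod.map some id (next.symm q) := by
  rw [Equiv.symm_apply_eq, kinkCode_some fun e => h ?_, Equiv.apply_symm_apply]
  rw [← e, Equiv.apply_symm_apply]

theorem flip_kinkCode_out : flip (kinkCode next p) (lift some (p, true)) = ((none, false), false) :=
  Prod.ext kinkCode_some_self rfl

theorem flip_kinkCode_in :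
    flip (kinkCode next p) (lift some (next p, false)) = ((none, true), true) :=
  Prod.ext kinkCode_symm_some_next rfl

theorem flip_kinkCode_lift {x : HalfEdge C} (h1 : x ≠ (p, true)) (h2 : x ≠ (next p, false)) :
    flip (kinkCode next p) (lift some x) = lift some (flip next x) := by
  rcases x with ⟨q, _ | _⟩
  · exact Prod.ext (kinkCode_symm_some fun e => h2 (by rw [e])) rfl
  · exact Prod.ext (kinkCode_some fun e => h1 (by rw [e])) rfl

theorem face_kink :
    face (kinkCode next p) ((none, true), false) = ((none, true), false) := rfl

/-- Adding the boundary of the monogon makes a cycle vanish on the edge of the kink. Then it runs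
straight through the new crossing and restricts to a cycle of the old code. -/
theorem kinkCode_isPlanarCode [Fintype C] (hp : IsPlanarCode next) :
    IsPlanarCode (kinkCode next p) := by
  refine isPlanarCode_of_boundary fun z hz => ?_
  obtain ⟨A, hA⟩ : ∃ A : HalfEdge (Option C) → ZMod 2, ∀ x,
      A x = if x = ((none, true), false) then z ((none, true), false) else 0 :=
    ⟨_, fun _ => rfl⟩
  have h1 : ∀ x, A (rotInv x) = A (flip (kinkCode next p) x) := by
    intro x
    have : rotInv x = ((none, true), false) ↔ flip (kinkCode next p) x = ((none, true), false) := by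
      have e := (face_injective (next := kinkCode next p)).eq_iff (a := flip (kinkCode next p) x)
        (b := ((none, true), false))
      rwa [face_kink, face, flip_flip] at e
    rw [hA, hA]
    simp only [this]
  refine ⟨A, _, isBoundary_of_face_eq h1, fun hz1 => ?_⟩
  obtain ⟨z1, e1⟩ : ∃ z1, z1 = z + fun x => A x + A (flip (kinkCode next p) x) := ⟨_, rfl⟩
  have m1 : z1 ((none, true), false) = 0 := by
    have e2 : flip (kinkCode next p) ((none, true), false) = ((none, false), true) := rfl
    rw [e1, Pi.add_apply, hA, hA, e2, if_pos rfl, if_neg (by simp), add_zero]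
    exact CharTwo.add_self_eq_zero _
  rw [← e1] at hz1 ⊢
  clear e1 h1 hA hz
  have m2 : z1 ((none, false), true) = 0 := by
    rw [← m1, ← hz1.flip_eq ((none, true), false)]
    rfl
  have m3 : z1 ((none, false), false) = z1 (lift some (p, true)) := by
    rw [← hz1.flip_eq (lift some (p, true)), flip_kinkCode_out]
  have m4 : z1 ((none, true), true) = z1 (lift some (next p, false)) := by
    rw [← hz1.flip_eq (lift some (next p, false)), flip_kinkCode_in]
  have m5 : z1 ((none, false), false) + z1 ((none, true), false) + z1 ((none, false), true) +
      z1 ((none, true), true) = 0 := hz1.sum_eq ((none, false), false)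
  have m6 : z1 (lift some (next p, false)) = z1 (lift some (p, true)) := by
    rw [m1, m2, m3, m4] at m5
    clear hz1 hp
    grind
  have hz0 : IsCycle next (fun x => z1 (lift some x)) := by
    refine ⟨fun x => ?_, fun x => ?_⟩
    · by_cases i1 : x = (p, true)
      · subst i1; exact m6
      by_cases i2 : x = (next p, false)
      · subst i2; rw [m6]
        congr 2
        simp [flip]
      · rw [← flip_kinkCode_lift i1 i2, hz1.flip_eq]
    · simpa only [rot_lift, opp_lift, rotInv_lift] using hz1.sum_eq (lift some x)
  rw [isPlanarCode_iff] at hp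
  obtain ⟨w, hw⟩ := hp _ hz0
  have n1 : w (next p, false) = w (p, true) + z1 (lift some (p, true)) := hw.flip_eq (p, true)
  let ω : HalfEdge (Option C) → ZMod 2
    | ((some c, s), b) => w ((c, s), b)
    | ((none, true), true) => w (p, true)
    | ((none, _), _) => w (p, true) + z1 (lift some (p, true))
  have i0 : ∀ x, ω (lift some x) = w x := fun x => rfl
  have i1 : ω ((none, true), true) = w (p, true) := rfl
  have i2 : ω ((none, true), false) = w (p, true) + z1 (lift some (p, true)) := rfl
  have i3 : ω ((none, false), false) = w (p, true) + z1 (lift some (p, true)) := rfl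
  have i4 : ω ((none, false), true) = w (p, true) + z1 (lift some (p, true)) := rfl
  clear_value ω
  rw [m6] at m4
  refine ⟨ω, fun x => ?_, fun x => ?_⟩
  · rcases x with ⟨⟨_ | c, s⟩, b⟩
    · rcases s with _ | _ <;> rcases b with _ | _
      · have : flip (kinkCode next p) ((none, false), false) = lift some (p, true) := rfl
        rw [this, i0, i3, m3]
        clear hz1 hp hz0 hw i0
        grind
      · have : flip (kinkCode next p) ((none, false), true) = ((none, true), false) := rfl
        rw [this, i2, i4, m2, add_zero]
      · have : flip (kinkCode next p) ((none, true), false) = ((none, false), true) := rfl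
        rw [this, i2, i4, m1, add_zero]
      · have : flip (kinkCode next p) ((none, true), true) = lift some (next p, false) := rfl
        rw [this, i0, i1, m4, n1]
    · rw [← lift_mk]
      generalize ((c, s), b) = x
      by_cases j1 : x = (p, true)
      · rw [j1, flip_kinkCode_out, i3, i0]
      by_cases j2 : x = (next p, false)
      · rw [j2, flip_kinkCode_in, i1, i0, n1, m6]
        clear hz1 hp hz0 hw i0
        grind
      rw [flip_kinkCode_lift j1 j2, i0, i0, hw.flip_eq]
  · rcases x with ⟨⟨_ | c, s⟩, b⟩
    · rcases s with _ | _ <;> rcases b with _ | _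
      · change ω ((none, true), true) = _
        rw [i1, i3, m3]
        clear hz1 hp hz0 hw i0
        grind
      · change ω ((none, true), false) = _
        rw [i2, i4, m2, add_zero]
      · change ω ((none, false), false) = _
        rw [i2, i3, m1, add_zero]
      · change ω ((none, false), true) = _
        rw [i1, i4, m4]
    · rw [← lift_mk, rotInv_lift, i0, i0, hw.rotInv_eq]

end Kink

/-! ### The first Reidemeister move -/

variable {D : VirtualDiagram}

/-- The diagram after adding a kink to the edge that starts at the passage `p`. -/
def kinkDiagram (D : VirtualDiagram) (p : D.C × Bool) (κ : CrossingKind) : VirtualDiagram where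
  C := Option D.C
  next := kinkCode D.next p
  kind c := c.elim κ D.kind
  circles := D.circles
  planar := kinkCode_isPlanarCode D.planar

theorem erasesVia_kinkDiagram (D : VirtualDiagram) (p : D.C × Bool) (κ : CrossingKind) :
    ErasesVia (kinkDiagram D p κ) D {(none : Option D.C)} some := by
  have h1 : ∀ c, c ∈ Set.range (some : D.C → Option D.C) ↔ c ∉ ({none} : Set (Option D.C)) := by
    rintro (_ | i) <;> simp
  have h2 : ∀ q, Ret (kinkCode D.next p) {none} (Prod.map some id q)
      (Prod.map some id (D.next q)) := by
    intro q
    by_cases h : q = p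
    · subst h
      refine .step (by rw [kinkCode_some_self]; rfl) ?_
      rw [kinkCode_some_self]
      refine .step (by rw [kinkCode_false]; rfl) ?_
      rw [kinkCode_false, ← kinkCode_true]
      exact .base (by simp [kinkCode_true])
    · rw [← kinkCode_some h]
      exact .base (by simp [kinkCode_some h])
  refine ⟨Option.some_injective _, h1, fun _ => rfl, h2, ?_⟩
  have h3 : Ret (kinkCode D.next p) {none} (none, true) (Prod.map some id (D.next p)) := by
    rw [← kinkCode_true]
    exact .base (by simp [kinkCode_true])
  have h4 : Ret (kinkCode D.next p) {none} (none, false) (Prod.map some id (D.next p)) :=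
    .step (by rw [kinkCode_false]; rfl) (by rwa [kinkCode_false])
  refine congrArg (· + D.circles) (numCycles_eq h1 (Option.some_injective _) h2 ?_)
  rintro ⟨_, _ | _⟩ rfl
  exacts [⟨_, h4⟩, ⟨_, h3⟩]

theorem equivalence_kinkDiagram (p : D.C × Bool) {κ : CrossingKind} (hκ : κ ≠ .virt) :
    equivalence (kinkDiagram D p κ) D :=
  equivalence_of_move (move_monogon (D := kinkDiagram D p κ) (h := ((none, true), false))
    face_kink hκ (erasesVia_kinkDiagram D p κ).erases)

/-! ### Paths and loops of half-edges -/

section Path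

variable {C : Type}

/-- A strand that arrives by the half-edge `u`, runs straight on along the half-edges in a list,
and finally arrives by the half-edge `y`. -/
def Path (next : Equiv.Perm (C × Bool)) : HalfEdge C → List (HalfEdge C) → HalfEdge C → Prop
  | u, [], y => u = y
  | u, a :: l, y => u = opp a ∧ Path next (flip next a) l y

variable {next : Equiv.Perm (C × Bool)}

theorem path_append {u y a : HalfEdge C} {l₁ l₂ : List (HalfEdge C)} :
    Path next u (l₁ ++ a :: l₂) y ↔ Path next u l₁ (opp a) ∧ Path next (flip next a) l₂ y := by
  induction l₁ generalizing u with
  | nil => exact Iff.rfl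
  | cons b l ih => simp only [List.cons_append, Path, ih, and_assoc]

theorem Path.flip_mem {x y : HalfEdge C} {l : List (HalfEdge C)} (h : Path next (flip next x) l y) :
    ∀ g ∈ x :: l, (∃ a ∈ l, flip next g = opp a) ∨ flip next g = y := by
  induction l generalizing x with
  | nil =>
    intro g hg
    rw [List.mem_singleton] at hg
    subst hg
    exact Or.inr h
  | cons b l ih =>
    intro g hg
    rcases List.mem_cons.1 hg with rfl | hg
    · exact Or.inl ⟨b, by simp, h.1⟩
    · rcases ih h.2 g hg with ⟨a, ha, e⟩ | e
      · exact Or.inl ⟨a, by simp [ha], e⟩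
      · exact Or.inr e

theorem Path.exists_flip {x y : HalfEdge C} {l : List (HalfEdge C)}
    (h : Path next (flip next x) l y) : ∀ a ∈ l, ∃ g ∈ x :: l, flip next g = opp a := by
  induction l generalizing x with
  | nil => simp
  | cons b l ih =>
    intro a ha
    rcases List.mem_cons.1 ha with rfl | ha
    · exact ⟨x, by simp, h.1⟩
    · obtain ⟨g, hg, e⟩ := ih h.2 a ha
      exact ⟨g, List.mem_cons_of_mem _ hg, e⟩

/-- Departing half-edges are renamed by `F` and arriving ones by `G`. The two may differ, so that a
path can be redirected where it ends. -/
theorem Path.map {C' : Type} {next' : Equiv.Perm (C' × Bool)} {F G : HalfEdge C → HalfEdge C'}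
    {u y : HalfEdge C} {l : List (HalfEdge C)} (h : Path next u l y)
    (h1 : ∀ g ∈ l, flip next' (F g) = G (flip next g)) (h2 : ∀ g ∈ l, G (opp g) = opp (F g)) :
    Path next' (G u) (l.map F) (G y) := by
  induction l generalizing u with
  | nil => exact congrArg G h
  | cons b l ih =>
    refine ⟨by rw [h.1, h2 b (by simp)], ?_⟩
    rw [h1 b (by simp)]
    exact ih h.2 (fun g hg => h1 g (by simp [hg])) fun g hg => h2 g (by simp [hg])

/-- The half-edges `h₀ :: l` run once around an embedded loop with one corner, which is
at the double point of `h₀`; the loop turns left there. -/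
structure Loop (next : Equiv.Perm (C × Bool)) (h₀ : HalfEdge C) (l : List (HalfEdge C)) :
    Prop where
  path : Path next (flip next h₀) l (rot h₀)
  nodup : ((h₀ :: l).map fun x => x.1.1).Nodup

variable {h₀ : HalfEdge C} {l : List (HalfEdge C)}

theorem Loop.eq_of_vert (hl : Loop next h₀ l) {x y : HalfEdge C} (hx : x ∈ h₀ :: l)
    (hy : y ∈ h₀ :: l) (h : x.1.1 = y.1.1) : x = y :=
  List.inj_on_of_nodup_map hl.nodup hx hy h

theorem Loop.ne_of_mem (hl : Loop next h₀ l) {x : HalfEdge C} (hx : x ∈ l) :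
    x.1.1 ≠ h₀.1.1 := by
  have := hl.nodup
  rw [List.map_cons, List.nodup_cons] at this
  exact fun e => this.1 (e ▸ List.mem_map_of_mem hx)

theorem Loop.flip_vert (hl : Loop next h₀ l) {g : HalfEdge C} (hg : g ∈ h₀ :: l) :
    ∃ a ∈ h₀ :: l, (flip next g).1.1 = a.1.1 := by
  rcases hl.path.flip_mem g hg with ⟨a, ha, e⟩ | e
  · exact ⟨a, by simp [ha], by rw [e]; rfl⟩
  · exact ⟨h₀, by simp, by rw [e]; rfl⟩

/-- The half-edges of a loop are not their own left neighbours, and so on. -/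
theorem Loop.flip_ne (hl : Loop next h₀ l) {g x : HalfEdge C} (hg : g ∈ h₀ :: l)
    (hx : x ∈ l) : flip next g ≠ x ∧ flip next g ≠ rot x ∧ flip next g ≠ rotInv x := by
  have m := rotations_ne x
  rcases hl.path.flip_mem g hg with ⟨a, ha, e⟩ | e
  · have key : ∀ y : HalfEdge C, y.1.1 = x.1.1 → y ≠ opp x → flip next g ≠ y := by
      intro y hy hne e'
      have : a = x := hl.eq_of_vert (by simp [ha]) (by simp [hx])
        (by rw [← hy, ← e', e]; rfl)
      exact hne (by rw [← e', e, this])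
    exact ⟨key _ rfl m.1.2.1, key _ rfl m.2.1.2.1, key _ rfl m.2.2.2.2.2⟩
  · have key : ∀ y : HalfEdge C, y.1.1 = x.1.1 → flip next g ≠ y := by
      intro y hy e'
      exact hl.ne_of_mem hx (by rw [← hy, ← e', e]; rfl)
    exact ⟨key _ rfl, key _ rfl, key _ rfl⟩

theorem Loop.flip_ne_corner (hl : Loop next h₀ l) {g : HalfEdge C} (hg : g ∈ h₀ :: l) :
    flip next g ≠ h₀ := by
  have m := rotations_ne h₀
  rcases hl.path.flip_mem g hg with ⟨a, ha, e⟩ | e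
  · intro e'
    exact hl.ne_of_mem ha (by rw [← e', e]; rfl)
  · rw [e]
    exact m.2.1.1

theorem Loop.nodup_list (hl : Loop next h₀ l) : (h₀ :: l).Nodup := hl.nodup.of_map _

theorem Loop.rot_notMem (hl : Loop next h₀ l) {x : HalfEdge C} (hx : x ∈ h₀ :: l) :
    rot x ∉ h₀ :: l :=
  fun h => (rotations_ne x).2.1.1 (hl.eq_of_vert h hx rfl)

/-! ### The cycle of a path -/

section Cycle

/-- A function that bounds is constant along the left-hand side of a path, if the cycle does not
leave the path there. -/
theorem Path.const {w z : HalfEdge C → ZMod 2} (hw : IsBoundary next w z)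
    (hz : ∀ x, z (flip next x) = z x) {u y : HalfEdge C} {l : List (HalfEdge C)}
    (h : Path next u l y) (hl : ∀ g ∈ l, z (rot g) = 0) :
    (∀ g ∈ l, w (rot g) = w (rotInv u) ∧ w g = w (rotInv u)) ∧ w (rotInv y) = w (rotInv u) := by
  induction l generalizing u with
  | nil => exact ⟨by simp, by rw [show u = y from h]⟩
  | cons b l ih =>
    have h1 : rotInv u = rot b := by rw [h.1, rotInv_opp]
    have h2 : w b = w (rot b) := by
      have := hw.rotInv_eq (rot b)
      rwa [rotInv_rot, hl b (by simp), add_zero] at this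
    have h3 : w (rotInv (flip next b)) = w b := hw.face_eq hz b
    obtain ⟨i1, i2⟩ := ih h.2 fun g hg => hl g (by simp [hg])
    rw [h3, h2] at i1 i2
    rw [h1]
    refine ⟨?_, i2⟩
    intro g hg
    rcases List.mem_cons.1 hg with rfl | hg
    · exact ⟨rfl, h2⟩
    · exact i1 g hg

variable [DecidableEq C]

/-- The sum of the edges of a list of half-edges, modulo 2. -/
def edgeSum (next : Equiv.Perm (C × Bool)) (l : List (HalfEdge C)) (x : HalfEdge C) : ZMod 2 :=
  l.count x + l.count (flip next x)

theorem edgeSum_flip (l : List (HalfEdge C)) (x : HalfEdge C) :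
    edgeSum next l (flip next x) = edgeSum next l x := by
  rw [edgeSum, edgeSum, flip_flip, add_comm]

theorem edgeSum_eq_zero {x : HalfEdge C} (h1 : x ∉ l) (h2 : flip next x ∉ l) :
    edgeSum next l x = 0 := by
  rw [edgeSum, List.count_eq_zero_of_not_mem h1, List.count_eq_zero_of_not_mem h2]
  simp

theorem edgeSum_eq_one {x : HalfEdge C} (hl : l.Nodup) (h1 : x ∈ l) (h2 : flip next x ∉ l) :
    edgeSum next l x = 1 := by
  rw [edgeSum, List.count_eq_one_of_mem hl h1, List.count_eq_zero_of_not_mem h2]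
  simp

theorem sum_indicator (a x : HalfEdge C) :
    ((if x = a then 1 else 0) + (if rot x = a then 1 else 0) + (if opp x = a then 1 else 0) +
      (if rotInv x = a then 1 else 0) : ZMod 2) = if x.1.1 = a.1.1 then 1 else 0 := by
  by_cases h : x.1.1 = a.1.1
  · have m := rotations_ne a
    rcases eq_of_vert_eq h with rfl | rfl | rfl | rfl <;> simp [m]
  · have m := ne_of_vert_ne h
    simp [m, h]

/-- A path has boundary at its two ends only. -/
theorem Path.sum_edgeSum {x y : HalfEdge C} {l : List (HalfEdge C)}
    (h : Path next (flip next x) l y) (g : HalfEdge C) :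
    edgeSum next (x :: l) g + edgeSum next (x :: l) (rot g) + edgeSum next (x :: l) (opp g) +
      edgeSum next (x :: l) (rotInv g) =
    (if g.1.1 = x.1.1 then 1 else 0) + (if g.1.1 = y.1.1 then 1 else 0) := by
  have key : ∀ (l : List (HalfEdge C)) (x g : HalfEdge C), edgeSum next (x :: l) g =
      edgeSum next l g + (if g = x then 1 else 0) + (if g = flip next x then 1 else 0) := by
    intro l x g
    have e : flip next g = x ↔ g = flip next x := flip_eq_iff next
    have e1 : ∀ b : HalfEdge C, (x :: l).count b = l.count b + if b = x then 1 else 0 := by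
      intro b
      rw [List.count_cons]
      congr 1
      by_cases e' : b = x
      · rw [e']; simp
      · rw [if_neg e', if_neg]
        simpa using fun h => e' h.symm
    simp only [edgeSum, e1, e]
    push_cast
    ring
  have s1 := sum_indicator x g
  induction l generalizing x with
  | nil =>
    have s2 := sum_indicator (flip next x) g
    rw [← show flip next x = y from h]
    have e0 : ∀ b, edgeSum next [] b = 0 := fun b => by simp [edgeSum]
    rw [key, key _ x (rot g), key _ x (opp g), key _ x (rotInv g), e0, e0, e0, e0]
    linear_combination s1 + s2
  | cons b l ih =>
    have s2 := sum_indicator (flip next x) g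
    have := ih h.2 (sum_indicator b g)
    have hb : (flip next x).1.1 = b.1.1 := by rw [h.1]; rfl
    rw [key, key _ x (rot g), key _ x (opp g), key _ x (rotInv g)]
    rw [hb] at s2
    have two : ((if g.1.1 = b.1.1 then 1 else 0) + (if g.1.1 = b.1.1 then 1 else 0) : ZMod 2) = 0 :=
      CharTwo.add_self_eq_zero _
    linear_combination s1 + s2 + this + two

end Cycle

end Path

/-! ### The inside of a loop -/

section Inside

variable {C : Type} {next : Equiv.Perm (C × Bool)} {h₀ : HalfEdge C} {l : List (HalfEdge C)}

/-- The half-edges inside a loop: those at the double points in `J`, and those that leave the loop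
to the left. -/
def Inside (l : List (HalfEdge C)) (J : Finset C) (x : HalfEdge C) : Prop :=
  x.1.1 ∈ J ∨ ∃ h ∈ l, x = rot h

/-- The inside of a loop is separated from the outside. -/
theorem Loop.exists_inside [Fintype C] [DecidableEq C] (hl : Loop next h₀ l)
    (hp : IsPlanarCode next) : ∃ J : Finset C, (∀ h ∈ h₀ :: l, h.1.1 ∉ J) ∧
      ∀ x, Inside l J x → Inside l J (flip next x) := by
  rw [isPlanarCode_iff] at hp
  -- The loop is a cycle modulo 2, and a function `w` that it bounds tells the two sides apart: the
  -- inside is where `w` has the value it has on the left of `h₀`.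
  obtain ⟨z, hz⟩ : ∃ z, z = edgeSum next (h₀ :: l) := ⟨_, rfl⟩
  have hc : IsCycle next z := by
    rw [hz]
    refine ⟨edgeSum_flip _, fun x => ?_⟩
    rw [hl.path.sum_edgeSum]
    exact CharTwo.add_self_eq_zero _
  obtain ⟨w, hw⟩ := hp z hc
  have z_rot : ∀ g ∈ l, z (rot g) = 0 := by
    intro g hg
    rw [hz]
    refine edgeSum_eq_zero (hl.rot_notMem (by simp [hg])) fun h => ?_
    exact (hl.flip_ne h hg).2.1 (flip_flip next _)
  have z_one : ∀ g ∈ h₀ :: l, z g = 1 := by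
    intro g hg
    rw [hz]
    refine edgeSum_eq_one hl.nodup_list hg fun h => ?_
    rcases List.mem_cons.1 hg with rfl | hg'
    · exact hl.flip_ne_corner h (flip_flip next _)
    · exact (hl.flip_ne h hg').1 (flip_flip next _)
  have z_off : ∀ x : HalfEdge C, (∀ h ∈ h₀ :: l, h.1.1 ≠ x.1.1) → z x = 0 := by
    intro x hx
    rw [hz]
    refine edgeSum_eq_zero (fun h => hx x h rfl) fun h => ?_
    obtain ⟨a, ha, e⟩ := hl.flip_vert h
    rw [flip_flip] at e
    exact hx a ha e.symm
  obtain ⟨c1, c2⟩ := hl.path.const hw hc.flip_eq z_rot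
  have e0 : w (rotInv (flip next h₀)) = w h₀ := hw.face_eq hc.flip_eq h₀
  rw [e0] at c1 c2
  -- the values outside the loop
  have out : ∀ g ∈ l, w (opp g) = w h₀ + 1 ∧ w (rotInv g) = w h₀ + 1 := by
    intro g hg
    refine ⟨?_, ?_⟩
    · obtain ⟨b, hb, e⟩ := hl.path.exists_flip g hg
      rw [← e, hw.flip_eq, z_one b hb]
      rcases List.mem_cons.1 hb with rfl | hb
      · rfl
      · rw [(c1 b hb).2]
    · rw [hw.rotInv_eq, z_one g (by simp [hg]), (c1 g hg).2]
  -- As the loop turns left at its corner, only one of the four sectors there is inside, the one on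
  -- the left of `h₀`.
  have out0 : w (rotInv h₀) = w h₀ + 1 ∧ w (opp h₀) = w h₀ + 1 ∧ w (rot h₀) = w h₀ + 1 := by
    have i1 := hw.rotInv_eq h₀
    have i2 := hw.rotInv_eq (rot h₀)
    have i3 := hw.rotInv_eq (opp h₀)
    have i4 := hw.rotInv_eq (rotInv h₀)
    have s := hc.sum_eq h₀
    have z0 := z_one h₀ (by simp)
    rw [rotInv_rot] at i2
    rw [rotInv_opp] at i3
    rw [rotInv_rotInv] at i4
    have zr : z (rotInv h₀) = 0 := by
      rw [hz]
      refine edgeSum_eq_zero (fun h => ?_) fun h => ?_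
      · exact (rotations_ne h₀).2.2.2.1 (hl.eq_of_vert h (by simp) rfl)
      · rcases hl.path.flip_mem _ h with ⟨a, ha, e⟩ | e
        · rw [flip_flip] at e
          exact hl.ne_of_mem ha (congrArg (fun y => y.1.1) e).symm
        · rw [flip_flip] at e
          exact (rotations_ne h₀).2.2.2.2.1 e
    have zo : z (opp h₀) = 0 := by
      rw [hz]
      refine edgeSum_eq_zero (fun h => ?_) fun h => ?_
      · exact (rotations_ne h₀).2.2.1.1 (hl.eq_of_vert h (by simp) rfl)
      · rcases hl.path.flip_mem _ h with ⟨a, ha, e⟩ | e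
        · rw [flip_flip] at e
          exact hl.ne_of_mem ha (congrArg (fun y => y.1.1) e).symm
        · rw [flip_flip] at e
          exact (rotations_ne h₀).2.2.1.2.1 e
    clear out c1 z_off z_one z_rot hw hc hp hz hl
    grind
  have w_off : ∀ x : HalfEdge C, (∀ h ∈ h₀ :: l, h.1.1 ≠ x.1.1) → ∀ y : HalfEdge C,
      y.1.1 = x.1.1 → w y = w x := by
    intro x hx y hy
    have i1 := hw.rotInv_eq x
    have i3 := hw.rotInv_eq (opp x)
    have i4 := hw.rotInv_eq (rotInv x)
    rw [z_off _ hx] at i1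
    rw [z_off (opp x) hx, rotInv_opp] at i3
    rw [z_off (rotInv x) hx, rotInv_rotInv] at i4
    rcases eq_of_vert_eq hy with rfl | rfl | rfl | rfl
    · rfl
    · rw [i3, i4, i1]; simp
    · rw [i4, i1]; simp
    · rw [i1]; simp
  -- Off the loop, `w` is constant around a double point by `w_off`, so the half-edge that
  -- represents it is immaterial.
  refine ⟨Finset.univ.filter fun c => (∀ h ∈ h₀ :: l, h.1.1 ≠ c) ∧
    w ((c, true), true) = w h₀, fun h hh h' => ?_, fun x hx => ?_⟩
  · rw [Finset.mem_filter] at h'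
    exact h'.2.1 h hh rfl
  have hx1 : w x = w h₀ ∧ z x = 0 := by
    rcases hx with hx | ⟨g, hg, rfl⟩
    · rw [Finset.mem_filter] at hx
      have e := w_off x hx.2.1 ((x.1.1, true), true) rfl
      exact ⟨e.symm.trans hx.2.2, z_off x hx.2.1⟩
    · exact ⟨(c1 g hg).1, z_rot g hg⟩
  have hx2 : w (flip next x) = w h₀ ∧ z (flip next x) = 0 :=
    ⟨by rw [hw.flip_eq, hx1.1, hx1.2, add_zero], by rw [hc.flip_eq, hx1.2]⟩
  generalize flip next x = y at hx2
  have ne1 : w h₀ ≠ w h₀ + 1 := by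
    intro e
    exact one_ne_zero (α := ZMod 2) (by linear_combination -e)
  by_cases hy : ∀ h ∈ h₀ :: l, h.1.1 ≠ y.1.1
  · refine Or.inl (Finset.mem_filter.2 ⟨Finset.mem_univ _, hy, ?_⟩)
    rw [← hx2.1]
    exact w_off y hy _ rfl
  · push Not at hy
    obtain ⟨h, hh, e⟩ := hy
    have z1 := z_one h hh
    rcases List.mem_cons.1 hh with rfl | hh
    · exfalso
      rcases eq_of_vert_eq e.symm with rfl | rfl | rfl | rfl
      · rw [z1] at hx2; exact one_ne_zero hx2.2
      · exact ne1 (hx2.1.symm.trans out0.2.2)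
      · exact ne1 (hx2.1.symm.trans out0.2.1)
      · exact ne1 (hx2.1.symm.trans out0.1)
    · rcases eq_of_vert_eq e.symm with rfl | rfl | rfl | rfl
      · rw [z1] at hx2; exact absurd hx2.2 one_ne_zero
      · exact Or.inr ⟨h, hh, rfl⟩
      · exact absurd (hx2.1.symm.trans (out h hh).1) ne1
      · exact absurd (hx2.1.symm.trans (out h hh).2) ne1

end Inside

/-! ### Loops whose inside consists of chords -/

section Chords

variable {C : Type} {next : Equiv.Perm (C × Bool)} {h₀ : HalfEdge C} {l : List (HalfEdge C)}

/-- Chords of a loop do not cross. -/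
theorem Loop.chord_mem [Fintype C] [DecidableEq C] {l₁ m l₂ : List (HalfEdge C)}
    {p q i j : HalfEdge C} (hl : Loop next h₀ (l₁ ++ p :: (m ++ q :: l₂))) (hp : IsPlanarCode next)
    (hpq : flip next (rot p) = rot q) (hij : flip next (rot i) = rot j) (hi : i ∈ m)
    (hj : j ∈ l₁ ++ p :: (m ++ q :: l₂)) : j ∈ m := by
  rw [isPlanarCode_iff] at hp
  obtain ⟨L, hL⟩ : ∃ L, L = l₁ ++ p :: (m ++ q :: l₂) := ⟨_, rfl⟩
  have mem : ∀ x, x ∈ L ↔ x ∈ l₁ ∨ x = p ∨ x ∈ m ∨ x = q ∨ x ∈ l₂ := by simp [hL]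
  have nd : L.Nodup := hL ▸ (List.nodup_cons.1 hl.nodup_list).2
  have nd2 : p ∉ m ∧ q ∉ m ∧ p ∉ l₁ ∧ q ∉ l₁ ∧ p ∉ l₂ ∧ q ∉ l₂ ∧ p ≠ q ∧
      (∀ x ∈ m, x ∉ l₁ ∧ x ∉ l₂) := by
    rw [hL] at nd
    simp only [List.nodup_append, List.nodup_cons, List.mem_append, List.mem_cons] at nd
    grind
  obtain ⟨np, nq, np1, nq1, np2, nq2, npq, -⟩ := nd2
  have path := hl.path
  rw [path_append, path_append] at path
  obtain ⟨P1, P2, P3⟩ := path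
  rw [← hL] at hl hj
  have hqp : flip next (rot q) = rot p := by rw [← hpq, flip_flip]
  have rot_inj : ∀ {x y : HalfEdge C}, rot x = rot y → x = y := fun {x y} e => by
    rw [← rotInv_rot x, e, rotInv_rot]
  -- The chord from `p` to `q` and the arc of the loop between them form a cycle. Its bounding
  -- function separates the inward side of the arc `m` from that of the rest of the loop, while it
  -- does not change across the edge from `i` to `j`.
  obtain ⟨z, hz⟩ : ∃ z : HalfEdge C → ZMod 2, ∀ x, z x = edgeSum next (p :: m) x +
    ((if x = rot p then 1 else 0) + (if x = rot q then 1 else 0)) := ⟨_, fun _ => rfl⟩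
  have hc : IsCycle next z := by
    refine ⟨fun x => ?_, fun x => ?_⟩
    · rw [hz, hz, edgeSum_flip]
      have e1 : flip next x = rot p ↔ x = rot q := by rw [flip_eq_iff, hpq]
      have e2 : flip next x = rot q ↔ x = rot p := by rw [flip_eq_iff, hqp]
      simp only [e1, e2]
      ring
    · have s1 := P2.sum_edgeSum x
      have s2 := sum_indicator (rot p) x
      have s3 := sum_indicator (rot q) x
      have e1 : (rot p).1.1 = p.1.1 := rfl
      have e2 : (rot q).1.1 = q.1.1 := rfl
      have e3 : (opp q).1.1 = q.1.1 := rfl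
      rw [e1] at s2
      rw [e2] at s3
      rw [e3] at s1
      rw [hz, hz, hz, hz]
      have t1 : ∀ a : ZMod 2, a + a = 0 := CharTwo.add_self_eq_zero
      linear_combination s1 + s2 + s3 + t1 (if x.1.1 = p.1.1 then 1 else 0) +
        t1 (if x.1.1 = q.1.1 then 1 else 0)
  have sub : ∀ x ∈ p :: m, x ∈ h₀ :: L := by
    intro x hx
    rw [List.mem_cons, mem]
    rcases List.mem_cons.1 hx with h | h <;> simp [h]
  have es : ∀ g ∈ L, edgeSum next (p :: m) (rot g) = 0 := fun g hg =>
    edgeSum_eq_zero (fun h => hl.rot_notMem (by simp [hg]) (sub _ h))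
      fun h => (hl.flip_ne (sub _ h) hg).2.1 (flip_flip next _)
  have z_rot : ∀ g ∈ L, g ≠ p → g ≠ q → z (rot g) = 0 := by
    intro g hg h1 h2
    rw [hz, es g hg, if_neg fun e => h1 (rot_inj e), if_neg fun e => h2 (rot_inj e)]
    simp
  have z_p : z (rot p) = 1 := by
    rw [hz, es p ((mem _).2 (by simp)), if_pos rfl, if_neg fun e => npq (rot_inj e)]
    simp
  have z_q : z (rot q) = 1 := by
    rw [hz, es q ((mem _).2 (by simp)), if_pos rfl, if_neg fun e => npq (rot_inj e).symm]
    simp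
  obtain ⟨w, hw⟩ := hp z hc
  have f1 := P1.const hw hc.flip_eq fun g hg => z_rot g ((mem _).2 (by simp [hg]))
    (fun e => np1 (e ▸ hg)) (fun e => nq1 (e ▸ hg))
  have f2 := P2.const hw hc.flip_eq fun g hg => z_rot g ((mem _).2 (by simp [hg]))
    (fun e => np (e ▸ hg)) (fun e => nq (e ▸ hg))
  have f3 := P3.const hw hc.flip_eq fun g hg => z_rot g ((mem _).2 (by simp [hg]))
    (fun e => np2 (e ▸ hg)) (fun e => nq2 (e ▸ hg))
  have fa : ∀ x, w (rotInv (flip next x)) = w x := fun x => hw.face_eq hc.flip_eq x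
  have r1 := hw.rotInv_eq (rot p)
  have r2 := hw.rotInv_eq (rot q)
  rw [rotInv_rot, z_p] at r1
  rw [rotInv_rot, z_q] at r2
  rw [fa] at f2 f3
  rw [rotInv_opp] at f1 f2
  have iL : i ∈ L := (mem _).2 (by simp [hi])
  have w_i := (f2.1 i hi).1
  have w_j : w (rot j) = w (rot i) := by
    rw [← hij, hw.flip_eq, z_rot i iL (fun e => np (e ▸ hi)) (fun e => nq (e ▸ hi)), add_zero]
  have ne1 : w p ≠ w p + 1 := fun e => one_ne_zero (α := ZMod 2) (by linear_combination -e)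
  have t1 : (1 : ZMod 2) + 1 = 0 := rfl
  rcases (mem j).1 hj with h | rfl | h | rfl | h
  · exfalso
    apply ne1
    linear_combination w_j + w_i - (f1.1 j h).1 + f1.2 + r1
  · rw [← hqp] at hij
    exact absurd (rot_inj (flip_injective next hij)) fun e => nq (e ▸ hi)
  · exact h
  · rw [← hpq] at hij
    exact absurd (rot_inj (flip_injective next hij)) fun e => np (e ▸ hi)
  · exfalso
    apply ne1
    linear_combination w_j + w_i - (f3.1 j h).1 - r2 - f2.2 - t1

/-- If the inside of a loop consists of chords, then one of the chords cuts off a bigon. -/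
theorem Loop.exists_adjacent [Fintype C] [DecidableEq C] (hl : Loop next h₀ l)
    (hp : IsPlanarCode next) (hc : ∀ h ∈ l, ∃ h' ∈ l, flip next (rot h) = rot h') (hne : l ≠ []) :
    ∃ l₁ a b l₂, l = l₁ ++ a :: b :: l₂ ∧ flip next (rot a) = rot b := by
  -- Induction on the length of the arc cut off by a chord: the chord from the first point `i` of
  -- the arc stays in the arc and cuts off a shorter one.
  have key : ∀ n, ∀ (l₁ : List (HalfEdge C)) p m q l₂, l = l₁ ++ p :: (m ++ q :: l₂) →
      m.length = n → flip next (rot p) = rot q →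
      ∃ l₁ a b l₂, l = l₁ ++ a :: b :: l₂ ∧ flip next (rot a) = rot b := by
    intro n
    induction n using Nat.strong_induction_on with
    | _ n ih =>
      intro l₁ p m q l₂ e hm hpq
      rcases m with _ | ⟨i, m⟩
      · exact ⟨l₁, p, q, l₂, e, hpq⟩
      obtain ⟨j, hj, hij⟩ := hc i (by rw [e]; simp)
      have hjm : j ∈ i :: m := (e ▸ hl).chord_mem hp hpq hij (by simp) (e ▸ hj)
      have hij' : j ≠ i := by
        rintro rfl
        have := flip_snd next (rot j)
        rw [hij] at this
        simp at this
      obtain ⟨m₁, m₂, rfl⟩ := List.append_of_mem ((List.mem_cons.1 hjm).resolve_left hij')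
      refine ih m₁.length ?_ (l₁ ++ [p]) i m₁ j (m₂ ++ q :: l₂) ?_ rfl hij
      · rw [← hm]
        simp only [List.length_cons, List.length_append]
        omega
      · rw [e]
        simp
  rcases l with _ | ⟨a, l⟩
  · exact absurd rfl hne
  obtain ⟨b, hb, hab⟩ := hc a (by simp)
  have hij' : b ≠ a := by
    rintro rfl
    have := flip_snd next (rot b)
    rw [hab] at this
    simp at this
  obtain ⟨m, l₂, rfl⟩ := List.append_of_mem ((List.mem_cons.1 hb).resolve_left hij')
  exact key _ [] a m b l₂ rfl rfl hab

end Chords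

/-! ### Removing a loop that contains only chords -/

variable {D D' : VirtualDiagram} {E : Set D.C} {f : D'.C → D.C}

theorem ErasesVia.path (h : ErasesVia D D' E f) {x y : HalfEdge D'.C} {l : List (HalfEdge D'.C)}
    (hp : Path D.next (flip D.next (lift f x)) (l.map (lift f)) (lift f y)) :
    Path D'.next (flip D'.next x) l y := by
  induction l generalizing x with
  | nil => exact h.flip_eq (hp ▸ .of_flip rfl (by rw [hp]; exact h.notMem _))
  | cons a l ih =>
    refine ⟨h.flip_eq ?_, ih hp.2⟩
    rw [← opp_lift, ← hp.1]
    exact .of_flip rfl (by rw [hp.1]; exact h.notMem _)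

/-- Dissolving two consecutive double points of a path. -/
theorem ErasesVia.path_splice (h : ErasesVia D D' E f) {x y : HalfEdge D'.C} {a b : HalfEdge D.C}
    {l₁ l₂ : List (HalfEdge D'.C)} (ha : a.1.1 ∈ E) (hb : b.1.1 ∈ E)
    (hp : Path D.next (flip D.next (lift f x))
      (l₁.map (lift f) ++ a :: b :: l₂.map (lift f)) (lift f y)) :
    Path D'.next (flip D'.next x) (l₁ ++ l₂) y := by
  induction l₁ generalizing x with
  | nil =>
    obtain ⟨e1, e2, e3⟩ := hp
    have key : ∀ t, flip D.next b = lift f t → flip D'.next x = t := by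
      intro t ht
      refine h.flip_eq (.of_str e1 ha ?_)
      rw [opp_opp]
      refine .of_str e2 hb ?_
      rw [opp_opp]
      exact .of_flip ht (h.notMem _)
    rcases l₂ with _ | ⟨c, l₂⟩
    · exact key y e3
    · exact ⟨key _ e3.1, h.path e3.2⟩
  | cons c l ih =>
    refine ⟨h.flip_eq ?_, ih hp.2⟩
    rw [← opp_lift, ← hp.1]
    exact .of_flip rfl (by rw [hp.1]; exact h.notMem _)

theorem ErasesVia.isOver_iff (h : ErasesVia D D' E f) (p : D'.C × Bool) :
    D'.IsOver p ↔ D.IsOver (Prod.map f id p) := by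
  simp [IsOver, h.kind]

theorem ErasesVia.isClassical_iff (h : ErasesVia D D' E f) (c : D'.C) :
    D'.IsClassical c ↔ D.IsClassical (f c) := by
  simp [IsClassical, h.kind]

theorem ErasesVia.exists_map_lift (h : ErasesVia D D' E f) {l : List (HalfEdge D.C)}
    (hl : ∀ x ∈ l, x.1.1 ∉ E) : ∃ l' : List (HalfEdge D'.C), l'.map (lift f) = l := by
  have : l ∈ Set.range (List.map (lift f)) := by
    rw [Set.range_list_map]
    exact fun x hx => h.exists_lift (hl x hx)
  exact this

/-- A loop that goes over, and whose inside consists of chords, can be removed. -/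
theorem exists_erasesVia_of_chords (n : ℕ) : ∀ {D : VirtualDiagram} {h₀ : HalfEdge D.C}
    {l : List (HalfEdge D.C)}, l.length = n → (∀ c, D.IsClassical c) → Loop D.next h₀ l →
    (∀ h ∈ l, D.IsOver h.1) → (∀ h ∈ l, ∃ h' ∈ l, flip D.next (rot h) = rot h') →
    ∃ D' f, ErasesVia D D' {c | ∃ h ∈ h₀ :: l, h.1.1 = c} f ∧ equivalence D D' := by
  induction n using Nat.strong_induction_on with
  | _ n ih =>
    intro D h₀ l hn hcl hl ho hc
    -- The empty loop is a monogon, which RI removes whatever the sign of its corner; this is why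
    -- `h₀` itself need not be an over passage.
    rcases eq_or_ne l [] with rfl | hne
    · have hh : face D.next h₀ = h₀ := by
        rw [face, show flip D.next h₀ = rot h₀ from hl.path, rotInv_rot]
      obtain ⟨D', f, hf⟩ := exists_erasesVia_monogon hh
      have e : {c | ∃ h ∈ [h₀], h.1.1 = c} = ({h₀.1.1} : Set D.C) := by
        ext c
        simp [eq_comm]
      exact ⟨D', f, e ▸ hf, equivalence_of_move (move_monogon hh (hcl _) hf.erases)⟩
    obtain ⟨l₁, a, b, l₂, rfl, hab⟩ := hl.exists_adjacent D.planar hc hne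
    have nd := hl.nodup
    have path := hl.path
    have fab : flip D.next a = opp b := (path_append.1 path).2.1
    have nab : a.1.1 ≠ b.1.1 := by
      intro e
      simp only [List.map_cons, List.map_append, List.nodup_cons, List.nodup_append, e] at nd
      simp at nd
    -- The bigon has one side on the loop and one on the innermost chord. The loop is over at both
    -- ends, so RII applies.
    have ffa : face D.next (face D.next a) = a := by
      rw [face, face, fab, rotInv_opp, ← hab, flip_flip, rotInv_rot]
    have hne' : a.1.1 ≠ (flip D.next a).1.1 := by rw [fab]; exact nab
    obtain ⟨D₁, f, hf⟩ := exists_erasesVia_bigon ffa hne'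
    have e1 : (flip D.next a).1.1 = b.1.1 := by rw [fab]; rfl
    have heq : equivalence D D₁ := equivalence_of_move
      (move_bigon rfl ffa hne' (ho a (by simp)) (by rw [fab]; exact ho b (by simp)) hf.erases)
    rw [e1] at hf
    have off : ∀ x ∈ h₀ :: (l₁ ++ l₂), x.1.1 ∉ ({a.1.1, b.1.1} : Set D.C) := by
      intro x hx hx'
      simp only [List.map_cons, List.map_append, List.nodup_cons, List.nodup_append,
        List.mem_append, List.mem_map, List.mem_cons] at nd
      simp only [List.mem_cons, List.mem_append] at hx
      simp only [Set.mem_insert_iff, Set.mem_singleton_iff] at hx'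
      grind
    obtain ⟨g₀, hg₀⟩ := hf.exists_lift (off h₀ (by simp))
    obtain ⟨m₁, hm₁⟩ := hf.exists_map_lift (l := l₁) fun x hx => off x (by simp [hx])
    obtain ⟨m₂, hm₂⟩ := hf.exists_map_lift (l := l₂) fun x hx => off x (by simp [hx])
    subst hg₀ hm₁ hm₂
    have hl' : Loop D₁.next g₀ (m₁ ++ m₂) := by
      refine ⟨hf.path_splice (a := a) (b := b) (by simp) (by simp) ?_, ?_⟩
      · simpa using path
      · refine List.Nodup.of_map f ?_
        have e : ((g₀ :: (m₁ ++ m₂)).map fun x => x.1.1).map f =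
            (lift f g₀ :: (m₁.map (lift f) ++ m₂.map (lift f))).map fun x => x.1.1 := by
          simp [Function.comp_def]
        rw [e]
        refine nd.sublist ?_
        refine List.Sublist.map _ (List.Sublist.cons_cons _ ?_)
        exact List.Sublist.append (List.Sublist.refl _) (by simp)
    have mem : ∀ g ∈ m₁ ++ m₂, lift f g ∈ m₁.map (lift f) ++ a :: b :: m₂.map (lift f) := by
      intro g hg
      have hg := List.mem_append.1 hg
      simp only [List.mem_append, List.mem_cons, List.mem_map]
      rcases hg with hg | hg
      · exact Or.inl ⟨g, hg, rfl⟩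
      · exact Or.inr (Or.inr (Or.inr ⟨g, hg, rfl⟩))
    obtain ⟨D₂, k, hk, heq'⟩ := ih (m₁ ++ m₂).length (by rw [← hn]; simp) rfl
      (fun c => (hf.isClassical_iff c).2 (hcl _)) hl'
      (fun g hg => (hf.isOver_iff _).2 (ho _ (mem g hg))) (fun g hg => by
        obtain ⟨x, hx, e⟩ := hc _ (mem g hg)
        have hx' : x.1.1 ∉ ({a.1.1, b.1.1} : Set D.C) := by
          have rot_inj : ∀ {x y : HalfEdge D.C}, rot x = rot y → x = y := fun {x y} e => by
            rw [← rotInv_rot x, e, rotInv_rot]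
          have h1 : x ≠ a := by
            rintro rfl
            have : rot (lift f g) = rot b := by rw [← hab, ← e, flip_flip]
            exact hf.notMem g.1.1 (by simp [← rot_inj this])
          have h2 : x ≠ b := by
            rintro rfl
            have : rot (lift f g) = rot a := flip_injective D.next (e.trans hab.symm)
            exact hf.notMem g.1.1 (by simp [← rot_inj this])
          have := off x
          simp only [List.mem_append, List.mem_cons] at hx this
          grind
        obtain ⟨y, rfl⟩ := hf.exists_lift hx'
        refine ⟨y, ?_, hf.flip_eq (.of_flip ?_ (hf.notMem _))⟩
        · simp only [List.mem_append, List.mem_cons, List.mem_map] at hx ⊢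
          rcases hx with ⟨t, ht, e⟩ | e | e | ⟨t, ht, e⟩
          · exact Or.inl (lift_injective f hf.injective e ▸ ht)
          · exact absurd (by rw [e]; simp) hx'
          · exact absurd (by rw [e]; simp) hx'
          · exact Or.inr (lift_injective f hf.injective e ▸ ht)
        · exact e)
    refine ⟨D₂, _, hf.trans hk ?_ ?_, equivalence.trans heq heq'⟩
    · rintro c (rfl | rfl)
      · exact ⟨a, by simp, rfl⟩
      · exact ⟨b, by simp, rfl⟩
    · intro c
      constructor
      · rintro ⟨x, hx, e⟩
        have hx' : x.1.1 ∉ ({a.1.1, b.1.1} : Set D.C) := by rw [e]; exact hf.notMem c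
        obtain ⟨y, rfl⟩ := hf.exists_lift hx'
        refine ⟨y, ?_, hf.injective e⟩
        simp only [List.mem_append, List.mem_cons, List.mem_map] at hx ⊢
        rcases hx with e | ⟨t, ht, e⟩ | e | e | ⟨t, ht, e⟩
        · exact Or.inl (lift_injective f hf.injective e)
        · exact Or.inr (Or.inl (lift_injective f hf.injective e ▸ ht))
        · exact absurd (by rw [e]; simp) hx'
        · exact absurd (by rw [e]; simp) hx'
        · exact Or.inr (Or.inr (lift_injective f hf.injective e ▸ ht))
      · rintro ⟨y, hy, rfl⟩
        refine ⟨lift f y, ?_, rfl⟩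
        rcases List.mem_cons.1 hy with rfl | hy
        · simp
        · exact List.mem_cons_of_mem _ (mem y hy)

/-! ### Pushing a loop over a double point -/

section Push

variable {C : Type} {next : Equiv.Perm (C × Bool)} {h₀ g : HalfEdge C}
  {l₁ l₂ : List (HalfEdge C)} {J : Finset C}

theorem Path.exists_last {x y : HalfEdge C} {l : List (HalfEdge C)}
    (h : Path next (flip next x) l y) : ∃ g ∈ x :: l, flip next g = y := by
  induction l generalizing x with
  | nil => exact ⟨x, by simp, h⟩
  | cons b l ih =>
    obtain ⟨g, hg, e⟩ := ih h.2
    exact ⟨g, List.mem_cons_of_mem _ hg, e⟩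

theorem perm_interleave {α : Type} (x p q r : α) (A B : List α) :
    (x :: (A ++ p :: q :: r :: B)).Perm (p :: r :: x :: (A ++ q :: B)) := by
  classical
  rw [List.perm_iff_count]
  intro c
  simp only [List.count_cons, List.count_append]
  omega

/-- A loop through `g`, with a double point in its inside that is joined to the loop
by the edge of `rot g`. -/
structure Reach (next : Equiv.Perm (C × Bool)) (h₀ g : HalfEdge C) (l₁ l₂ : List (HalfEdge C))
    (J : Finset C) : Prop where
  loop : Loop next h₀ (l₁ ++ g :: l₂)
  off : ∀ h ∈ h₀ :: (l₁ ++ g :: l₂), h.1.1 ∉ J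
  inside : ∀ x, Inside (l₁ ++ g :: l₂) J x → Inside (l₁ ++ g :: l₂) J (flip next x)
  mem : (flip next (rot g)).1.1 ∈ J

/-- The half-edge of the loop before `g`. -/
def before (next : Equiv.Perm (C × Bool)) (g : HalfEdge C) : HalfEdge C := flip next (opp g)

/-- The side of the triangle at the double point that is not on the loop. -/
def across (next : Equiv.Perm (C × Bool)) (g : HalfEdge C) : HalfEdge C :=
  rotInv (flip next (rot g))

theorem flip_before : flip next (before next g) = opp g := flip_flip _ _

theorem face_before : face next (before next g) = rot g := by
  rw [face, flip_before, rotInv_opp]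

theorem face_rot : face next (rot g) = across next g := rfl

theorem flip_rot : flip next (rot g) = rot (across next g) := by
  rw [across, rot_rotInv]

theorem eq_before {x : HalfEdge C} (h : flip next x = opp g) : x = before next g := by
  rw [before, ← h, flip_flip]

namespace Reach

theorem across_mem (hr : Reach next h₀ g l₁ l₂ J) : (across next g).1.1 ∈ J := hr.mem

theorem before_mem (hr : Reach next h₀ g l₁ l₂ J) : before next g ∈ h₀ :: l₁ := by
  obtain ⟨x, hx, e⟩ := (path_append.1 hr.loop.path).1.exists_last
  exact eq_before e ▸ hx

theorem mem_iff {x : HalfEdge C} :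
    x ∈ h₀ :: (l₁ ++ g :: l₂) ↔ x ∈ h₀ :: l₁ ∨ x = g ∨ x ∈ l₂ := by simp [or_assoc]

theorem before_mem' (hr : Reach next h₀ g l₁ l₂ J) : before next g ∈ h₀ :: (l₁ ++ g :: l₂) :=
  mem_iff.2 (Or.inl hr.before_mem)

theorem notMem (hr : Reach next h₀ g l₁ l₂ J) :
    g ∉ h₀ :: l₁ ∧ g ∉ l₂ ∧ ∀ x ∈ h₀ :: l₁, x ∉ l₂ := by
  have nd := hr.loop.nodup_list
  rw [← List.cons_append, List.nodup_append, List.nodup_cons (a := g)] at nd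
  exact ⟨fun h => nd.2.2 g h g (by simp) rfl, nd.2.1.1, fun x h h' => nd.2.2 x h x (by simp [h']) rfl⟩

theorem before_vert (hr : Reach next h₀ g l₁ l₂ J) : (before next g).1.1 ≠ g.1.1 := fun e =>
  hr.notMem.1 (hr.loop.eq_of_vert hr.before_mem' (by simp) e ▸ hr.before_mem)

theorem across_vert (hr : Reach next h₀ g l₁ l₂ J) {x : HalfEdge C}
    (hx : x ∈ h₀ :: (l₁ ++ g :: l₂)) : x.1.1 ≠ (across next g).1.1 := fun e =>
  hr.off x hx (e ▸ hr.across_mem)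

/-- The edge of the loop that arrives at `g`, the edge from `g` to the inner double point, and the
next edge at that point follow one another on a face. The finger goes from the first to the third of
them. -/
theorem onFace (hr : Reach next h₀ g l₁ l₂ J) : OnFace next (before next g) (across next g) 2 where
  pos := by norm_num
  eq := by simp only [Function.iterate_succ_apply, Function.iterate_zero_apply, face_before,
    face_rot]
  ne i h1 h2 := by
    interval_cases i
    · rw [Function.iterate_one, face_before]
      exact fun e => hr.before_vert (congrArg (fun x => x.1.1) e).symm
    · simp only [Function.iterate_succ_apply, Function.iterate_zero_apply, face_before, face_rot]
      exact fun e => hr.across_vert hr.before_mem' (congrArg (fun x => x.1.1) e).symm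
  edge_ne := by
    rw [flip_before]
    exact fun e => hr.across_vert (x := g) (by simp) (congrArg (fun x => x.1.1) e).symm

theorem flip_vert_ne (hr : Reach next h₀ g l₁ l₂ J) {x : HalfEdge C}
    (hx : x ∈ h₀ :: (l₁ ++ g :: l₂)) (h : x ≠ before next g) :
    (flip next x).1.1 ≠ g.1.1 ∧ (flip next x).1.1 ≠ (across next g).1.1 := by
  refine ⟨fun e => ?_, fun e => ?_⟩
  · rcases hr.loop.path.flip_mem x hx with ⟨a, ha, e'⟩ | e'
    · have : a = g := hr.loop.eq_of_vert (by simp [ha]) (by simp) (by rw [← e, e']; rfl)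
      exact h (eq_before (by rw [e', this]))
    · exact hr.loop.ne_of_mem (x := g) (by simp) (by rw [← e, e']; rfl)
  · obtain ⟨a, ha, e'⟩ := hr.loop.flip_vert hx
    exact hr.across_vert ha (e'.symm.trans e)

/-- The new double points of the finger. -/
abbrev out (next : Equiv.Perm (C × Bool)) (g : HalfEdge C) : HalfEdge (C ⊕ Bool) :=
  fingerOut (before next g) (across next g)

/-- The other new double points of the finger. -/
abbrev back (next : Equiv.Perm (C × Bool)) (g : HalfEdge C) : HalfEdge (C ⊕ Bool) :=
  fingerBack (before next g) (across next g)

/-- The loop after pushing it over the double point. -/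
abbrev pushList (next : Equiv.Perm (C × Bool)) (g : HalfEdge C) (l₁ l₂ : List (HalfEdge C)) :
    List (HalfEdge (C ⊕ Bool)) :=
  l₁.map inc ++ out next g :: inc g :: back next g :: l₂.map inc

theorem mem_pushList {x : HalfEdge (C ⊕ Bool)} : x ∈ pushList next g l₁ l₂ ↔
    (∃ y ∈ l₁, inc y = x) ∨ x = out next g ∨ x = inc g ∨ x = back next g ∨ ∃ y ∈ l₂, inc y = x := by
  simp only [pushList, List.mem_append, List.mem_cons, List.mem_map]

/-- The double points of the loop after pushing it. -/
theorem vert_pushList {c : C ⊕ Bool} : (∃ h ∈ inc h₀ :: pushList next g l₁ l₂, h.1.1 = c) ↔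
    (∃ h ∈ h₀ :: (l₁ ++ g :: l₂), Sum.inl h.1.1 = c) ∨ c ∈ Set.range Sum.inr := by
  constructor
  · rintro ⟨h, hh, e⟩
    have key : ∀ y ∈ h₀ :: (l₁ ++ g :: l₂), h = inc y →
        ∃ h ∈ h₀ :: (l₁ ++ g :: l₂), Sum.inl h.1.1 = c := by
      rintro y hy rfl
      exact ⟨y, hy, e⟩
    rcases (List.mem_cons.1 hh).imp_right mem_pushList.1 with
      rfl | ⟨y, hy, rfl⟩ | rfl | rfl | rfl | ⟨y, hy, rfl⟩
    · exact Or.inl (key h₀ (by simp) rfl)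
    · exact Or.inl (key y (by simp [hy]) rfl)
    · exact Or.inr ⟨_, e⟩
    · exact Or.inl (key g (by simp) rfl)
    · exact Or.inr ⟨_, e⟩
    · exact Or.inl (key y (by simp [hy]) rfl)
  · rintro (⟨y, hy, rfl⟩ | ⟨_ | _, rfl⟩)
    · simp only [List.mem_cons, List.mem_append] at hy
      refine ⟨inc y, List.mem_cons.2 ((?_ : y = h₀ ∨ _).imp (congrArg inc) mem_pushList.2), rfl⟩
      rcases hy with rfl | hy | rfl | hy
      · exact Or.inl rfl
      · exact Or.inr (Or.inl ⟨y, hy, rfl⟩)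
      · exact Or.inr (Or.inr (Or.inr (Or.inl rfl)))
      · exact Or.inr (Or.inr (Or.inr (Or.inr (Or.inr ⟨y, hy, rfl⟩))))
    · exact ⟨out next g, by simp, rfl⟩
    · exact ⟨back next g, by simp, rfl⟩

variable [DecidableEq C]

theorem flip_code_inc (hr : Reach next h₀ g l₁ l₂ J) {x : HalfEdge C} (h1 : x ≠ before next g)
    (h2 : x ≠ opp g) (h3 : x ≠ across next g) (h4 : x ≠ flip next (across next g)) :
    flip hr.onFace.code (inc x) = inc (flip next x) := by
  rw [hr.onFace.flip_code, fingerFlip_inc h1 (by rwa [flip_before]) h3 h4]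

/-- The finger ends just beyond the inner double point: its second new crossing, `g` and the inner
point span a triangle with one side on the loop. RIII then carries the loop across the inner point.
-/
theorem isTri (hr : Reach next h₀ g l₁ l₂ J) :
    IsTri hr.onFace.code (back next g) (inc (rot g)) (inc (across next g)) where
  face₀ := by
    rw [face, hr.onFace.flip_code, fingerFlip_back, flip_before, rotInv_lift, rotInv_opp]
  face₁ := by
    rw [face, hr.flip_code_inc, rotInv_lift]
    · rfl
    · exact fun e => hr.before_vert (congrArg (fun x => x.1.1) e).symm
    · exact (rotations_ne g).2.1.2.1
    · exact fun e => hr.across_vert (x := g) (by simp) (congrArg (fun x => x.1.1) e)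
    · rw [Ne, ← flip_eq_iff, flip_rot]
      exact (rotations_ne _).2.1.1
  face₂ := by
    rw [face, hr.onFace.flip_code, hr.onFace.fingerFlip_k, rotInv_rot]
  ne₀₁ := by simp [back, fingerBack]
  ne₁₂ e := hr.across_vert (x := g) (by simp) (Sum.inl_injective e)
  ne₀₂ := by simp [back, fingerBack]

/-- The code after pushing the loop over the double point. -/
abbrev pushNext (hr : Reach next h₀ g l₁ l₂ J) : Equiv.Perm ((C ⊕ Bool) × Bool) :=
  triNext hr.onFace.code (back next g) (inc (rot g)) (inc (across next g))

/-- The edges after pushing the loop over the double point. -/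
theorem exists_swap (hr : Reach next h₀ g l₁ l₂ J) :
    ∃ S : HalfEdge (C ⊕ Bool) → HalfEdge (C ⊕ Bool),
      (∀ x, flip hr.pushNext x = S (flip hr.onFace.code (S x))) ∧ (∀ x, S (S x) = x) ∧
      (∀ x : HalfEdge C, x.1.1 ≠ g.1.1 → x.1.1 ≠ (across next g).1.1 → S (inc x) = inc x) ∧
      (∀ x : HalfEdge (C ⊕ Bool), x.1.1 = Sum.inr false → S x = x) ∧
      S (inc g) = back next g ∧ S (inc (opp g)) = opp (back next g) ∧
      S (inc (rot g)) = inc (rotInv (across next g)) ∧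
      S (inc (opp (across next g))) = rot (back next g) := by
  have hS := hr.isTri.triSwapH_triSwapH
  have hne := fun x => hr.isTri.triSwapH_of_ne (x := x)
  obtain ⟨⟨a1, a2, a3, a4⟩, ⟨b1, b2, b3, b4⟩, c1, c2, c3, c4⟩ := hr.isTri.triSwapH_apply
  refine ⟨triSwapH hr.onFace.code (back next g) (inc (rot g)) (inc (across next g)),
    hr.isTri.flip_triNext, hS, fun x h1 h2 => ?_, fun x hx => ?_, ?_, ?_, ?_, ?_⟩
  · refine hne _ (by simp [back, fingerBack]) ?_ ?_
    · exact fun e => h1 (Sum.inl_injective e)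
    · exact fun e => h2 (Sum.inl_injective e)
  · exact hne _ (by simp [back, fingerBack, hx]) (by simp [hx]) (by simp [hx])
  · rwa [rotInv_lift, rotInv_rot] at b4
  · rwa [rot_lift, rot_rot] at b3
  · rwa [rotInv_lift] at b1
  · rwa [opp_lift] at c2

theorem flip_code_loop (hr : Reach next h₀ g l₁ l₂ J) {x : HalfEdge C}
    (hx : x ∈ h₀ :: (l₁ ++ g :: l₂)) (h : x ≠ before next g) :
    flip hr.onFace.code (inc x) = inc (flip next x) := by
  refine hr.flip_code_inc h ?_ ?_ ?_
  · intro e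
    have : x = g := hr.loop.eq_of_vert hx (by simp) (by rw [e]; rfl)
    exact (rotations_ne g).2.2.1.1 (e.symm.trans this)
  · exact fun e => hr.across_vert hx (by rw [e])
  · intro e
    exact (hr.flip_vert_ne hx h).2 (by rw [e, flip_flip])

/-- After the finger the loop meets `out`, `back`, `g`. Turning over the triangle exchanges the last
two, which gives the order in `pushList`. -/
theorem push_loop (hr : Reach next h₀ g l₁ l₂ J) :
    Loop hr.pushNext (inc h₀) (pushList next g l₁ l₂) := by
  obtain ⟨S, hS, SS, S1, S2, S3, S4, S5, S6⟩ := hr.exists_swap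
  obtain ⟨n1, n2, n3⟩ := hr.notMem
  have fh : flip hr.pushNext (inc (before next g)) = opp (out next g) := by
    rw [hS, S1 _ hr.before_vert (hr.across_vert hr.before_mem'), hr.onFace.flip_code, fingerFlip_h,
      S2 _ rfl]
  have fa : flip hr.pushNext (out next g) = opp (inc g) := by
    rw [hS, S2 (out next g) rfl, hr.onFace.flip_code, fingerFlip_out, ← S4, SS, opp_lift]
  have fg : flip hr.pushNext (inc g) = opp (back next g) := by
    rw [hS, S3, hr.onFace.flip_code, fingerFlip_back, flip_before, S4]
  have gb : g ≠ before next g := fun e => hr.before_vert (by rw [← e])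
  have fb : flip hr.pushNext (back next g) = inc (flip next g) := by
    obtain ⟨i1, i2⟩ := hr.flip_vert_ne (x := g) (by simp) gb
    rw [hS, ← S3, SS, hr.flip_code_loop (by simp) gb, S1 _ i1 i2]
  have fx : ∀ x ∈ h₀ :: (l₁ ++ g :: l₂), x ≠ before next g → x ≠ g →
      flip hr.pushNext (inc x) = inc (flip next x) := by
    intro x hx h1 h2
    obtain ⟨i1, i2⟩ := hr.flip_vert_ne hx h1
    rw [hS, S1 _ (fun e => h2 (hr.loop.eq_of_vert hx (by simp) e)) (hr.across_vert hx),
      hr.flip_code_loop hx h1, S1 _ i1 i2]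
  obtain ⟨p1, p2⟩ := path_append.1 hr.loop.path
  refine ⟨path_append.2 ⟨?_, fa, fg, ?_⟩, ?_⟩
  · let G : HalfEdge C → HalfEdge (C ⊕ Bool) := fun x =>
      if x = opp g then opp (out next g) else inc x
    have hG : ∀ x ∈ h₀ :: l₁, flip hr.pushNext (inc x) = G (flip next x) := by
      intro x hx
      by_cases h : x = before next g
      · rw [h, fh]
        exact (if_pos flip_before).symm
      · rw [fx x (mem_iff.2 (Or.inl hx)) h fun e => n1 (e ▸ hx)]
        exact (if_neg fun e => h (eq_before e)).symm
    have := p1.map (F := inc) (G := G) (next' := hr.pushNext)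
      (fun x hx => hG x (by simp [hx])) fun x hx => if_neg fun e => n1 ?_
    · rw [← hG h₀ (by simp)] at this
      convert this
      exact (if_pos rfl).symm
    · have : x = g := by simpa using congrArg opp e
      exact this ▸ List.mem_cons_of_mem _ hx
  · rw [fb]
    exact p2.map (F := inc) (G := inc) (fun x hx => fx x (mem_iff.2 (Or.inr (Or.inr hx)))
      (fun e => n3 _ hr.before_mem (e ▸ hx)) fun e => n2 (e ▸ hx)) fun x _ => rfl
  · have e : ((inc h₀ :: pushList next g l₁ l₂).map fun x => x.1.1).Perm
        (Sum.inr false :: Sum.inr true ::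
          ((h₀ :: (l₁ ++ g :: l₂)).map fun x => x.1.1).map Sum.inl) := by
      simp only [pushList, List.map_cons, List.map_append, List.map_map]
      exact perm_interleave _ _ _ _ _ _
    rw [e.nodup_iff]
    refine List.nodup_cons.2 ⟨by simp, List.nodup_cons.2 ⟨by simp, ?_⟩⟩
    exact hr.loop.nodup.map Sum.inl_injective

/-- The double points that remain in the inside. -/
def pushInside (next : Equiv.Perm (C × Bool)) (g : HalfEdge C) (J : Finset C) :
    Finset (C ⊕ Bool) :=
  (J.erase (across next g).1.1).map ⟨Sum.inl, Sum.inl_injective⟩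

theorem card_pushInside (hr : Reach next h₀ g l₁ l₂ J) {n : ℕ} (hn : J.card = n + 1) :
    (pushInside next g J).card = n := by
  rw [pushInside, Finset.card_map, Finset.card_erase_of_mem hr.across_mem, hn]
  rfl

/-- The new edges are `S` applied to those of the finger diagram. It is therefore enough to describe
the set `P` that `S` exchanges with the new inside, and to see that it is closed under the edges of
the finger diagram. -/
theorem push_inside (hr : Reach next h₀ g l₁ l₂ J) (x : HalfEdge (C ⊕ Bool))
    (hx : Inside (pushList next g l₁ l₂) (pushInside next g J) x) :
    Inside (pushList next g l₁ l₂) (pushInside next g J) (flip hr.pushNext x) := by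
  obtain ⟨S, hS, SS, S1, S2, S3, S4, S5, S6⟩ := hr.exists_swap
  obtain ⟨n1, n2, n3⟩ := hr.notMem
  obtain ⟨k, hk⟩ : ∃ k, k = across next g := ⟨_, rfl⟩
  have kJ : k.1.1 ∈ J := hk ▸ hr.across_mem
  have gJ : g.1.1 ∉ J := hr.off g (by simp)
  have gk : g.1.1 ≠ k.1.1 := fun e => gJ (e ▸ kJ)
  have rotk : flip next (rot g) = rot k := hk ▸ flip_rot
  have mk := rotations_ne k
  have inJ : ∀ u : HalfEdge C, u.1.1 ∈ J → u.1.1 ≠ k.1.1 →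
      Inside (pushList next g l₁ l₂) (pushInside next g J) (inc u) := fun u h1 h2 =>
    Or.inl (Finset.mem_map_of_mem _ (Finset.mem_erase.2 ⟨hk ▸ h2, h1⟩))
  have inL : ∀ y ∈ pushList next g l₁ l₂,
      Inside (pushList next g l₁ l₂) (pushInside next g J) (rot y) := fun y hy =>
    Or.inr ⟨y, hy, rfl⟩
  rw [← hk] at S1 S5 S6
  -- The old inside loses the ends `rot g` and `rot k` of the edge to the inner point, and the
  -- half-edge `k` on the third side of the triangle. The half-edge of the finger crossing that
  -- leads on to `flip next k` is added.
  let P : HalfEdge (C ⊕ Bool) → Prop := fun y =>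
    (∃ u, y = inc u ∧ Inside (l₁ ++ g :: l₂) J u ∧ u ≠ k ∧ u ≠ rot k ∧ u ≠ rot g) ∨
    y = rot (out next g)
  have P1 : ∀ y, P y → P (flip hr.onFace.code y) := by
    have aux : ∀ u : HalfEdge C, u ≠ k → u ≠ rot k → u ≠ rot g →
        flip next u ≠ rot k ∧ flip next u ≠ rot g := by
      intro u h1 h2 h3
      refine ⟨fun e => h3 (flip_injective next (e.trans rotk.symm)), fun e => h2 ?_⟩
      rw [← rotk, ← e, flip_flip]
    rintro _ (⟨u, rfl, hu, h1, h2, h3⟩ | rfl)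
    · by_cases h4 : u = flip next k
      · right
        rw [h4, hr.onFace.flip_code, hk, hr.onFace.fingerFlip_flip_k]
      · left
        refine ⟨flip next u, ?_, hr.inside u hu, fun e => h4 (by rw [← e, flip_flip]),
          aux u h1 h2 h3⟩
        refine hr.flip_code_inc ?_ ?_ (hk ▸ h1) (hk ▸ h4)
        · rintro rfl
          rcases hu with hu | ⟨y, hy, e⟩
          · exact hr.off _ hr.before_mem' hu
          · exact hr.loop.rot_notMem (List.mem_cons_of_mem _ hy) (e ▸ hr.before_mem')
        · rintro rfl
          rcases hu with hu | ⟨y, hy, e⟩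
          · exact gJ hu
          · have : y = g := hr.loop.eq_of_vert (by simp [hy]) (by simp)
              (congrArg (fun x => x.1.1) e).symm
            exact (rotations_ne g).2.1.2.1 (by rw [e, this])
    · left
      refine ⟨flip next k, ?_, hr.inside k (Or.inl kJ), flip_ne next k, ?_, fun e => ?_⟩
      · rw [hr.onFace.flip_code, fingerFlip_rot_out, hk]
      · rw [← rotk]
        exact fun e => gk (congrArg (fun x => x.1.1) (flip_injective next e)).symm
      · have : k = rot k := by rw [← rotk, ← e, flip_flip]
        exact mk.1.1 this
  have P2 : ∀ y, P y → Inside (pushList next g l₁ l₂) (pushInside next g J) (S y) := by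
    rintro _ (⟨u, rfl, hu, h1, h2, h3⟩ | rfl)
    · rcases hu with hu | ⟨y, hy, rfl⟩
      · by_cases h4 : u.1.1 = k.1.1
        · rcases eq_of_vert_eq h4 with e | e | e | e
          · exact absurd e h1
          · exact absurd e h2
          · rw [e, S6]
            exact inL _ (by simp)
          · rw [e, ← S5, SS]
            exact inL (inc g) (by simp)
        · rw [S1 u (fun e => gJ (e ▸ hu)) h4]
          exact inJ u hu h4
      · have hy' : y ≠ g := fun e => h3 (by rw [e])
        rw [S1 (rot y) (fun e => hy' (hr.loop.eq_of_vert (by simp [hy]) (by simp) e))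
          (hk ▸ hr.across_vert (x := y) (List.mem_cons_of_mem _ hy))]
        refine inL (inc y) (mem_pushList.2 ?_)
        rcases List.mem_append.1 hy with hy | hy
        · exact Or.inl ⟨y, hy, rfl⟩
        · have := (List.mem_cons.1 hy).resolve_left hy'
          exact Or.inr (Or.inr (Or.inr (Or.inr ⟨y, this, rfl⟩)))
    · rw [S2 _ rfl]
      exact inL _ (by simp)
  have P3 : ∀ y, Inside (pushList next g l₁ l₂) (pushInside next g J) y → P (S y) := by
    have old : ∀ y ∈ l₁ ++ g :: l₂, y ≠ g → P (S (rot (inc y))) := by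
      intro y hy h
      have h1 : y.1.1 ≠ g.1.1 := fun e => h (hr.loop.eq_of_vert (by simp [hy]) (by simp) e)
      have h2 : y.1.1 ≠ k.1.1 := hk ▸ hr.across_vert (List.mem_cons_of_mem _ hy)
      rw [rot_lift, S1 (rot y) h1 h2]
      exact Or.inl ⟨rot y, rfl, Or.inr ⟨y, hy, rfl⟩, fun e => h2 (congrArg (fun x => x.1.1) e),
        fun e => h2 (congrArg (fun x => x.1.1) e), fun e => h1 (congrArg (fun x => x.1.1) e)⟩
    rintro y (hy | ⟨y, hy, rfl⟩)
    · obtain ⟨c, hc, e⟩ := Finset.mem_map.1 hy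
      obtain ⟨hc1, hc2⟩ := Finset.mem_erase.1 hc
      obtain ⟨u, rfl⟩ := exists_lift (f := Sum.inl) (h := y) ⟨c, e⟩
      have e : c = u.1.1 := Sum.inl_injective e
      subst e
      rw [← hk] at hc1
      rw [S1 u (fun e => gJ (e ▸ hc2)) hc1]
      exact Or.inl ⟨u, rfl, Or.inl hc2, fun e => hc1 (by rw [e]),
        fun e => hc1 (congrArg (fun x => x.1.1) e),
        fun e => gJ (congrArg (fun x => x.1.1) e ▸ hc2)⟩
    · replace hy := mem_pushList.1 hy
      rcases hy with ⟨y, hy, rfl⟩ | rfl | rfl | rfl | ⟨y, hy, rfl⟩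
      · exact old y (by simp [hy]) fun e => n1 (e ▸ List.mem_cons_of_mem _ hy)
      · rw [S2 _ rfl]
        exact Or.inr rfl
      · rw [rot_lift, S5]
        exact Or.inl ⟨_, rfl, Or.inl kJ, mk.2.2.2.1, mk.2.2.2.2.1,
          fun e => gk (congrArg (fun x => x.1.1) e).symm⟩
      · rw [← S6, SS]
        exact Or.inl ⟨_, rfl, Or.inl kJ, mk.2.2.1.1, mk.2.2.1.2.1,
          fun e => gk (congrArg (fun x => x.1.1) e).symm⟩
      · exact old y (by simp [hy]) fun e => n2 (e ▸ hy)
  rw [hS]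
  exact P2 _ (P1 _ (P3 _ hx))

end Reach

end Push

/-! ### Emptying the inside of a loop -/

theorem exists_isOver_fingerOut {D : VirtualDiagram} {h k : HalfEdge D.C} {n : ℕ}
    (hf : OnFace D.next h k n) :
    ∃ κ, κ ≠ .virt ∧ (fingerDiagram hf κ).IsOver (fingerOut h k).1 := by
  by_cases e : xor h.2 k.2 = true
  · exact ⟨.neg, by simp, Or.inr ⟨rfl, e⟩⟩
  · exact ⟨.pos, by simp, Or.inl ⟨rfl, eq_false_of_ne_true e⟩⟩

theorem change_ne_virt {κ : CrossingKind} (h : κ ≠ .virt) : κ.change ≠ .virt := by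
  cases κ <;> simp_all [CrossingKind.change]

/-- Each push takes one double point out of `J` at the price of two more on the loop, so induction
on the size of `J` works although the diagram grows. The conclusion speaks of an erasure from `D`,
so that the detour through larger diagrams leaves no trace. -/
theorem exists_erasesVia_of_inside (n : ℕ) : ∀ {D : VirtualDiagram} {h₀ : HalfEdge D.C}
    {l : List (HalfEdge D.C)} {J : Finset D.C}, J.card = n → (∀ c, D.IsClassical c) →
    Loop D.next h₀ l → (∀ h ∈ l, D.IsOver h.1) → (∀ h ∈ h₀ :: l, h.1.1 ∉ J) →
    (∀ x, Inside l J x → Inside l J (flip D.next x)) →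
    ∃ D' f, ErasesVia D D' {c | ∃ h ∈ h₀ :: l, h.1.1 = c} f ∧ equivalence D D' := by
  induction n with
  | zero =>
    intro D h₀ l J hn hcl hl ho _ hi
    rw [Finset.card_eq_zero] at hn
    subst hn
    refine exists_erasesVia_of_chords _ rfl hcl hl ho fun h hh => ?_
    exact (hi _ (Or.inr ⟨h, hh, rfl⟩)).resolve_left (by simp)
  | succ n ih =>
    intro D h₀ l J hn hcl hl ho hJ hi
    -- If no inward edge leads to `J`, all of them are chords, and what is left in `J` plays no
    -- role: separate pieces have no position relative to the loop.
    by_cases hg : ∀ g ∈ l, (flip D.next (rot g)).1.1 ∉ J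
    · refine exists_erasesVia_of_chords _ rfl hcl hl ho fun h hh => ?_
      exact (hi _ (Or.inr ⟨h, hh, rfl⟩)).resolve_left (hg h hh)
    push Not at hg
    obtain ⟨g, hgl, hg⟩ := hg
    obtain ⟨l₁, l₂, rfl⟩ := List.append_of_mem hgl
    have hr : Reach D.next h₀ g l₁ l₂ J := ⟨hl, hJ, hi, hg⟩
    obtain ⟨κ, hκ, hκo⟩ := exists_isOver_fingerOut hr.onFace
    have hκ' := change_ne_virt hκ
    have cl₁ : ∀ c, (fingerDiagram hr.onFace κ).IsClassical c := by
      rintro (c | _ | _)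
      exacts [hcl c, hκ, hκ']
    have inc_over : ∀ h : HalfEdge D.C, D.IsOver h.1 →
        (fingerDiagram hr.onFace κ).IsOver (inc h).1 := fun h hh => hh
    have hb := isOver_fingerBack hr.onFace κ hκo
    have ht : IsTri (fingerDiagram hr.onFace κ).next (fingerBack (before D.next g)
      (across D.next g)) (inc (rot g)) (inc (across D.next g)) := hr.isTri
    have heq₁ := equivalence_fingerDiagram hr.onFace hκ
    have hflip : (flip (fingerDiagram hr.onFace κ).next
        (fingerBack (before D.next g) (across D.next g))).1 = (inc g).1 := by
      change (flip hr.onFace.code (fingerBack (before D.next g) (across D.next g))).1 = _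
      rw [hr.onFace.flip_code, fingerFlip_back, flip_before]
      rfl
    -- The inner point is the corner off the over strand. RIII needs it to be classical, since an
    -- over strand must not be moved across a virtual crossing.
    have heq₂ := equivalence_triDiagram ht hb (by
      rw [hflip]; exact inc_over g (ho g (by simp))) (cl₁ _)
    obtain ⟨D', f, hf, heq⟩ := ih (D := triDiagram _ ht) (h₀ := inc h₀)
      (l := Reach.pushList D.next g l₁ l₂) (J := Reach.pushInside D.next g J)
      (hr.card_pushInside hn) cl₁ hr.push_loop (by
        intro h hh
        rcases Reach.mem_pushList.1 hh with ⟨y, hy, rfl⟩ | rfl | rfl | rfl | ⟨y, hy, rfl⟩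
        · exact inc_over y (ho y (by simp [hy]))
        · exact hκo
        · exact inc_over g (ho g (by simp))
        · exact hb
        · exact inc_over y (ho y (by simp [hy]))) (by
        intro h hh hJ'
        obtain ⟨c, hc, e⟩ := Finset.mem_map.1 hJ'
        have hc := Finset.mem_of_mem_erase hc
        rcases Reach.vert_pushList.1 ⟨h, hh, e.symm⟩ with ⟨y, hy, e'⟩ | ⟨_, e'⟩
        · exact hJ y hy (Sum.inl_injective e' ▸ hc)
        · exact absurd e' (by simp)) hr.push_inside
    have vert := @Reach.vert_pushList _ D.next h₀ g l₁ l₂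
    have inr_mem : ∀ i : Bool, ∃ h ∈ inc h₀ :: Reach.pushList D.next g l₁ l₂, h.1.1 = Sum.inr i :=
      fun i => vert.2 (Or.inr ⟨i, rfl⟩)
    have g_mem : ∃ h ∈ inc h₀ :: Reach.pushList D.next g l₁ l₂, h.1.1 = Sum.inl g.1.1 :=
      vert.2 (Or.inl ⟨g, by simp, rfl⟩)
    -- Two of the three corners lie on the loop and get dissolved, so turning over the triangle does
    -- not matter for the erasure; afterwards the finger is cancelled as well.
    have hf₁ : ErasesVia (fingerDiagram hr.onFace κ) D'
        {c | ∃ h ∈ inc h₀ :: Reach.pushList D.next g l₁ l₂, h.1.1 = c} f :=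
      ErasesVia.of_triDiagram ht (Or.inl (inr_mem true)) (Or.inl g_mem) (Or.inl (inr_mem true)) hf
    obtain ⟨k, hk, -⟩ := (erasesVia_fingerDiagram hr.onFace κ).cancel hf₁ (by
      rintro _ ⟨i, rfl⟩
      exact inr_mem i)
    refine ⟨D', k, ?_, equivalence.trans (equivalence.symm heq₁) (equivalence.trans heq₂ heq)⟩
    convert hk using 1
    ext c
    refine Iff.trans ?_ (vert (c := Sum.inl c)).symm
    simp [Sum.inl_injective.eq_iff]

/-- A loop that goes over everything can be removed, in a diagram without virtual crossings. -/
theorem exists_erasesVia_loop {D : VirtualDiagram} {h₀ : HalfEdge D.C} {l : List (HalfEdge D.C)}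
    (hcl : ∀ c, D.IsClassical c) (hl : Loop D.next h₀ l) (ho : ∀ h ∈ l, D.IsOver h.1) :
    ∃ D' f, ErasesVia D D' {c | ∃ h ∈ h₀ :: l, h.1.1 = c} f ∧ equivalence D D' := by
  obtain ⟨J, hJ, hi⟩ := hl.exists_inside D.planar
  exact exists_erasesVia_of_inside _ rfl hcl hl ho hJ hi

/-! ### Removing a self-crossing strand -/

section Strand

variable {C : Type} {next : Equiv.Perm (C × Bool)}

theorem path_reverse {x y : HalfEdge C} {l : List (HalfEdge C)} (h : Path next (flip next x) l y) :
    Path next (flip next y) (l.reverse.map opp) x := by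
  induction l generalizing x with
  | nil => exact (flip_eq_iff next).1 h |>.symm
  | cons a l ih =>
    rw [List.reverse_cons, List.map_append, List.map_singleton, path_append, opp_opp]
    exact ⟨ih h.2, ((flip_eq_iff next).1 h.1).symm⟩

theorem path_iterate (p : C × Bool) (m : ℕ) :
    Path next (flip next (p, true)) ((List.iterate next (next p) m).map fun q => (q, true))
      (next^[m + 1] p, false) := by
  induction m generalizing p with
  | zero => rfl
  | succ m ih => exact ⟨rfl, ih (next p)⟩

end Strand

/-- A strand that goes over everything, and whose ends are the two passages of a double point. -/
theorem exists_erasesVia_strand {D : VirtualDiagram} {p : D.C × Bool} {m : ℕ}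
    (hcl : ∀ c, D.IsClassical c) (hp : D.next^[m + 1] p = oth p)
    (hinj : ∀ i ≤ m, ∀ j ≤ m, (D.next^[i] p).1 = (D.next^[j] p).1 → i = j)
    (ho : ∀ i, 1 ≤ i → i ≤ m → D.IsOver (D.next^[i] p)) :
    ∃ D' f E, ErasesVia D D' E f ∧ equivalence D D' ∧ (∀ i ≤ m, (D.next^[i] p).1 ∈ E) := by
  have nd : ((p :: List.iterate D.next (D.next p) m).map Prod.fst).Nodup := by
    have e : p :: List.iterate D.next (D.next p) m = List.iterate D.next p (m + 1) := rfl
    rw [e, ← List.range_map_iterate, List.map_map]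
    refine List.Nodup.map_on (fun i hi j hj h => ?_) List.nodup_range
    rw [List.mem_range] at hi hj
    exact hinj i (by omega) j (by omega) h
  have mem : ∀ q ∈ List.iterate D.next (D.next p) m, ∃ i, 1 ≤ i ∧ i ≤ m ∧ q = D.next^[i] p := by
    intro q hq
    obtain ⟨i, hi, rfl⟩ := List.mem_iterate.1 hq
    exact ⟨i + 1, by omega, by omega, rfl⟩
  have mem' : ∀ i, 1 ≤ i → i ≤ m → D.next^[i] p ∈ List.iterate D.next (D.next p) m := by
    intro i h1 h2
    obtain ⟨i, rfl⟩ := Nat.exists_eq_add_of_le' h1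
    exact List.mem_iterate.2 ⟨i, by omega, rfl⟩
  have path := path_iterate (next := D.next) p m
  rw [hp] at path
  -- A `Loop` turns left at its corner. If the strand from `p` turns right there, it is run
  -- backwards.
  cases hs : p.2 with
  | true =>
    have e : (oth p, false) = rot (p, true) := by
      refine Prod.ext rfl ?_
      simp [rot, hs]
    rw [e] at path
    obtain ⟨D', f, hf, heq⟩ := exists_erasesVia_loop hcl ⟨path, by
        simpa [Function.comp_def] using nd⟩ (by
      intro h hh
      obtain ⟨q, hq, rfl⟩ := List.mem_map.1 hh
      obtain ⟨i, h1, h2, rfl⟩ := mem q hq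
      exact ho i h1 h2)
    refine ⟨D', f, _, hf, heq, fun i hi => ?_⟩
    rcases Nat.eq_zero_or_pos i with rfl | h1
    · exact ⟨_, List.mem_cons_self, rfl⟩
    · exact ⟨_, List.mem_cons_of_mem _ (List.mem_map_of_mem (mem' i h1 hi)), rfl⟩
  | false =>
    have e : (p, true) = rot (oth p, false) := by
      rcases p with ⟨c, s⟩
      subst hs
      rfl
    have path := path_reverse path
    rw [e] at path
    obtain ⟨D', f, hf, heq⟩ := exists_erasesVia_loop hcl ⟨path, by
        have : ((p :: (List.iterate D.next (D.next p) m)).map Prod.fst).Perm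
            (((oth p, false) :: (((List.iterate D.next (D.next p) m).map
              fun q => (q, true)).reverse.map opp)).map fun x => x.1.1) := by
          rw [List.map_cons, List.map_cons]
          refine List.Perm.cons _ ?_
          rw [← List.map_reverse, List.map_map, List.map_map]
          exact (List.reverse_perm _).symm.map _
        exact this.nodup_iff.1 nd⟩ (by
      intro h hh
      obtain ⟨q, hq, rfl⟩ := List.mem_map.1 hh
      obtain ⟨q, hq', rfl⟩ := List.mem_map.1 (List.mem_reverse.1 hq)
      obtain ⟨i, h1, h2, rfl⟩ := mem q hq'
      exact ho i h1 h2)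
    refine ⟨D', f, _, hf, heq, fun i hi => ?_⟩
    rcases Nat.eq_zero_or_pos i with rfl | h1
    · exact ⟨_, List.mem_cons_self, rfl⟩
    · refine ⟨opp (D.next^[i] p, true), List.mem_cons_of_mem _ (List.mem_map_of_mem
        (List.mem_reverse.2 (List.mem_map_of_mem (mem' i h1 hi)))), rfl⟩

theorem classical_kink {D : VirtualDiagram} (hcl : ∀ c, D.IsClassical c) (p : D.C × Bool) :
    ∀ c, (kinkDiagram D p .pos).IsClassical c := by
  rintro (_ | c)
  · exact CrossingKind.noConfusion
  · exact hcl c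

/-- A component without self-crossings that goes over everything. -/
theorem exists_erasesVia_component {D : VirtualDiagram} {p : D.C × Bool} {m : ℕ}
    (hcl : ∀ c, D.IsClassical c) (hp : D.next^[m + 1] p = p)
    (hinj : ∀ i ≤ m, ∀ j ≤ m, (D.next^[i] p).1 = (D.next^[j] p).1 → i = j)
    (ho : ∀ i ≤ m, D.IsOver (D.next^[i] p)) :
    ∃ D' f E, ErasesVia D D' E f ∧ equivalence D D' ∧ p.1 ∈ E := by
  -- A kink on the last edge of the component supplies the corner: the component becomes a strand
  -- from one passage of the kink to the other. The sign of the kink is arbitrary, since the corner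
  -- need not be over.
  obtain ⟨K, hK⟩ : ∃ K, K = kinkCode D.next (D.next^[m] p) := ⟨_, rfl⟩
  have h1 : D.next (D.next^[m] p) = p := by rw [← Function.iterate_succ_apply' D.next, hp]
  have h2 : ∀ i ≤ m, K^[i + 1] (none, true) = Prod.map some id (D.next^[i] p) := by
    intro i
    induction i with
    | zero =>
      intro _
      change K (none, true) = _
      rw [hK, kinkCode_true, h1]
      rfl
    | succ i ih =>
      intro hi
      rw [Function.iterate_succ_apply', ih (by omega), hK, kinkCode_some,
        Function.iterate_succ_apply']
      intro e
      have := hinj i (by omega) m le_rfl (by rw [e])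
      omega
  have h3 : K^[m + 1 + 1] (none, true) = (none, false) := by
    rw [Function.iterate_succ_apply', h2 m le_rfl, hK, kinkCode_some_self]
  have h4 : ∀ i ≤ m + 1, ∀ j ≤ m + 1,
      (K^[i] (none, true)).1 = (K^[j] (none, true)).1 → i = j := by
    rintro (_ | i) hi (_ | j) hj e
    · rfl
    · rw [h2 j (by omega)] at e
      exact absurd e (by simp)
    · rw [h2 i (by omega)] at e
      exact absurd e (by simp)
    · rw [h2 i (by omega), h2 j (by omega)] at e
      rw [hinj i (by omega) j (by omega) (Option.some_injective _ e)]
  have h5 : ∀ i, 1 ≤ i → i ≤ m + 1 →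
      (kinkDiagram D (D.next^[m] p) .pos).IsOver (K^[i] (none, true)) := by
    intro i i1 i2
    obtain ⟨i, rfl⟩ := Nat.exists_eq_add_of_le' i1
    rw [h2 i (by omega)]
    exact ho i (by omega)
  subst hK
  obtain ⟨D', f, E, hf, heq, hE⟩ := exists_erasesVia_strand (D := kinkDiagram D (D.next^[m] p) .pos)
    (p := (none, true)) (m := m + 1) (classical_kink hcl _) h3 h4 h5
  obtain ⟨k, hk, -⟩ := (erasesVia_kinkDiagram D (D.next^[m] p) .pos).cancel hf (by
    rintro _ rfl
    exact hE 0 (by omega))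
  refine ⟨D', k, _, hk, equivalence.trans (equivalence.symm
    (equivalence_kinkDiagram _ (by simp))) heq, ?_⟩
  have := hE 1 (by omega)
  have e := h2 0 (by omega)
  exact (congrArg (fun q : Option D.C × Bool => q.1 ∈ E) e).mp this

/-! ### Descending diagrams -/

/-- The diagram `D` is descending: the passages are ordered such that every component is run
through once, and every crossing is first met at its over passage. -/
structure Descending {α : Type} [LinearOrder α] (D : VirtualDiagram) (t : D.C × Bool → α) :
    Prop where
  injective : Function.Injective t
  step : ∀ p, (t p < t (D.next p) ∧ ∀ r, t p < t r → t (D.next p) ≤ t r) ∨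
    ∀ r, D.next.SameCycle p r → t (D.next p) ≤ t r
  over_first : ∀ p, D.IsOver p → t p < t (oth p)

theorem Ret.sameCycle {C : Type} {next : Equiv.Perm (C × Bool)} {E : Set C} {p q : C × Bool}
    (h : Ret next E p q) : next.SameCycle p q := by
  induction h with
  | base _ => exact Equiv.Perm.sameCycle_apply_right.2 (Equiv.Perm.SameCycle.refl _ _)
  | step _ _ ih => exact Equiv.Perm.sameCycle_apply_left.1 ih

theorem ErasesVia.sameCycle {D D' : VirtualDiagram} {E : Set D.C} {f : D'.C → D.C}
    (h : ErasesVia D D' E f) {p q : D'.C × Bool} (hpq : D'.next.SameCycle p q) :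
    D.next.SameCycle (Prod.map f id p) (Prod.map f id q) := by
  obtain ⟨n, rfl⟩ := exists_iterate_of_sameCycle hpq
  generalize n + 1 = n
  clear hpq
  induction n with
  | zero => exact Equiv.Perm.SameCycle.refl _ _
  | succ n ih =>
    rw [Function.iterate_succ_apply']
    exact ih.trans (h.ret _).sameCycle

/-- The survivors keep their order. Between two consecutive survivors on a component the walk either
moves on in time throughout or passes the base point once, which gives the two alternatives in
`step`. -/
theorem Descending.of_erasesVia {α : Type} [LinearOrder α] {D D' : VirtualDiagram} {E : Set D.C}
    {f : D'.C → D.C} {t : D.C × Bool → α} (hd : Descending D t) (h : ErasesVia D D' E f) :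
    Descending D' (fun p => t (Prod.map f id p)) where
  injective := hd.injective.comp (h.injective.prodMap Function.injective_id)
  step := by
    have key : ∀ {p q}, Ret D.next E p q →
        (t p < t q ∧ ∀ r : D.C × Bool, r.1 ∉ E → t p < t r → t q ≤ t r) ∨
        ∀ r : D.C × Bool, r.1 ∉ E → D.next.SameCycle p r → t q ≤ t r := by
      intro p q hpq
      induction hpq with
      | @base p _ => exact (hd.step p).imp (fun h => ⟨h.1, fun r _ => h.2 r⟩) fun h r _ => h r
      | @step p q hp _ ih =>
        have ne : ∀ r : D.C × Bool, r.1 ∉ E → t (D.next p) ≤ t r → t (D.next p) < t r :=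
          fun r hr h => lt_of_le_of_ne h fun e => hr (hd.injective e ▸ hp)
        have sc : ∀ r, D.next.SameCycle p r → D.next.SameCycle (D.next p) r := fun r hr =>
          Equiv.Perm.sameCycle_apply_left.2 hr
        rcases ih with ⟨i1, i2⟩ | i
        · rcases hd.step p with ⟨j1, j2⟩ | j
          · exact Or.inl ⟨j1.trans i1, fun r hr hlt => i2 r hr (ne r hr (j2 r hlt))⟩
          · exact Or.inr fun r hr hs => i2 r hr (ne r hr (j r hs))
        · exact Or.inr fun r hr hs => i r hr (sc r hs)
    intro p
    exact (key (h.ret p)).imp (fun i => ⟨i.1, fun r => i.2 _ (h.notMem _)⟩)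
      fun i r hr => i _ (h.notMem _) (h.sameCycle hr)
  over_first p hp := hd.over_first _ ((h.isOver_iff p).1 hp)

theorem isOver_or_isOver_oth {D : VirtualDiagram} {p : D.C × Bool} (h : D.IsClassical p.1) :
    D.IsOver p ∨ D.IsOver (oth p) := by
  rcases p with ⟨c, s⟩
  unfold IsOver
  unfold IsClassical at h
  rcases e : D.kind c with _ | _ | _
  · cases s <;> simp [oth, e]
  · cases s <;> simp [oth, e]
  · exact absurd e h

/-- The first component of a descending diagram can be simplified. -/
theorem Descending.exists_erasesVia {α : Type} [LinearOrder α] {D : VirtualDiagram}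
    {t : D.C × Bool → α} (hd : Descending D t) (hcl : ∀ c, D.IsClassical c) (hne : Nonempty D.C) :
    ∃ D' f E, ErasesVia D D' E f ∧ equivalence D D' ∧ Set.Nonempty E := by
  obtain ⟨p, hp⟩ := Finite.exists_min t
  -- The walk from the earliest passage `p` is followed up to the first double point that it meets
  -- twice.
  have hex : ∃ k, ∃ j < k, (D.next^[j] p).1 = (D.next^[k] p).1 := by
    obtain ⟨i, j, hij, e⟩ := Finite.exists_ne_map_eq_of_infinite fun n => (D.next^[n] p).1
    rcases lt_or_gt_of_ne hij with h | h
    · exact ⟨j, i, h, e⟩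
    · exact ⟨i, j, h, e.symm⟩
  classical
  obtain ⟨k, hk⟩ : ∃ k, k = Nat.find hex := ⟨_, rfl⟩
  obtain ⟨j, hj, ej⟩ := Nat.find_spec hex
  rw [← hk] at hj ej
  have hmin : ∀ i < k, ∀ i' < i, (D.next^[i'] p).1 ≠ (D.next^[i] p).1 := fun i hi i' hi' e =>
    Nat.find_min hex (hk ▸ hi) ⟨i', hi', e⟩
  have hinj : ∀ i < k, ∀ i' < k, (D.next^[i] p).1 = (D.next^[i'] p).1 → i = i' := by
    intro i hi i' hi' e
    rcases lt_trichotomy i i' with h | h | h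
    · exact absurd e (hmin i' hi' i h)
    · exact h
    · exact absurd e.symm (hmin i hi i' h)
  -- Up to that moment the walk follows the time order without gaps: a jump back would mean a return
  -- to `p`, hence a repeated double point.
  have first : ∀ i < k, ∀ r, t r < t (D.next^[i] p) → ∃ i' < i, r = D.next^[i'] p := by
    intro i
    induction i with
    | zero => exact fun _ r hr => absurd hr (not_lt.2 (hp r))
    | succ i ih =>
      intro hi r hr
      rw [Function.iterate_succ_apply'] at hr
      rcases hd.step (D.next^[i] p) with ⟨h1, h2⟩ | h
      · rcases lt_trichotomy (t r) (t (D.next^[i] p)) with h3 | h3 | h3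
        · obtain ⟨i', hi', e⟩ := ih (by omega) r h3
          exact ⟨i', by omega, e⟩
        · exact ⟨i, by omega, hd.injective h3⟩
        · exact absurd hr (not_lt.2 (h2 r h3))
      · have sc : D.next.SameCycle (D.next^[i] p) p :=
          (Equiv.Perm.SameCycle.symm ⟨i, by simp [Equiv.Perm.iterate_eq_pow]⟩)
        have e : D.next (D.next^[i] p) = p := hd.injective (le_antisymm (h p sc) (hp _))
        exact absurd (by rw [Function.iterate_succ_apply', e]; rfl) (hmin (i + 1) hi 0 (by omega))
  -- An under passage would be preceded by its over passage, and the double point would have been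
  -- repeated already.
  have isOver : ∀ i < k, D.IsOver (D.next^[i] p) := by
    intro i hi
    refine (isOver_or_isOver_oth (hcl _)).resolve_right fun h => ?_
    have := hd.over_first _ h
    rw [oth_oth] at this
    obtain ⟨i', hi', e⟩ := first i hi _ this
    exact hmin i hi i' hi' (by rw [← e]; rfl)
  -- Either the walk repeats a passage, which by injectivity is only possible for `p` itself, so a
  -- whole component has been traversed; or it meets the other passage of an earlier double point
  -- and closes a loop there.
  rcases eq_or_eq_oth ej.symm with e | e
  · rcases j with _ | j
    · obtain ⟨m, rfl⟩ := Nat.exists_eq_succ_of_ne_zero (by omega : k ≠ 0)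
      obtain ⟨D', f, E, h1, h2, h3⟩ := exists_erasesVia_component hcl e
        (fun i hi j hj => hinj i (by omega) j (by omega)) fun i hi => isOver i (by omega)
      exact ⟨D', f, E, h1, h2, _, h3⟩
    · obtain ⟨m, rfl⟩ := Nat.exists_eq_succ_of_ne_zero (by omega : k ≠ 0)
      rw [Nat.succ_eq_add_one, Function.iterate_succ_apply', Function.iterate_succ_apply'] at e
      have := hinj m (by omega) j (by omega) (by rw [D.next.injective e])
      omega
  · obtain ⟨m, rfl⟩ := Nat.exists_eq_add_of_lt hj
    have it : ∀ i, D.next^[i] (D.next^[j] p) = D.next^[j + i] p := fun i => by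
      rw [add_comm, Function.iterate_add_apply]
    obtain ⟨D', f, E, h1, h2, h3⟩ := exists_erasesVia_strand (p := D.next^[j] p) (m := m) hcl
      (by rw [it, ← add_assoc]; exact e)
      (fun i hi i' hi' h => by
        rw [it, it] at h
        have := hinj _ (by omega) _ (by omega) h
        omega)
      (fun i _ hi => by rw [it]; exact isOver _ (by omega))
    exact ⟨D', f, E, h1, h2, _, h3 0 (by omega)⟩

theorem Descending.isTrivial {α : Type} [LinearOrder α] (n : ℕ) : ∀ {D : VirtualDiagram}
    {t : D.C × Bool → α}, Fintype.card D.C = n → Descending D t → (∀ c, D.IsClassical c) →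
    D.IsTrivial := by
  induction n using Nat.strong_induction_on with
  | _ n ih =>
    intro D t hn hd hcl
    rcases isEmpty_or_nonempty D.C with he | hne
    · exact ⟨D, he, equivalence.refl D⟩
    obtain ⟨D', f, E, hf, heq, c, hc⟩ := hd.exists_erasesVia hcl hne
    have hlt : Fintype.card D'.C < n := by
      rw [← hn]
      exact Fintype.card_lt_of_injective_of_notMem f hf.injective
        (b := c) fun h => (hf.range c).1 h hc
    obtain ⟨D₀, h1, h2⟩ := ih _ hlt rfl (hd.of_erasesVia hf)
      fun c => (hf.isClassical_iff c).2 (hcl _)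
    exact ⟨D₀, h1, equivalence.trans heq h2⟩

/-! ### Replacing a virtual crossing by a classical one -/

section Corner

variable {C : Type} {next : Equiv.Perm (C × Bool)}

/-- Every double point has a corner that is not the corner of a monogon. -/
theorem exists_corner (next : Equiv.Perm (C × Bool)) (c : C) :
    ∃ k : HalfEdge C, k.1.1 = c ∧ OnFace next (flip next (rot k)) k 1 := by
  have key : ∃ k : HalfEdge C, k.1.1 = c ∧ k ≠ flip next (rot k) := by
    by_contra! h
    have h1 := h ((c, true), true) rfl
    have h2 := h (rot ((c, true), true)) rfl
    rw [← flip_eq_iff, h2] at h1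
    exact (rotations_ne ((c, true), true)).2.2.1.1 (by simpa using (flip_injective next h1).symm)
  obtain ⟨k, hk, h⟩ := key
  have e : face next (flip next (rot k)) = k := by rw [face, flip_flip, rotInv_rot]
  refine ⟨k, hk, le_rfl, e, fun i h1 h2 => ?_, ?_⟩
  · rw [le_antisymm h2 h1, Function.iterate_one, e]
    exact h
  · rw [flip_flip]
    exact (rotations_ne k).1.1

variable {k : HalfEdge C}

variable (k) in
/-- The corners of the bigon. -/
def cornerSet : Set (C ⊕ Bool) := {Sum.inr true, Sum.inl k.1.1}

theorem inl_notMem_cornerSet {x : C} (h : x ≠ k.1.1) : Sum.inl x ∉ cornerSet k := by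
  simp [cornerSet, h]

theorem inl_mem_cornerSet {x : C} (h : x = k.1.1) : Sum.inl x ∈ cornerSet k := by
  simp [cornerSet, h]

theorem inr_mem_cornerSet : Sum.inr true ∈ cornerSet k := by simp [cornerSet]

theorem inr_notMem_cornerSet : Sum.inr false ∉ cornerSet k := by simp [cornerSet]

theorem inl_mem_map {R : Finset C} {x : C} :
    (Sum.inl x : C ⊕ Bool) ∈ R.map ⟨Sum.inl, Sum.inl_injective⟩ ↔ x ∈ R := by
  simp

theorem inr_notMem_map {R : Finset C} (i : Bool) :
    (Sum.inr i : C ⊕ Bool) ∉ R.map ⟨Sum.inl, Sum.inl_injective⟩ := by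
  simp

variable [DecidableEq C]

/-- The new name of a double point, after the bigon that is made by a finger at its corner has
been removed on the other side. -/
def moveCorner (c x : C) : C ⊕ Bool := if x = c then Sum.inr false else Sum.inl x

/-- Of the two new double points, `fingerOut` is the one away from the corner. Its `rot` plays the
role of `k` with the same label and direction, so the replacement keeps the position in the plane
and the meaning of the signs. -/
theorem lift_moveCorner (hk : OnFace next (flip next (rot k)) k 1) :
    lift (moveCorner k.1.1) k = rot (fingerOut (flip next (rot k)) k) := by
  have h : (flip next (rot k)).2 = !(rot k).2 := flip_snd _ _
  rw [fingerOut, h]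
  rcases k with ⟨⟨c, _ | _⟩, _ | _⟩ <;> simp [lift, moveCorner, rot]

theorem lift_moveCorner_of_ne {x y : HalfEdge C} (h : x.1.1 ≠ y.1.1) :
    lift (moveCorner y.1.1) x = inc x :=
  Prod.ext (Prod.ext (if_neg h) rfl) rfl

theorem moveCorner_range (x : C ⊕ Bool) :
    x ∈ Set.range (moveCorner k.1.1) ↔ x ∉ cornerSet k := by
  simp only [cornerSet, Set.mem_insert_iff, Set.mem_singleton_iff, Set.mem_range, moveCorner]
  rcases x with x | _ | _
  · by_cases h : x = k.1.1
    · simp only [h, or_true, not_true_eq_false, iff_false, not_exists]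
      intro y
      split_ifs with h' <;> simp [h']
    · simp only [Sum.inl_injective.eq_iff, h, reduceCtorEq, or_self, not_false_eq_true, iff_true]
      exact ⟨x, if_neg h⟩
  · simp only [Sum.inr.injEq, Bool.false_eq_true, reduceCtorEq, or_self, not_false_eq_true, iff_true]
    exact ⟨k.1.1, if_pos rfl⟩
  · simp only [true_or, not_true_eq_false, iff_false, not_exists]
    intro y
    split_ifs <;> simp

theorem moveCorner_injective (c : C) : Function.Injective (moveCorner c) := by
  intro x y h
  simp only [moveCorner] at h
  split_ifs at h with h1 h2
  · rw [h1, h2]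
  · exact Sum.inl_injective h

theorem ite_moveCorner {R : Finset C} {c : C} (hc : c ∉ R) (κ K : C → CrossingKind) (x : C) :
    (if x ∈ insert c R then κ x else K x) =
      if moveCorner c x ∈ R.map ⟨Sum.inl, Sum.inl_injective⟩ then
        Sum.elim κ (fun _ => .pos) (moveCorner c x)
      else Sum.elim K (fun i => if i then .virt else κ c) (moveCorner c x) := by
  by_cases h : x = c
  · subst h
    simp [moveCorner]
  · by_cases h' : x ∈ R <;> simp [moveCorner, h, h']

/-- An edge that arrives at the corner point from the far side, by `opp k` or `rotInv k`, runs
through both dissolved double points and stops at the remaining one. -/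
theorem retH_arrive (hk : OnFace next (flip next (rot k)) k 1) {z : HalfEdge (C ⊕ Bool)}
    {y : HalfEdge C} (h : flip hk.code z = inc y) (h1 : y ≠ k) (h2 : y ≠ rot k) :
    RetH hk.code (cornerSet k) z (lift (moveCorner k.1.1) y) := by
  have hl := lift_moveCorner hk
  by_cases hy : y.1.1 = k.1.1
  · refine .of_str h (inl_mem_cornerSet hy) ?_
    rcases eq_of_vert_eq hy with rfl | rfl | rfl | rfl
    · exact absurd rfl h1
    · exact absurd rfl h2
    · rw [opp_lift, opp_opp, ← opp_lift, hl, opp_rot]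
      refine .of_str (by rw [hk.flip_code, hk.fingerFlip_k]) inr_mem_cornerSet ?_
      exact .of_flip (by rw [opp_rot, hk.flip_code, fingerFlip_rotInv_back]) inr_notMem_cornerSet
    · rw [opp_lift, opp_rotInv, ← rotInv_lift, hl, rotInv_rot]
      have e : flip hk.code (inc (rot k)) = fingerBack (flip next (rot k)) k := by
        have := fingerFlip_flip_h (next := next) (h := flip next (rot k)) (k := k)
        rw [flip_flip] at this
        rw [hk.flip_code, this]
      refine .of_str e inr_mem_cornerSet ?_
      exact .of_flip (by rw [hk.flip_code, fingerFlip_opp_back]) inr_notMem_cornerSet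
  · rw [lift_moveCorner_of_ne hy]
    exact .of_flip h (inl_notMem_cornerSet hy)

theorem retH_depart (hk : OnFace next (flip next (rot k)) k 1) {x : HalfEdge C} (h1 : x ≠ k)
    (h2 : x ≠ rot k) :
    RetH hk.code (cornerSet k) (inc x) (lift (moveCorner k.1.1) (flip next x)) := by
  have hl := lift_moveCorner hk
  by_cases e1 : x = flip next (rot k)
  · subst e1
    rw [flip_flip, ← rot_lift, hl, rot_rot]
    exact .of_flip (by rw [hk.flip_code, fingerFlip_h]) inr_notMem_cornerSet
  by_cases e2 : x = flip next k
  · subst e2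
    rw [flip_flip, hl]
    exact .of_flip (by rw [hk.flip_code, hk.fingerFlip_flip_k]) inr_notMem_cornerSet
  refine retH_arrive hk ?_ (fun e => e2 ?_) fun e => e1 ?_
  · rw [hk.flip_code, fingerFlip_inc e1 (by rwa [flip_flip]) h1 e2]
  · rw [← e, flip_flip]
  · rw [← e, flip_flip]

theorem retH_back (hk : OnFace next (flip next (rot k)) k 1) :
    RetH hk.code (cornerSet k) (fingerBack (flip next (rot k)) k)
      (lift (moveCorner k.1.1) (flip next (rotInv k))) := by
  have m := rotations_ne k
  refine .of_str (y := inc (rot k)) ?_ (inl_mem_cornerSet rfl) ?_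
  · rw [hk.flip_code, fingerFlip_back, flip_flip]
  · rw [opp_lift, opp_rot]
    exact retH_depart hk m.2.2.2.1 m.2.2.2.2.1

theorem retH_rot_back (hk : OnFace next (flip next (rot k)) k 1) :
    RetH hk.code (cornerSet k) (rot (fingerBack (flip next (rot k)) k))
      (lift (moveCorner k.1.1) (flip next (opp k))) := by
  have m := rotations_ne k
  refine .of_str (y := inc k) (by rw [hk.flip_code, fingerFlip_rot_back])
    (inl_mem_cornerSet rfl) ?_
  rw [opp_lift]
  exact retH_depart hk m.2.2.1.1 m.2.2.1.2.1

/-- Dissolving the bigon on the other side of the finger yields the original code, with the first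
new double point in place of the corner point. -/
theorem retH_moveCorner (hk : OnFace next (flip next (rot k)) k 1) (x : HalfEdge C) :
    RetH hk.code (cornerSet k) (lift (moveCorner k.1.1) x)
      (lift (moveCorner k.1.1) (flip next x)) := by
  have hl := lift_moveCorner hk
  have hne : flip next (rot k) ≠ k := hk.ne'.symm
  have hne' : flip next k ≠ rot k := hk.flip_flip_ne ∘ fun e => by rw [← e, flip_flip] at hne; exact absurd rfl hne
  by_cases hx : x.1.1 = k.1.1
  · rcases eq_of_vert_eq hx with rfl | rfl | rfl | rfl
    · rw [hl]
      exact retH_arrive hk (by rw [hk.flip_code, fingerFlip_rot_out]) (flip_ne next _) hne'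
    · rw [← rot_lift, hl, rot_rot]
      exact retH_arrive hk (by rw [hk.flip_code, fingerFlip_opp_out]) hne (flip_ne next _)
    · rw [← opp_lift, hl, opp_rot]
      refine .of_str (by rw [hk.flip_code, fingerFlip_rotInv_out]) inr_mem_cornerSet ?_
      rw [opp_rotInv]
      exact retH_rot_back hk
    · rw [← rotInv_lift, hl, rotInv_rot]
      refine .of_str (by rw [hk.flip_code, fingerFlip_out]) inr_mem_cornerSet ?_
      rw [opp_opp]
      exact retH_back hk
  · rw [lift_moveCorner_of_ne hx]
    exact retH_depart hk (fun e => hx (by rw [e])) fun e => hx (by rw [e]; rfl)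

theorem exists_retH_corner (hk : OnFace next (flip next (rot k)) k 1) {x : HalfEdge (C ⊕ Bool)}
    (hx : x.1.1 ∈ cornerSet k) : ∃ y, RetH hk.code (cornerSet k) x y := by
  have hb : RetH hk.code (cornerSet k) (rotInv (fingerBack (flip next (rot k)) k))
      (rotInv (fingerOut (flip next (rot k)) k)) :=
    .of_flip (by rw [hk.flip_code, fingerFlip_rotInv_back]) inr_notMem_cornerSet
  have hb' : RetH hk.code (cornerSet k) (opp (fingerBack (flip next (rot k)) k))
      (fingerOut (flip next (rot k)) k) :=
    .of_flip (by rw [hk.flip_code, fingerFlip_opp_back]) inr_notMem_cornerSet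
  rcases hx with hx | hx
  · rcases eq_of_vert_eq (h := fingerBack (flip next (rot k)) k) hx with rfl | rfl | rfl | rfl
    exacts [⟨_, retH_back hk⟩, ⟨_, retH_rot_back hk⟩, ⟨_, hb'⟩, ⟨_, hb⟩]
  · rcases eq_of_vert_eq (h := inc k) hx with rfl | rfl | rfl | rfl
    · exact ⟨_, .of_str (by rw [hk.flip_code, hk.fingerFlip_k]) inr_mem_cornerSet
        (by rw [opp_rot]; exact hb)⟩
    · have := fingerFlip_flip_h (next := next) (h := flip next (rot k)) (k := k)
      rw [flip_flip] at this
      exact ⟨_, .of_str (by rw [rot_lift, hk.flip_code, this]) inr_mem_cornerSet hb'⟩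
    · have m := rotations_ne k
      exact ⟨_, retH_depart hk (x := opp k) m.2.2.1.1 m.2.2.1.2.1⟩
    · have m := rotations_ne k
      exact ⟨_, retH_depart hk (x := rotInv k) m.2.2.2.1 m.2.2.2.2.1⟩

end Corner

/-! ### Replacing doubled virtual crossings -/

/-- The diagram with the same underlying code, and other kinds of double points. -/
def withKind (D : VirtualDiagram) (K : D.C → CrossingKind) : VirtualDiagram where
  C := D.C
  next := D.next
  kind := K
  circles := D.circles
  planar := D.planar

theorem erasesVia_moveCorner {D : VirtualDiagram} {k : HalfEdge D.C}
    (hk : OnFace D.next (flip D.next (rot k)) k 1) (κ : CrossingKind)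
    {K' : D.C ⊕ Bool → CrossingKind} {K : D.C → CrossingKind}
    (h : ∀ x, K x = K' (moveCorner k.1.1 x)) :
    ErasesVia (withKind (fingerDiagram hk κ) K') (withKind D K) (cornerSet k)
      (moveCorner k.1.1) := by
  have h2 : ∀ p, Ret hk.code (cornerSet k) (Prod.map (moveCorner k.1.1) id p)
      (Prod.map (moveCorner k.1.1) id (D.next p)) := fun p =>
    (retH_moveCorner hk (p, true)).ret rfl
  refine ⟨moveCorner_injective _, moveCorner_range, h, h2, ?_⟩
  refine congrArg (· + D.circles) (numCycles_eq moveCorner_range (moveCorner_injective _) h2 ?_)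
  intro p hp
  obtain ⟨y, hy⟩ := exists_retH_corner hk (x := (p, true)) hp
  exact ⟨_, hy.ret rfl⟩

/-- A virtual crossing that has been doubled by a finger can be replaced. -/
theorem equivalence_moveCorner {D : VirtualDiagram} {k : HalfEdge D.C}
    (hk : OnFace D.next (flip D.next (rot k)) k 1) (κ : CrossingKind)
    {K' : D.C ⊕ Bool → CrossingKind} {K : D.C → CrossingKind}
    (h : ∀ x, K x = K' (moveCorner k.1.1 x)) (h1 : K' (Sum.inr true) = .virt)
    (h2 : K' (Sum.inl k.1.1) = .virt) :
    equivalence (withKind (fingerDiagram hk κ) K') (withKind D K) := by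
  have e : flip hk.code (fingerBack (flip D.next (rot k)) k) = inc (rot k) := by
    rw [hk.flip_code, fingerFlip_back, flip_flip]
  have e2 : face hk.code (face hk.code (fingerBack (flip D.next (rot k)) k)) =
      fingerBack (flip D.next (rot k)) k := by
    rw [face, face, e, rotInv_lift, rotInv_rot, hk.flip_code, hk.fingerFlip_k, rotInv_rot]
  refine equivalence_of_move (move_virtual_bigon
    (D := withKind (fingerDiagram hk κ) K') (h := fingerBack (flip D.next (rot k)) k) (g := inc (rot k))
    e e2 Sum.inr_ne_inl h1 h2 (erasesVia_moveCorner hk κ h).erases)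

/-- Each of the virtual crossings in `R` can be doubled such that virtualization of a new crossing
amounts to replacing it by a classical crossing. -/
theorem exists_replace (n : ℕ) : ∀ (D : VirtualDiagram) (R : Finset D.C) (κ : D.C → CrossingKind),
    R.card = n → (∀ c, κ c ≠ .virt) →
    ∃ (D' : VirtualDiagram) (g : D.C → D'.C) (S : Finset D'.C), equivalence D D' ∧
      Function.Injective g ∧ (∀ c, D'.kind (g c) = D.kind c) ∧ S.card = n ∧
      (∀ x ∈ S, D'.IsClassical x) ∧ (∀ c, g c ∉ S) ∧
      ∀ (K : D.C → CrossingKind) (K' : D'.C → CrossingKind), (∀ c ∈ R, K c = .virt) →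
        (∀ c, K' (g c) = K c) → (∀ x ∈ S, K' x = .virt) →
        (∀ x ∉ S, x ∉ Set.range g → K' x = D'.kind x) →
        equivalence (withKind D' K') (withKind D fun c => if c ∈ R then κ c else K c) := by
  induction n with
  | zero =>
    intro D R κ hR _
    rw [Finset.card_eq_zero] at hR
    subst hR
    refine ⟨D, id, ∅, equivalence.refl D, Function.injective_id, fun _ => rfl, rfl, by simp, by simp,
      fun K K' _ h _ _ => ?_⟩
    have : K' = fun c => if c ∈ (∅ : Finset D.C) then κ c else K c := by
      funext c
      simpa using h c
    rw [this]
  | succ n ih =>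
    intro D R κ hR hκ
    obtain ⟨c, R', hc, rfl, hR'⟩ := Finset.card_eq_succ.1 hR
    obtain ⟨k, rfl, hk⟩ := exists_corner D.next c
    have hfin := equivalence_fingerDiagram hk (hκ k.1.1)
    -- The remaining virtual crossings are treated in the finger diagram. They all are old double
    -- points, so the value `.pos` at the new ones is never used.
    obtain ⟨D₂, g, S, heq, hg, hgk, hS, hSc, hgS, hK⟩ := ih (fingerDiagram hk (κ k.1.1))
      (R'.map ⟨Sum.inl, Sum.inl_injective⟩) (Sum.elim κ fun _ => .pos)
      ((Finset.card_map _).trans hR') (by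
        rintro (x | _)
        · exact hκ x
        · exact CrossingKind.noConfusion)
    have g_ne : ∀ {x y : D.C ⊕ Bool}, x ≠ y → g x ≠ g y := fun h e => h (hg e)
    refine ⟨D₂, fun x => g (Sum.inl x), insert (g (Sum.inr true)) S,
      equivalence.trans (equivalence.symm hfin) heq, hg.comp Sum.inl_injective,
      fun x => hgk _, ?_, ?_, ?_, ?_⟩
    · exact (Finset.card_insert_of_notMem (hgS _)).trans (congrArg (· + 1) hS)
    · intro x hx
      rcases Finset.mem_insert.1 hx with rfl | hx
      · exact fun h => change_ne_virt (hκ _) ((hgk _).symm.trans h)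
      · exact hSc x hx
    · intro x hx
      rcases Finset.mem_insert.1 hx with h | h
      · exact g_ne (by simp) h
      · exact hgS _ h
    · intro K K' k1 k2 k3 k4
      -- The second new crossing, next to the corner, is the one to be virtualized; the first one
      -- keeps the sign that was chosen for the virtual crossing.
      have step := hK (Sum.elim K fun i => if i then .virt else κ k.1.1) K' (by
          intro x hx
          obtain ⟨y, hy, rfl⟩ := Finset.mem_map.1 hx
          exact k1 y (Finset.mem_insert_of_mem hy)) (by
          rintro (x | _ | _)
          · exact k2 x
          · refine (k4 _ ?_ ?_).trans (hgk _)
            · intro h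
              rcases Finset.mem_insert.1 h with h | h
              · exact g_ne (by simp) h
              · exact hgS _ h
            · rintro ⟨y, hy⟩
              exact g_ne (by simp) hy
          · exact k3 _ (Finset.mem_insert_self _ _))
        (fun x hx => k3 x (Finset.mem_insert_of_mem hx)) (by
          intro x hx hx'
          refine k4 x (fun h => ?_) ?_
          · rcases Finset.mem_insert.1 h with rfl | h
            · exact hx' ⟨_, rfl⟩
            · exact hx h
          · rintro ⟨y, rfl⟩
            exact hx' ⟨_, rfl⟩)
      refine equivalence.trans step (equivalence_moveCorner hk (κ k.1.1) (fun x => ?_) ?_ ?_)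
      · exact ite_moveCorner hc κ K x
      · exact if_neg (inr_notMem_map _)
      · exact (if_neg (inl_mem_map.not.2 hc)).trans (k1 _ (Finset.mem_insert_self _ _))

/-! ### Base point sequences -/

section Time

variable {C : Type} {next : Equiv.Perm (C × Bool)}

theorem nonempty_basePointSequence [Finite C] (next : Equiv.Perm (C × Bool)) :
    Nonempty (BasePointSequence next) := by
  obtain ⟨n, ⟨e⟩⟩ := Finite.exists_equiv_fin (Quotient (Equiv.Perm.SameCycle.setoid next))
  refine ⟨n, fun i => (e.symm i).out, fun p => ⟨e ⟦p⟧, ?_, fun i hi => ?_⟩⟩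
  · beta_reduce
    rw [e.symm_apply_apply]
    exact Quotient.mk_out (s := Equiv.Perm.SameCycle.setoid next) p
  · rw [← e.symm_apply_eq, ← (e.symm i).out_eq]
    exact Quotient.sound hi

variable {a : BasePointSequence next} {i j : Fin a.length} {k l : ℕ} {q r : C × Bool}

theorem encounters_sameCycle (h : a.Encounters i k q) : next.SameCycle (a.pt i) q := by
  rw [← h.1, ← Equiv.Perm.coe_pow]
  exact ⟨(k + 1 : ℕ), by rw [zpow_natCast]⟩

theorem encounters_unique (h : a.Encounters i k q) (h' : a.Encounters j l q) : i = j ∧ k = l := by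
  obtain rfl : i = j := (a.cover q).unique (encounters_sameCycle h) (encounters_sameCycle h')
  refine ⟨rfl, le_antisymm ?_ ?_⟩
  · exact not_lt.1 fun hl => h.2 l hl h'.1
  · exact not_lt.1 fun hl => h'.2 k hl h.1

theorem exists_encounters [Finite C] (a : BasePointSequence next) (q : C × Bool) :
    ∃ i k, a.Encounters i k q := by
  obtain ⟨i, hi, -⟩ := a.cover q
  have h := exists_iterate_of_sameCycle hi
  classical
  exact ⟨i, Nat.find h, Nat.find_spec h, fun j hj => Nat.find_min h hj⟩

/-- The moment at which a passage is encountered. -/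
noncomputable def time [Finite C] (a : BasePointSequence next) (q : C × Bool) :
    Fin a.length ×ₗ ℕ :=
  toLex ((exists_encounters a q).choose, (exists_encounters a q).choose_spec.choose)

theorem time_eq [Finite C] (h : a.Encounters i k q) : time a q = toLex (i, k) := by
  obtain ⟨h1, h2⟩ := encounters_unique (exists_encounters a q).choose_spec.choose_spec h
  exact congrArg toLex (Prod.ext h1 h2)

theorem time_injective [Finite C] (a : BasePointSequence next) : Function.Injective (time a) := by
  intro q r e
  obtain ⟨i, k, h⟩ := exists_encounters a q
  obtain ⟨j, l, h'⟩ := exists_encounters a r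
  rw [time_eq h, time_eq h'] at e
  obtain ⟨rfl, rfl⟩ := Prod.ext_iff.1 (toLex.injective e)
  exact h.1.symm.trans h'.1

theorem before_iff [Finite C] : a.Before q r ↔ time a q < time a r := by
  constructor
  · rintro ⟨i, j, k, l, h, h', hl⟩
    rw [time_eq h, time_eq h']
    exact Prod.Lex.toLex_lt_toLex.2 hl
  · intro hl
    obtain ⟨i, k, h⟩ := exists_encounters a q
    obtain ⟨j, l, h'⟩ := exists_encounters a r
    rw [time_eq h, time_eq h'] at hl
    exact ⟨i, j, k, l, h, h', Prod.Lex.toLex_lt_toLex.1 hl⟩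

theorem time_step [Finite C] (a : BasePointSequence next) (p : C × Bool) :
    (time a p < time a (next p) ∧ ∀ r, time a p < time a r → time a (next p) ≤ time a r) ∨
      ∀ r, next.SameCycle p r → time a (next p) ≤ time a r := by
  obtain ⟨i, k, h⟩ := exists_encounters a p
  -- The base point lies on the edge that starts at `a.pt i`, so this passage is met last on its
  -- component and its successor first.
  by_cases hp : p = a.pt i
  · right
    intro r hr
    obtain ⟨j, l, h'⟩ := exists_encounters a r
    obtain rfl : j = i := (a.cover r).unique (encounters_sameCycle h') (hp ▸ hr)
    rw [time_eq h', time_eq (i := j) (k := 0) ⟨congrArg next hp.symm, by simp⟩]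
    exact Prod.Lex.toLex_le_toLex.2 (.inr ⟨rfl, Nat.zero_le _⟩)
  · left
    have h1 : a.Encounters i (k + 1) (next p) := by
      refine ⟨by rw [Function.iterate_succ_apply', h.1], fun j hj e => ?_⟩
      rw [Function.iterate_succ_apply'] at e
      have e := next.injective e
      cases j with
      | zero => exact hp e.symm
      | succ j => exact h.2 j (Nat.lt_of_succ_lt_succ hj) e
    rw [time_eq h, time_eq h1]
    refine ⟨Prod.Lex.toLex_lt_toLex.2 (.inr ⟨rfl, Nat.lt_succ_self k⟩), fun r hr => ?_⟩
    obtain ⟨j, l, h'⟩ := exists_encounters a r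
    rw [time_eq h'] at hr ⊢
    exact Prod.Lex.toLex_le_toLex.2
      ((Prod.Lex.toLex_lt_toLex.1 hr).imp id fun hh => ⟨hh.1, Nat.succ_le_of_lt hh.2⟩)

end Time

/-! ### The warping degree -/

theorem IsUnder.isClassical {D : VirtualDiagram} {p : D.C × Bool} (h : D.IsUnder p) :
    D.IsClassical p.1 := by
  intro e
  rcases h with h | h <;> rw [e] at h <;> cases h.1

theorem isUnder_oth {D : VirtualDiagram} {p : D.C × Bool} (h : D.IsOver p) : D.IsUnder (oth p) := by
  rcases h with ⟨h, h'⟩ | ⟨h, h'⟩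
  · exact .inl ⟨h, by simp [oth, h']⟩
  · exact .inr ⟨h, by simp [oth, h']⟩

/-- Changing exactly the warping crossings works. This makes the set in `warpingDegreeAt` nonempty,
so that its infimum is attained and is not a default value. -/
theorem exists_not_isWarping (D : VirtualDiagram) (a : BasePointSequence D.next) :
    ∃ T : Finset D.C, (∀ c ∈ T, D.IsClassical c) ∧
      ∀ c : D.C, ¬ (D.changeCrossings T).IsWarping a c := by
  classical
  refine ⟨Finset.univ.filter fun c => D.IsWarping a c, fun c hc => ?_, ?_⟩
  · obtain ⟨s, hs, -⟩ := (Finset.mem_filter.1 hc).2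
    exact IsUnder.isClassical hs
  rintro c ⟨s, hs, hb⟩
  have hb : time a (c, s) < time a (c, !s) := before_iff.1 hb
  by_cases hc : D.IsWarping a c
  · obtain ⟨s', hs', hb'⟩ := hc
    have hb' : time a (c, s') < time a (c, !s') := before_iff.1 hb'
    obtain rfl : s = !s' := by
      have hc : D.IsWarping a c := ⟨s', hs', before_iff.2 hb'⟩
      simp only [IsUnder, changeCrossings, Finset.mem_filter, Finset.mem_univ, true_and, hc,
        if_true] at hs hs'
      generalize D.kind c = κ at hs hs'
      cases κ <;> cases s <;> cases s' <;> simp_all [CrossingKind.change]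
    rw [Bool.not_not] at hb
    exact lt_asymm hb hb'
  · refine hc ⟨s, ?_, before_iff.2 hb⟩
    simpa [IsUnder, changeCrossings, hc] using hs

/-- The warping degree is attained. -/
theorem exists_warpingDegree (D : VirtualDiagram) :
    ∃ (a : BasePointSequence D.next) (T : Finset D.C), (∀ c ∈ T, D.IsClassical c) ∧
      T.card = D.warpingDegree ∧ ∀ c : D.C, ¬ (D.changeCrossings T).IsWarping a c := by
  have := nonempty_basePointSequence D.next
  obtain ⟨a, ha⟩ : D.warpingDegree ∈ Set.range D.warpingDegreeAt :=
    Nat.sInf_mem (Set.range_nonempty _)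
  obtain ⟨T₀, h1, h2⟩ := exists_not_isWarping D a
  obtain ⟨T, h⟩ : D.warpingDegreeAt a ∈ {k | ∃ T : Finset D.C, (∀ c ∈ T, D.IsClassical c) ∧
      T.card = k ∧ ∀ c : D.C, ¬ (D.changeCrossings T).IsWarping a c} :=
    Nat.sInf_mem ⟨_, T₀, h1, rfl, h2⟩
  exact ⟨a, T, ha ▸ h⟩

/-- Crossings may be chosen such that they are first met at their over passages. -/
theorem descending_withKind {D : VirtualDiagram} {a : BasePointSequence D.next} {T : Finset D.C}
    (h : ∀ c : D.C, ¬ (D.changeCrossings T).IsWarping a c) {K : D.C → CrossingKind}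
    (hK : ∀ c, K c = (if time a (c, false) < time a (c, true) then .pos else .neg) ∨
      K c = (D.changeCrossings T).kind c) : Descending (withKind D K) (time a) where
  injective := time_injective a
  step := time_step a
  over_first := by
    rintro ⟨c, s⟩ (hp : (K c = .pos ∧ s = false) ∨ (K c = .neg ∧ s = true))
    have ne : time a (c, s) ≠ time a (oth (c, s)) := (time_injective a).ne (oth_ne (c, s)).symm
    rcases hK c with hc | hc
    · rw [hc] at hp
      split_ifs at hp with hl
      · obtain rfl : s = false := by simpa using hp
        exact hl
      · obtain rfl : s = true := by simpa using hp
        exact lt_of_le_of_ne (not_lt.1 hl) ne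
    · rw [hc] at hp
      refine lt_of_not_ge fun hl => ?_
      refine h c ⟨!s, isUnder_oth (D := D.changeCrossings T) (p := (c, s)) hp, before_iff.2 ?_⟩
      rw [Bool.not_not]
      exact lt_of_le_of_ne hl ne.symm

/-- A diagram with `v` virtual crossings is equivalent to a diagram that is unknottable by
virtualization of `v` crossings and as many crossing changes as the warping degree says. -/
theorem exists_isUnknottable (D : VirtualDiagram) :
    ∃ D', equivalence D D' ∧ D'.IsUnknottable D.numVirtual D.warpingDegree := by
  obtain ⟨a, T, hT, hd, hw⟩ := exists_warpingDegree D
  obtain ⟨R, hR, mem_R⟩ : ∃ R : Finset D.C, R.card = D.numVirtual ∧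
      ∀ c, c ∈ R ↔ D.kind c = .virt := by
    classical
    refine ⟨Finset.univ.filter fun c => D.kind c = .virt, ?_, fun c => by simp⟩
    rw [numVirtual, Nat.card_eq_fintype_card, Fintype.card_subtype]
  -- The sign for a virtual crossing puts its earlier passage over: in a positive crossing that is
  -- the passage labelled `false`.
  obtain ⟨D', g, S, heq, hg, hgk, hS, hSc, hgS, hK⟩ := exists_replace _ D _
    (fun c => if time a (c, false) < time a (c, true) then .pos else .neg) hR
    (fun c => by split_ifs <;> simp)
  have mem : ∀ c, g c ∈ T.map ⟨g, hg⟩ ↔ c ∈ T := fun c => Finset.mem_map' _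
  refine ⟨D', heq, S, T.map ⟨g, hg⟩, hSc, fun x hx => ?_, ?_, hS, ?_, ?_⟩
  · obtain ⟨c, hc, rfl⟩ := Finset.mem_map.1 hx
    exact fun e => hT c hc ((hgk c).symm.trans e)
  · refine Finset.disjoint_right.2 fun x hx => ?_
    obtain ⟨c, hc, rfl⟩ := Finset.mem_map.1 hx
    exact hgS c
  · rw [Finset.card_map, hd]
  -- The crossing changes are made at the copies of `T` in `D'`, away from `S`, so they commute with
  -- the replacement of the virtual crossings.
  have step := hK (D.changeCrossings T).kind ((D'.virtualize S).changeCrossings (T.map ⟨g, hg⟩)).kind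
    (fun c hc => by
      have hc := (mem_R c).1 hc
      simp [changeCrossings, hc, CrossingKind.change])
    (fun c => by simp [changeCrossings, virtualize, hgS, hgk])
    (fun x hx => by simp [changeCrossings, virtualize, hx, CrossingKind.change])
    (fun x hx hx' => by
      have : x ∉ T.map ⟨g, hg⟩ := fun h => by
        obtain ⟨c, -, rfl⟩ := Finset.mem_map.1 h
        exact hx' ⟨c, rfl⟩
      exact (if_neg this).trans (if_neg hx))
  have hT' : ∀ c, D.kind c ≠ .virt → (D.changeCrossings T).kind c ≠ .virt := fun c hc => by
    simp only [changeCrossings]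
    split_ifs
    exacts [change_ne_virt hc, hc]
  have hcl : ∀ c : D.C, (if c ∈ R then (if time a (c, false) < time a (c, true) then .pos else .neg)
      else (D.changeCrossings T).kind c) ≠ CrossingKind.virt := fun c => by
    by_cases h : c ∈ R
    · rw [if_pos h]
      split_ifs <;> exact CrossingKind.noConfusion
    · rw [if_neg h]
      exact hT' c ((mem_R c).not.1 h)
  suffices hs : IsTrivial _ from
    let ⟨D₀, h0, h1⟩ := hs
    ⟨D₀, h0, equivalence.trans step h1⟩
  refine Descending.isTrivial _ rfl (descending_withKind hw fun c => ?_) fun c => ?_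
  · by_cases h : c ∈ R
    exacts [.inl (if_pos h), .inr (if_neg h)]
  · exact hcl c

end PlaneCode

/-! ### Existence of the minima -/

theorem theorem2p6 (L : VirtualLink) (D : VirtualDiagram) (hD : D.IsDiagramOf L)
    (v : ℕ) (hv : D.numVirtual = v) :
    ∃ u : ℕ ×ₗ ℕ, L.IsUnknottingIndex u ∧ u ≤ toLex (v, D.warpingDegree) := by
  obtain ⟨D', h, hu⟩ := PlaneCode.exists_isUnknottable D
  rw [hv] at hu
  -- The well-order is used twice, first for the index of the diagram `D'` and then for the index of
  -- the link.
  have key : ∀ s : Set (ℕ ×ₗ ℕ), ∀ w ∈ s, ∃ u, IsLeast s u ∧ u ≤ w := fun s w hw =>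
    ⟨_, ⟨WellFounded.min_mem wellFounded_lt s ⟨w, hw⟩,
      fun _ hx => WellFounded.min_le wellFounded_lt hx⟩, WellFounded.min_le wellFounded_lt hw⟩
  obtain ⟨w, hw, hle⟩ := key {w | D'.IsUnknottable (ofLex w).1 (ofLex w).2}
    (toLex (v, D.warpingDegree)) hu
  obtain ⟨u, hu, hle'⟩ := key {w | ∃ D : VirtualDiagram, D.IsDiagramOf L ∧ D.IsUnknottingIndex w} w
    ⟨D', (Quotient.sound (VirtualDiagram.equivalence.symm h)).trans hD, hw⟩
  exact ⟨u, hu, hle'.trans hle⟩
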